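/- Let $K$ be a field, $X=\bigsqcup_{n\ge 1}X_n$ a positively graded set ($|x|=n$ for $x\in X_n$), and $\Theta:K[X]\to K[X]\otimes K[X]$ a graded coassociative coproduct (no counit is required), $\Theta(x)=\sum x_{(1)}\otimes x_{(2)}$. **The preshuffle bialgebra.** For $n\ge1$ let $\mathcal K_{n,X}$ be the set of tuples $(f;x_1,\dots,x_r)$ where $f:\{1,\dots,n\}\to\{1,\dots,r\}$ is surjective, $x_i\in X$ with $|x_i|=|f^{-1}(i)|$, and $f(i)=f(j)$, $i\le k\le j$ imply $f(k)\le f(i)$. Put $K[\mathcal K_\infty,X]=\bigoplus_{n\ge1}K[\mathcal K_{n,X}]$. For $f$ on $\{1,\dots,n\}$, $g$ on $\{1,\dots,m\}$ and $0\le i\le m$, $$(f;x_1,\dots,x_r)\bullet_i(g;y_1,\dots,y_k)=\big((g(1)+r,\dots,g(i)+r,f(1),\dots,f(n),g(i+1)+r,\dots,g(m)+r);x_1,\dots,x_r,y_1,\dots,y_k\big).$$ The product $\bullet_0$ is associative. The coproduct is $$\Delta_\Theta(f;x_1,\dots,x_r)=\sum_{i=1}^{n-1}\sum (f'_i;x_{1(1)},\dots,x_{r(1)})\otimes(f''_i;x_{1(2)},\dots,x_{r(2)}),$$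 where $f'_i,f''_i$ are the standardizations of $(f(1),\dots,f(i))$ and $(f(i+1),\dots,f(n))$ (the values that occur are renumbered $1,2,\dots$ increasingly), the inner sum is over the terms of $x_j\otimes1+1\otimes x_j+\Theta(x_j)$ with $|x_{j(1)}|=|f^{-1}(j)\cap\{1,\dots,i\}|$, and entries equal to $1$ are omitted. An element $z$ is primitive if $\Delta_\Theta(z)=0$. Let $\xi_{n_1,\dots,n_r}=(1,\dots,1,2,\dots,2,\dots,r,\dots,r)$, where $i$ occurs $n_i$ times, and for $x\in X_n$ $$e(x)=\sum_{r\ge1}(-1)^{r+1}\sum(\xi_{n_1,\dots,n_r};x_{(1)},\dots,x_{(r)}),\qquad n_i=|x_{(i)}|,$$ with the iterated coproducts of $\Theta$. **The operations.** For homogeneous $x_1,\dots,x_q,y,z$ and $1\le p\le|y|$, with $n=\sum_{i\ge1}|x_i|$ and $n_{\ge2}=\sum_{i\ge2}|x_i|$, put $$L_0^p(y;z)=z\bullet_py\ \ (p<|y|),\qquad L_0^{|y|}(y;z)=z\bullet_{|y|}y-y\bullet_0z,$$ $$L_q^p(x_1,\dots,x_q;y;z)=z\bullet_{p+n}(x_1\bullet_0\cdots\bullet_0x_q\bullet_0y)-x_1\bullet_0\big(z\bullet_{p+n_{\ge2}}(x_2\bullet_0\cdots\bullet_0x_q\bullet_0y)\big)\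 \ (q\ge1),$$ extended multilinearly. Let $\mathcal Prim_{psh}(X)$ be the smallest subspace of $K[\mathcal K_\infty,X]$ that contains $e(x)$ for all $x\in X$ and is closed under all $L_q^p$. **$Prim_{psh}$ algebras.** A $Prim_{psh}$ algebra is a graded vector space $V$ with degree-preserving multilinear operations $L_q^j:V^{\otimes q}\otimes V_m\otimes V\to V$ ($q\ge0$, $1\le j\le m$) satisfying, for homogeneous elements, the relations (a), (b) below. For $\mathbf x=(x_1,\dots,x_n)$ write $\mathbf x_{\le r}=(x_1,\dots,x_r)$, $\mathbf x_{>r}=(x_{r+1},\dots,x_n)$ and $n_{>r}=|x_{r+1}|+\dots+|x_n|$. Set $N^j(\mathbf x;y;z)=L_n^j(\mathbf x;y;z)$ and, for $l\ge2$, $$N^j(\mathbf x;y;z_1,\dots,z_l)=\sum_{p=0}^nL_p^{j+n_{>p}}\big(\mathbf x_{\le p};N^j(\mathbf x_{>p};y;z_2,\dots,z_l);z_1\big).$$ For $\mathbf z=(z_1,\dots,z_m)$, $m\ge0$, set $$\begin{aligned}R^{jk}(\mathbf x;y;\mathbf z;w;t)=&\sum_{r=0}^nL_r^{j+k+n_{>r}+|z_1|+\dots+|z_m|}\big(\mathbf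 x_{\le r};N^j(\mathbf x_{>r};y;z_1,\dots,z_m,w);t\big)\\&+\delta_{j,|y|}\Big(\sum_{l=1}^m\sum_{r=0}^nL_{r+1+m-l}^k\big(\mathbf x_{\le r},N^{j}(\mathbf x_{>r};y;z_1,\dots,z_l),z_{l+1},\dots,z_m;w;t\big)+L_{n+m+1}^k(\mathbf x,y,\mathbf z;w;t)\Big).\end{aligned}$$ (a) $L_n^j(\mathbf x;y;L_0^k(w;t))=R^{jk}(\mathbf x;y;\emptyset;w;t)-\delta_{k,|w|}\sum_{r=0}^nL_r^{j+n_{>r}}\big(\mathbf x_{\le r};L_{n-r}^j(\mathbf x_{>r};y;t);w\big)$; (b) for $m\ge1$, $L_n^j(\mathbf x;y;L_m^k(\mathbf z;w;t))=R^{jk}(\mathbf x;y;\mathbf z;w;t)-\sum_{r=0}^nL_r^{j+n_{>r}}\big(\mathbf x_{\le r};R^{jk}(\mathbf x_{>r};y;z_2,\dots,z_m;w;t);z_1\big)$. Homomorphisms are linear maps that preserve degrees and commute with all $L_q^j$. **Normal forms.** Let $\mathbb B$ be the set of formal expressions defined recursively: every $x\in X$ is in $\mathbb B$, of degree $|x|$;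 and $L_q^j(t_1,\dots,t_q;s;x)$ is in $\mathbb B$ for $q\ge0$, $t_1,\dots,t_q,s\in\mathbb B$, $x\in X$ and $1\le j\le|s|$, of degree $\sum|t_i|+|s|+|x|$. Put $\alpha(x)=(\xi_{|x|};x)$ and $$\alpha(L_q^j(t_1,\dots,t_q;s;x))=(\xi_{|x|};x)\bullet_{j+|t_1|+\dots+|t_q|}(\alpha(t_1)\bullet_0\cdots\bullet_0\alpha(t_q)\bullet_0\alpha(s)).$$ An element $(f;x_1,\dots,x_r)\in\mathcal K_{n,X}$ is irreducible if $f$ is not a concatenation $(g(1),\dots,g(i),h(1)+a,\dots,h(n-i)+a)$ with $1\le i\le n-1$ and $g$ with values in $\{1,\dots,a\}$, $h$ with values $\geq 1$. **Proposition.** 1. $\mathcal Prim_{psh}(X)$ is the space of all primitive elements of $K[\mathcal K_\infty,X]$. 2. $\mathcal Prim_{psh}(X)$, graded by degree and with the operations $L_q^p$, is a $Prim_{psh}$ algebra, and it is the free one on $X$: for every $Prim_{psh}$ algebra $W$ and every map $\varphi:X\to W$ with $\varphi(X_n)\subseteq W_n$ there is a unique homomorphism $\Phi:\mathcal Prim_{psh}(X)\to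 W$ with $\Phi(e(x))=\varphi(x)$ for all $x\in X$. 3. $\alpha$ is a degree-preserving bijection from $\mathbb B$ onto the set of irreducible elements of $\bigcup_{n\ge1}\mathcal K_{n,X}$, and the elements of $\mathbb B$, evaluated in $K[\mathcal K_\infty,X]$ with $x$ replaced by $e(x)$, form a basis of $\mathcal Prim_{psh}(X)$. -/

import Mathlib

universe u v w

namespace Presh

open scoped TensorProduct

noncomputable section

/-! ### Coloured maps

A map `f : {1, …, n} → {1, …, r}` is written as the list of its values; the letters are
`0, …, r - 1` instead of `1, …, r`. -/

/-- A word in the natural numbers together with a list of colours. -/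
@[ext]
structure ColWord (X : Type v) where
  word : List ℕ
  col : List X

variable {K : Type u} {X : Type v}

/-- The degree `n` of a coloured word `(f; x₁, …, x_r)` with `f : {1, …, n} → {1, …, r}`. -/
def ColWord.length (w : ColWord X) : ℕ := w.word.length

/-- `(f; x₁, …, x_r)` is an element of `𝒦_{n,X}` for some `n ≥ 1`: the values of `f` lie in a set
of `r` letters, `|xᵢ| = |f⁻¹(i)|`, and `f i = f j`, `i ≤ k ≤ j` imply `f k ≤ f i`.
Surjectivity of `f` is implied by the second condition when all colours have positive degree. -/
structure IsKWord (deg : X → ℕ) (w : ColWord X) : Prop where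
  ne_nil : w.word ≠ []
  lt_length : ∀ a ∈ w.word, a < w.col.length
  count_eq : ∀ (i : ℕ) (h : i < w.col.length), w.word.count i = deg w.col[i]
  le_of_between : ∀ (i k j : ℕ) (hik : i ≤ k) (hkj : k ≤ j) (hj : j < w.word.length),
    w.word[i] = w.word[j] → w.word[k] ≤ w.word[i]

/-- `f` is irreducible: it is not a concatenation `g × h = (g, h + r)`, where `g` takes its values
in the first `r` letters and `g`, `h` are maps on nonempty sets. -/
def IsIrr (f : List ℕ) : Prop :=
  ¬ ∃ (g h : List ℕ) (r : ℕ), g ≠ [] ∧ h ≠ [] ∧ (∀ a ∈ g, a < r) ∧ f = g ++ h.map (· + r)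

/-- The one-letter word `(ξ_n; x)`, `n = |x|`. -/
def corolla (deg : X → ℕ) (x : X) : ColWord X := ⟨List.replicate (deg x) 0, [x]⟩

/-- `ξ_{n₁, …, n_r}` with `nᵢ = |xᵢ|`, as a list of letters. -/
def xiList (deg : X → ℕ) : List X → List ℕ
  | [] => []
  | x :: xs => List.replicate (deg x) 0 ++ (xiList deg xs).map (· + 1)

/-- The coloured word `(ξ_{n₁, …, n_r}; x₁, …, x_r)`. -/
def xiWord (deg : X → ℕ) (xs : List X) : ColWord X := ⟨xiList deg xs, xs⟩

/-- `(f; x₁, …, x_r) •ᵢ (g; y₁, …, y_k)` is the word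
`(g 1 + r, …, g i + r, f 1, …, f n, g (i + 1) + r, …, g m + r)` with colours
`x₁, …, x_r, y₁, …, y_k`. It is used for `0 ≤ i ≤ m`. -/
def wordMul (i : ℕ) (p q : ColWord X) : ColWord X :=
  ⟨(q.word.take i).map (· + p.col.length) ++ p.word ++ (q.word.drop i).map (· + p.col.length),
    p.col ++ q.col⟩

/-! ### The space `K[𝒦_∞, X]`, its operations and its coproduct -/

/-- The vector space on all coloured words. It contains `K[𝒦_∞, X]` as a subspace, and the empty
word, which is a unit for `•₀`. -/
abbrev WordSpace (K : Type u) [Field K] (X : Type v) : Type max u v := ColWord X →₀ K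

variable [Field K]

/-- The subspace `K[𝒦_∞, X]`. -/
def kSpace (K : Type u) [Field K] (deg : X → ℕ) : Submodule K (WordSpace K X) :=
  Finsupp.supported K K {w | IsKWord deg w}

/-- The homogeneous elements of degree `n`. -/
def homog (K : Type u) [Field K] (X : Type v) (n : ℕ) : Submodule K (WordSpace K X) :=
  Finsupp.supported K K {w | w.length = n}

/-- The operation `•ᵢ`, the bilinear extension of `wordMul i`. -/
def bul (i : ℕ) : WordSpace K X →ₗ[K] WordSpace K X →ₗ[K] WordSpace K X :=
  Finsupp.linearCombination K fun p =>
    Finsupp.linearCombination K fun q => Finsupp.single (wordMul i p q) (1 : K)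

/-- A graded coassociative coproduct `Θ` on `K[X]`. The space `K[X]` is concentrated in positive
degrees, so that `Θ(x)` only has terms `a ⊗ b` with `|a|, |b| ≥ 1`. -/
structure GradedCoproduct (K : Type u) [Field K] {X : Type v} (deg : X → ℕ) where
  map : (X →₀ K) →ₗ[K] (X →₀ K) ⊗[K] (X →₀ K)
  graded : ∀ (x a b : X),
    finsuppTensorFinsupp' K X X (map (Finsupp.single x 1)) (a, b) ≠ 0 → deg a + deg b = deg x
  coassoc : (TensorProduct.assoc K (X →₀ K) (X →₀ K) (X →₀ K)).toLinearMap ∘ₗ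
    map.rTensor (X →₀ K) ∘ₗ map = map.lTensor (X →₀ K) ∘ₗ map

variable {deg : X → ℕ}

/-- The coefficients of `Θ(x)` in the basis `a ⊗ b`, `a, b ∈ X`, of `K[X] ⊗ K[X]`. -/
def GradedCoproduct.coeff (Θ : GradedCoproduct K deg) (x : X) : X × X →₀ K :=
  finsuppTensorFinsupp' K X X (Θ.map (Finsupp.single x 1))

/-- Standardization of a word: the letters that occur are renumbered `0, 1, 2, …` increasingly. -/
def stdize (p : List ℕ) : List ℕ := p.map fun a => (p.toFinset.filter (· < a)).card

/-- The part `∑ x₍₁₎ ⊗ x₍₂₎`, `|x₍₁₎| = m`, of `x ⊗ 1 + 1 ⊗ x + Θ(x)`; the unit is written as the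
empty list of colours. -/
def splitColor (Θ : GradedCoproduct K deg) (m : ℕ) (x : X) : List X × List X →₀ K :=
  if m = 0 then Finsupp.single ([], [x]) 1
  else if m = deg x then Finsupp.single ([x], []) 1
  else (Θ.coeff x).sum fun ab c => if deg ab.1 = m then Finsupp.single ([ab.1], [ab.2]) c else 0

/-- `∑ (x_{k(1)}, x_{k+1(1)}, …) ⊗ (x_{k(2)}, x_{k+1(2)}, …)`, where `|x_{j(1)}|` is the number of
letters `j` in the word `p`. -/
def splitColors (Θ : GradedCoproduct K deg) (p : List ℕ) : ℕ → List X → (List X × List X →₀ K)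
  | _, [] => Finsupp.single ([], []) 1
  | k, x :: xs => (splitColor Θ (p.count k) x).sum fun s c =>
      (splitColors Θ p (k + 1) xs).sum fun t d =>
        Finsupp.single (s.1 ++ t.1, s.2 ++ t.2) (c * d)

/-- The coproduct `Δ_Θ` on words: cut the word into two nonempty pieces, standardize both, and
distribute the colours by means of `Θ`. -/
def wordCoproduct (Θ : GradedCoproduct K deg) (w : ColWord X) :
    WordSpace K X ⊗[K] WordSpace K X :=
  ∑ i ∈ Finset.Ico 1 w.length,
    (splitColors Θ (w.word.take i) 0 w.col).sum fun s c =>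
      c • (Finsupp.single (⟨stdize (w.word.take i), s.1⟩ : ColWord X) (1 : K) ⊗ₜ[K]
        Finsupp.single (⟨stdize (w.word.drop i), s.2⟩ : ColWord X) (1 : K))

/-- The coproduct `Δ_Θ`. -/
def coproduct (Θ : GradedCoproduct K deg) :
    WordSpace K X →ₗ[K] WordSpace K X ⊗[K] WordSpace K X :=
  Finsupp.linearCombination K (wordCoproduct Θ)

/-- The space of primitive elements of `K[𝒦_∞, X]`. -/
def primitives (Θ : GradedCoproduct K deg) : Submodule K (WordSpace K X) :=
  kSpace K deg ⊓ LinearMap.ker (coproduct Θ)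

/-! ### The operations `L_q^p` -/

/-- `x₁ •₀ x₂ •₀ ⋯ •₀ x_q` (the empty word for `q = 0`). -/
def concat (xs : List (WordSpace K X)) : WordSpace K X :=
  xs.foldr (fun x y => bul 0 x y) (Finsupp.single ⟨[], []⟩ 1)

/-- `z •_{p + n} (x₁ •₀ ⋯ •₀ x_q •₀ y)` where `n = |x₁| + ⋯ + |x_q|`, extended linearly in
`x₁ •₀ ⋯ •₀ x_q` to elements that are not homogeneous. -/
def insertAfter (xs : List (WordSpace K X)) (p : ℕ) (y z : WordSpace K X) : WordSpace K X :=
  Finsupp.linearCombination K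
    (fun t : ColWord X => bul (p + t.length) z (bul 0 (Finsupp.single t (1 : K)) y)) (concat xs)

/-- `L_q^p(x₁, …, x_q; y; z)`, used for `1 ≤ p ≤ |y|`:
* `z •_p y` for `q = 0` and `p < |y|`;
* `z •_p y - y •₀ z` for `q = 0` and `p = |y|`;
* `z •_{p + n} (x₁ •₀ ⋯ •₀ x_q •₀ y) - x₁ •₀ (z •_{p + n'} (x₂ •₀ ⋯ •₀ x_q •₀ y))` for `q ≥ 1`, with
  `n = |x₁| + ⋯ + |x_q|` and `n' = |x₂| + ⋯ + |x_q|`. -/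
def primOp : List (WordSpace K X) → ℕ → WordSpace K X → WordSpace K X → WordSpace K X
  | [], p, y, z => bul p z y -
      Finsupp.linearCombination K
        (fun t : ColWord X => if p = t.length then bul 0 (Finsupp.single t (1 : K)) z else 0) y
  | x :: xs, p, y, z => insertAfter (x :: xs) p y z - bul 0 x (insertAfter xs p y z)

/-- `∑ x₍₁₎ ⊗ ⋯ ⊗ x₍r₊₁₎`, the `r`-fold iterate of `Θ` at `x`. -/
def iterCoproduct (Θ : GradedCoproduct K deg) : ℕ → X → (List X →₀ K)
  | 0, x => Finsupp.single [x] 1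
  | r + 1, x => (Θ.coeff x).sum fun ab c =>
      c • (iterCoproduct Θ r ab.1).mapDomain fun l => l ++ [ab.2]

/-- The element `e(ξ_n; x) = (ξ_n; x) - ∑ (ξ_{n₁,n₂}; x₍₁₎, x₍₂₎) + ⋯`; the terms with more than
`|x|` factors vanish. -/
def eElt (Θ : GradedCoproduct K deg) (x : X) : WordSpace K X :=
  ∑ r ∈ Finset.range (deg x), (-1 : K) ^ r • (iterCoproduct Θ r x).mapDomain (xiWord deg)

/-- A subspace is closed under the operations `L_q^p`. -/
def ClosedUnderPrimOp (S : Submodule K (WordSpace K X)) : Prop :=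
  ∀ (xs : List (WordSpace K X)) (m p : ℕ) (y z : WordSpace K X),
    (∀ x ∈ xs, x ∈ S) → y ∈ S → y ∈ homog K X m → 1 ≤ p → p ≤ m → z ∈ S → primOp xs p y z ∈ S

/-- `𝒫rim_psh(X)`: the smallest subspace that contains all `e(ξ_n; x)` and is closed under the
operations `L_q^p`. -/
def primPsh (Θ : GradedCoproduct K deg) : Submodule K (WordSpace K X) :=
  sInf {S | (∀ x, eElt Θ x ∈ S) ∧ ClosedUnderPrimOp S}

theorem eElt_mem (Θ : GradedCoproduct K deg) (x : X) : eElt Θ x ∈ primPsh Θ :=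
  Submodule.mem_sInf.2 fun _ hS => hS.1 x

/-! ### `Prim_psh` algebras

In the relations a homogeneous element is given together with its degree, as a pair in `ℕ × V`. -/

section Relations

variable {V : Type w} [AddCommGroup V]

/-- The elements of a list of pairs (degree, element). -/
def elts (xs : List (ℕ × V)) : List V := xs.map Prod.snd

/-- The total degree of a list of pairs (degree, element). -/
def degs (xs : List (ℕ × V)) : ℕ := (xs.map Prod.fst).sum

/-- `∑ L_{p₁}^{j + n_{> p₁}}(x₁, …; L_{p₂}^{…}(…; ⋯ L_{p_l}^j(…, x_n; y; z_l) ⋯; z₂); z₁)`, the sum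
over all `(p₁, …, p_l)` with `pᵢ ≥ 0` and `p₁ + ⋯ + p_l = n`, for `l ≥ 1`. -/
def nest (L : List V → ℕ → V → V → V) (j : ℕ) (y : V) : List (ℕ × V) → List V → V
  | _, [] => y
  | xs, [z] => L (elts xs) j y z
  | xs, z :: z' :: zs => ∑ p ∈ Finset.range (xs.length + 1),
      L (elts (xs.take p)) (j + degs (xs.drop p)) (nest L j y (xs.drop p) (z' :: zs)) z

/-- The common part of the two relations. With `x = (x₁, …, x_n)`, `z = (z₁, …, z_m)` (`m ≥ 0`),
`N_l(x; y; z₁, …, z_l)` the element `nest`, and `d = |y|`, it is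
`∑_r L_r(x₁, …, x_r; N_{m+1}(x_{r+1}, …, x_n; y; z₁, …, z_m, w); t)` plus, if `j = |y|`,
`∑_{1 ≤ l ≤ m} ∑_r L^k(x₁, …, x_r, N_l(x_{r+1}, …, x_n; y; z₁, …, z_l), z_{l+1}, …, z_m; w; t)`
`+ L^k(x₁, …, x_n, y, z₁, …, z_m; w; t)`. -/
def relSum (L : List V → ℕ → V → V → V) (j k d : ℕ) (xs : List (ℕ × V)) (y : V)
    (zs : List (ℕ × V)) (w t : V) : V :=
  (∑ r ∈ Finset.range (xs.length + 1),
    L (elts (xs.take r)) (j + k + degs (xs.drop r) + degs zs)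
      (nest L j y (xs.drop r) (elts zs ++ [w])) t) +
  if j = d then
    (∑ l ∈ Finset.Icc 1 zs.length, ∑ r ∈ Finset.range (xs.length + 1),
      L (elts (xs.take r) ++ nest L j y (xs.drop r) (elts (zs.take l)) :: elts (zs.drop l))
        k w t) +
    L (elts xs ++ y :: elts zs) k w t
  else 0

end Relations

/-- A `Prim_psh` algebra: a graded vector space with multilinear operations
`L_q^j : V^{⊗ q} ⊗ V_m ⊗ V → V`, `q ≥ 0`, `1 ≤ j ≤ m`, of degree zero, subject to two families of
relations, which express `L_n^j(x₁, …, x_n; y; L_m^k(z₁, …, z_m; w; t))` for `m = 0` and `m ≥ 1`.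
The value `L xs j y z` is only used for `y` homogeneous of a degree `m` with `1 ≤ j ≤ m`. -/
structure PrimPshAlgebra (K : Type u) [Field K] (V : Type w) [AddCommGroup V] [Module K V] where
  gr : ℕ → Submodule K V
  isInternal : DirectSum.IsInternal gr
  L : List V → ℕ → V → V → V
  add_left : ∀ (xs xs' : List V) (a b : V) (m j : ℕ) (y z : V), y ∈ gr m → 1 ≤ j → j ≤ m →
    L (xs ++ (a + b) :: xs') j y z = L (xs ++ a :: xs') j y z + L (xs ++ b :: xs') j y z
  smul_left : ∀ (xs xs' : List V) (c : K) (a : V) (m j : ℕ) (y z : V), y ∈ gr m → 1 ≤ j → j ≤ m →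
    L (xs ++ (c • a) :: xs') j y z = c • L (xs ++ a :: xs') j y z
  add_mid : ∀ (xs : List V) (m j : ℕ) (y y' z : V), y ∈ gr m → y' ∈ gr m → 1 ≤ j → j ≤ m →
    L xs j (y + y') z = L xs j y z + L xs j y' z
  smul_mid : ∀ (xs : List V) (m j : ℕ) (c : K) (y z : V), y ∈ gr m → 1 ≤ j → j ≤ m →
    L xs j (c • y) z = c • L xs j y z
  add_right : ∀ (xs : List V) (m j : ℕ) (y z z' : V), y ∈ gr m → 1 ≤ j → j ≤ m →
    L xs j y (z + z') = L xs j y z + L xs j y z'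
  smul_right : ∀ (xs : List V) (m j : ℕ) (c : K) (y z : V), y ∈ gr m → 1 ≤ j → j ≤ m →
    L xs j y (c • z) = c • L xs j y z
  mem_gr : ∀ (xs : List (ℕ × V)) (m j r : ℕ) (y z : V), (∀ x ∈ xs, x.2 ∈ gr x.1) → y ∈ gr m →
    1 ≤ j → j ≤ m → z ∈ gr r → L (elts xs) j y z ∈ gr (degs xs + m + r)
  rel_zero : ∀ (xs : List (ℕ × V)) (d e f j k : ℕ) (y w t : V), (∀ x ∈ xs, x.2 ∈ gr x.1) →
    y ∈ gr d → w ∈ gr e → t ∈ gr f → 1 ≤ j → j ≤ d → 1 ≤ k → k ≤ e →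
    L (elts xs) j y (L [] k w t) = relSum L j k d xs y [] w t -
      if k = e then ∑ r ∈ Finset.range (xs.length + 1),
        L (elts (xs.take r)) (j + degs (xs.drop r)) (L (elts (xs.drop r)) j y t) w
      else 0
  rel_succ : ∀ (xs : List (ℕ × V)) (z : ℕ × V) (zs : List (ℕ × V)) (d e f j k : ℕ) (y w t : V),
    (∀ x ∈ xs, x.2 ∈ gr x.1) → (∀ x ∈ z :: zs, x.2 ∈ gr x.1) →
    y ∈ gr d → w ∈ gr e → t ∈ gr f → 1 ≤ j → j ≤ d → 1 ≤ k → k ≤ e →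
    L (elts xs) j y (L (elts (z :: zs)) k w t) = relSum L j k d xs y (z :: zs) w t -
      ∑ r ∈ Finset.range (xs.length + 1),
        L (elts (xs.take r)) (j + degs (xs.drop r)) (relSum L j k d (xs.drop r) y zs w t) z.2

/-- Homomorphisms of `Prim_psh` algebras: linear maps that preserve degrees and operations. -/
structure PrimPshAlgebra.IsHom {V : Type*} {W : Type*} [AddCommGroup V] [Module K V]
    [AddCommGroup W] [Module K W] (A : PrimPshAlgebra K V) (B : PrimPshAlgebra K W)
    (φ : V →ₗ[K] W) : Prop where
  map_gr : ∀ (n : ℕ) (x : V), x ∈ A.gr n → φ x ∈ B.gr n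
  map_op : ∀ (xs : List V) (m j : ℕ) (y z : V), y ∈ A.gr m → 1 ≤ j → j ≤ m →
    φ (A.L xs j y z) = B.L (xs.map φ) j (φ y) (φ z)

/-! ### The set `𝔹` and the bijection with irreducible elements -/

/-- Formal expressions `x` and `L_q^j(t₁, …, t_q; s; x)` with `x ∈ X`. -/
inductive NormalForm (X : Type v) : Type v
  | gen (x : X) : NormalForm X
  | op (q : ℕ) (ts : Fin q → NormalForm X) (s : NormalForm X) (j : ℕ) (x : X) : NormalForm X

/-- The degree of an expression. -/
def NormalForm.degree (deg : X → ℕ) : NormalForm X → ℕ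
  | .gen x => deg x
  | .op _ ts s _ x => (∑ i, (ts i).degree deg) + s.degree deg + deg x

/-- The elements of `𝔹`: the expressions all of whose upper indices satisfy `1 ≤ j ≤ |s|`. -/
def NormalForm.IsLegal (deg : X → ℕ) : NormalForm X → Prop
  | .gen _ => True
  | .op _ ts s j _ => (∀ i, (ts i).IsLegal deg) ∧ s.IsLegal deg ∧ 1 ≤ j ∧ j ≤ s.degree deg

/-- The map `α`: `α(x) = (ξ_{|x|}; x)` and
`α(L_q^j(t₁, …, t_q; s; x)) = (ξ_{|x|}; x) •_{j + n} (α(t₁) •₀ ⋯ •₀ α(t_q) •₀ α(s))`, where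
`n = |t₁| + ⋯ + |t_q|`. -/
def NormalForm.alpha (deg : X → ℕ) : NormalForm X → ColWord X
  | .gen x => corolla deg x
  | .op _ ts s j x => wordMul (j + ∑ i, (ts i).degree deg) (corolla deg x)
      ((List.ofFn fun i => (ts i).alpha deg).foldr (wordMul 0) (s.alpha deg))

/-- The value of an expression in `K[𝒦_∞, X]`, where `x ∈ X` stands for `e(ξ_{|x|}; x)`. -/
def NormalForm.eval (Θ : GradedCoproduct K deg) : NormalForm X → WordSpace K X
  | .gen x => eElt Θ x
  | .op _ ts s j x => primOp (List.ofFn fun i => (ts i).eval Θ) j (s.eval Θ) (eElt Θ x)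

end

end Presh

namespace Presh
open scoped TensorProduct
noncomputable section
variable {K : Type u} {X : Type v}

/-! The proof finds a basis of the space of words that consists of products, under `•₀`, of values
of normal forms, and reads the three statements off from it.

Words. The smallest letter of a word fills a single block, so a nonempty word is `(ξ; x) •_J u` for
unique `x`, `J`, `u`, and `u` is a product of irreducible words in exactly one way. Recursively,
irreducible words correspond to normal forms (`bijOn_alpha`), and words to lists of normal forms
(`listWord_injective`).

Basis. In `(ξ; x) •_J u` one replaces `(ξ; x)` by `e(x) + ∑ e(x₍₁₎) •₀ (ξ; x₍₂₎)`. The insertion of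
an `e(x)` into a product of values is again a sum of products of values by `bul_concat_eq`, so these
products span (`single_mem_goodSpan`). In bounded degree, with colours in a finite set closed under
`Θ`, a finite number of products spans at least as many distinct words, so the products are
independent (`linearIndependent_evalList`).

Primitive elements. Coassociativity makes `e(x)` primitive (`eElt_mem_primitives`), and the
operations preserve primitivity (`primOp_mem_primitives`). Hence the coproduct deconcatenates
products of values, and a primitive element only involves products with a single factor. So the
primitive elements, `primPsh Θ` and the span of the values of normal forms coincide.

Relations. A primitive element that is a sum of products vanishes (`eq_zero_of_mem_decomposables`),
so the relations may be checked modulo products. There `L_n^j(x₁, …, x_n; y; z)` is the insertion `z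
•_{j + |x₁| + ⋯ + |x_n|} (x₁ •₀ ⋯ •₀ x_n •₀ y)`, and the relations follow from `(a •_i b) •_j c = a
•_{i+j} (b •_j c)`.

Freeness. A linear map `Φ` is prescribed on the basis of normal forms. The elements `z` for which
`Φ` commutes with all operations with last argument `z` form a subspace. It contains `e(x)`, because
`L(t₁, …, t_q; s; e(x))` is a basis vector for normal forms `tᵢ`, `s`; by the relations it is closed
under the operations (`op_mem_commuting`), so it is everything. -/

/-! ### Combinatorics of coloured words -/

/-- The defining conditions of `𝒦_{n,X}` with the empty word allowed. -/
structure Admissible (deg : X → ℕ) (w : ColWord X) : Prop where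
  count : ∀ i, w.word.count i = (w.col[i]?).elim 0 deg
  le_of_sublist : ∀ a b, [a, b, a].Sublist w.word → b ≤ a

theorem sublist_of_getElem {l : List ℕ} {i k j : ℕ} (hik : i < k) (hkj : k < j)
    (hj : j < l.length) : [l[i], l[k], l[j]].Sublist l := by
  have h1 : l = l.take k ++ l.drop k := (List.take_append_drop k l).symm
  have h2 : [l[i]].Sublist (l.take k) := by
    rw [List.singleton_sublist, List.mem_take_iff_getElem]
    exact ⟨i, by omega, rfl⟩
  have h3 : [l[k], l[j]].Sublist (l.drop k) := by
    rw [List.drop_eq_getElem_cons (by omega)]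
    refine List.Sublist.cons_cons _ ?_
    rw [List.singleton_sublist, List.mem_drop_iff_getElem]
    exact ⟨j - (k + 1), by omega, by congr 1; omega⟩
  have := h2.append h3
  rwa [← h1] at this

theorem exists_getElem_of_sublist {l : List ℕ} {a b c : ℕ} (h : [a, b, c].Sublist l) :
    ∃ (i k j : ℕ) (hik : i < k) (hkj : k < j) (hj : j < l.length),
      l[i] = a ∧ l[k] = b ∧ l[j] = c := by
  obtain ⟨f, hf⟩ := List.sublist_iff_exists_fin_orderEmbedding_get_eq.1 h
  refine ⟨f ⟨0, by simp⟩, f ⟨1, by simp⟩, f ⟨2, by simp⟩, ?_, ?_, (f ⟨2, by simp⟩).2, ?_, ?_, ?_⟩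
  · exact f.lt_iff_lt.2 (by simp)
  · exact f.lt_iff_lt.2 (by simp)
  · exact (hf ⟨0, by simp⟩).symm
  · exact (hf ⟨1, by simp⟩).symm
  · exact (hf ⟨2, by simp⟩).symm

/-- Avoiding the subsequences `a b a` with `b > a` passes to sublists, filters and shifts without
index arithmetic. A letter that is not an index of a colour has multiplicity `0`, so one count
condition also bounds the letters. -/
theorem isKWord_iff {deg : X → ℕ} {w : ColWord X} :
    IsKWord deg w ↔ Admissible deg w ∧ w.word ≠ [] := by
  constructor
  · intro h
    refine ⟨⟨fun i => ?_, fun a b hab => ?_⟩, h.ne_nil⟩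
    · by_cases hi : i < w.col.length
      · rw [h.count_eq i hi, List.getElem?_eq_getElem hi]; rfl
      · rw [List.getElem?_eq_none (by omega)]
        exact List.count_eq_zero.2 fun hm => hi (h.lt_length i hm)
    · obtain ⟨i, k, j, hik, hkj, hj, rfl, rfl, h3⟩ := exists_getElem_of_sublist hab
      exact h.le_of_between i k j hik.le hkj.le hj h3.symm
  · rintro ⟨h, hne⟩
    refine ⟨hne, fun a ha => ?_, fun i hi => ?_, fun i k j hik hkj hj hij => ?_⟩
    · by_contra hc
      have := h.count a
      rw [List.getElem?_eq_none (by omega)] at this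
      exact List.count_eq_zero.1 this ha
    · rw [h.count i, List.getElem?_eq_getElem hi]; rfl
    · rcases hik.eq_or_lt with rfl | hik
      · exact le_rfl
      rcases hkj.eq_or_lt with rfl | hkj
      · exact hij.ge
      refine h.le_of_sublist _ _ ?_
      have := sublist_of_getElem hik hkj hj
      rwa [← hij] at this

theorem IsKWord.admissible {deg : X → ℕ} {w : ColWord X} (h : IsKWord deg w) :
    Admissible deg w := (isKWord_iff.1 h).1

theorem Admissible.lt_length {deg : X → ℕ} {w : ColWord X} (h : Admissible deg w) {a : ℕ}
    (ha : a ∈ w.word) : a < w.col.length := by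
  by_contra hc
  have := h.count a
  rw [List.getElem?_eq_none (by omega)] at this
  exact List.count_eq_zero.1 this ha

/-- Surjectivity of `f` enters here, through the positivity of the degrees. -/
theorem Admissible.mem_iff {deg : X → ℕ} (hdeg : ∀ x, 1 ≤ deg x) {w : ColWord X}
    (h : Admissible deg w) {a : ℕ} : a ∈ w.word ↔ a < w.col.length := by
  refine ⟨h.lt_length, fun ha => ?_⟩
  have := h.count a
  rw [List.getElem?_eq_getElem ha] at this
  have h1 := hdeg w.col[a]
  exact List.count_pos_iff.1 (by simp only [Option.elim] at this; omega)

theorem Admissible.col_eq_nil {deg : X → ℕ} (hdeg : ∀ x, 1 ≤ deg x) {w : ColWord X}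
    (h : Admissible deg w) (hw : w.word = []) : w = ⟨[], []⟩ := by
  ext1
  · exact hw
  · by_contra hc
    have := (h.mem_iff hdeg (a := 0)).2 (List.length_pos_iff.2 hc)
    simp [hw] at this

theorem admissible_nil {deg : X → ℕ} : Admissible deg (⟨[], []⟩ : ColWord X) :=
  ⟨fun i => by simp, fun a b h => by simp at h⟩

theorem admissible_corolla (deg : X → ℕ) (x : X) : Admissible deg (corolla deg x) := by
  refine ⟨fun i => ?_, fun a b h => ?_⟩
  · rcases i with _ | i
    · simp [corolla]
    · simp [corolla, List.count_replicate]
  · have h1 : b ∈ (corolla deg x).word := h.subset (by simp)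
    simp only [corolla, List.mem_replicate] at h1
    omega

@[simp] theorem length_corolla (deg : X → ℕ) (x : X) : (corolla deg x).length = deg x := by
  simp [corolla, ColWord.length]

@[simp] theorem length_wordMul (i : ℕ) (p q : ColWord X) :
    (wordMul i p q).length = p.length + q.length := by
  have : (q.word.take i).length + (q.word.drop i).length = q.word.length := by
    rw [← List.length_append, List.take_append_drop]
  simp only [wordMul, ColWord.length, List.length_append, List.length_map]
  omega

@[simp] theorem wordMul_nil_left (i : ℕ) (q : ColWord X) : wordMul i ⟨[], []⟩ q = q := by
  simp [wordMul]

@[simp] theorem wordMul_nil_right (i : ℕ) (p : ColWord X) : wordMul i p ⟨[], []⟩ = p := by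
  simp [wordMul]

theorem wordMul_zero (p q : ColWord X) :
    wordMul 0 p q = ⟨p.word ++ q.word.map (· + p.col.length), p.col ++ q.col⟩ := by
  simp [wordMul]

/-- The block of `a` starts after `i` letters of `b`, and the block of `b` after `j` letters of `c`;
so `a` starts after `i + j` letters on both sides. The bounds keep `take` from truncating. -/
theorem wordMul_wordMul {i j : ℕ} {a b c : ColWord X} (hi : i ≤ b.length) (hj : j ≤ c.length) :
    wordMul j (wordMul i a b) c = wordMul (i + j) a (wordMul j b c) := by
  unfold ColWord.length at hi hj
  have h1 : (c.word.take j).length = j := by simp [hj]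
  ext1
  · simp only [wordMul, List.take_append, List.drop_append, List.map_append, List.length_append,
      List.length_map, h1]
    have h2 : i + j - j = i := by omega
    have h3 : i + j - (j + b.word.length) = 0 := by omega
    have h4 : (c.word.take j).take (i + j) = c.word.take j := by
      rw [List.take_take]; congr 1; omega
    have h5 : (c.word.take j).drop (i + j) = [] := by
      apply List.drop_eq_nil_of_le; omega
    simp only [← List.map_take, ← List.map_drop, h2, h3, h4, h5, List.take_zero, List.drop_zero,
      List.map_nil, List.append_nil, List.nil_append, List.map_map, List.append_assoc]
    have h6 : ((fun x => x + a.col.length) ∘ fun x => x + b.col.length) =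
        fun x => x + (a.col.length + b.col.length) := by
      funext x; simp only [Function.comp]; omega
    rw [h6]
  · simp [wordMul]

theorem wordMul_assoc (a b c : ColWord X) :
    wordMul 0 (wordMul 0 a b) c = wordMul 0 a (wordMul 0 b c) :=
  wordMul_wordMul (Nat.zero_le _) (Nat.zero_le _)

theorem wordMul_wordMul_zero {i : ℕ} {a b c : ColWord X} (hi : i ≤ b.length) :
    wordMul i a (wordMul 0 b c) = wordMul 0 (wordMul i a b) c := by
  unfold ColWord.length at hi
  have h1 : i - b.word.length = 0 := by omega
  ext1
  · simp [wordMul, List.take_append, List.drop_append, h1, Function.comp_def]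
    intros; omega
  · simp [wordMul]

theorem sublist_mid {L : List ℕ} {p : ℕ → Bool} {a b : ℕ} (h : [a, b, a].Sublist L)
    (ha : p a) (hb : p b) : [a, b, a].Sublist (L.filter p) := by
  have := h.filter p
  simpa [ha, hb] using this

theorem Admissible.wordMul {deg : X → ℕ} {p q : ColWord X} (hp : Admissible deg p)
    (hq : Admissible deg q) (i : ℕ) : Admissible deg (wordMul i p q) := by
  set r := p.col.length with hr
  set u := (q.word.take i).map (· + r) with hu
  set v := (q.word.drop i).map (· + r) with hv
  have hw : (Presh.wordMul i p q).word = u ++ p.word ++ v := rfl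
  have hge : ∀ a ∈ u ++ v, r ≤ a := by
    intro a ha
    simp only [hu, hv, List.mem_append, List.mem_map] at ha
    rcases ha with ⟨b, -, rfl⟩ | ⟨b, -, rfl⟩ <;> omega
  have hlt : ∀ a ∈ p.word, a < r := fun a ha => hp.lt_length ha
  have huv : u ++ v = q.word.map (· + r) := by
    rw [hu, hv, ← List.map_append, List.take_append_drop]
  have hcount : ∀ a, (u ++ v).count a = if a < r then 0 else q.word.count (a - r) := by
    intro a
    split_ifs with h
    · exact List.count_eq_zero.2 fun hm => by have := hge a hm; omega
    · rw [huv]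
      conv_lhs => rw [show a = (a - r) + r by omega]
      exact List.count_map_of_injective _ (· + r) (fun x y h => by simpa using h) _
  refine ⟨fun a => ?_, fun a b hab => ?_⟩
  · have h1 : (u ++ p.word ++ v).count a = (u ++ v).count a + p.word.count a := by
      simp only [List.count_append]; omega
    rw [hw, h1, hcount]
    simp only [Presh.wordMul]
    split_ifs with h
    · rw [hp.count a, List.getElem?_append_left h, zero_add]
    · rw [hq.count, hp.count, List.getElem?_append_right (by omega),
        List.getElem?_eq_none (l := p.col) (by omega)]
      simp [hr]
  · rw [hw] at hab
    by_cases ha : a < r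
    · by_cases hb : b < r
      · have h1 := sublist_mid (p := fun c => decide (c < r)) hab (by simpa) (by simpa)
        rw [List.filter_append, List.filter_append, List.filter_eq_nil_iff.2,
          List.filter_eq_self.2, List.filter_eq_nil_iff.2] at h1
        · exact hp.le_of_sublist _ _ (by simpa using h1)
        · intro c hc; have := hge c (by simp [hc]); simp; omega
        · intro c hc; simpa using hlt c hc
        · intro c hc; have := hge c (by simp [hc]); simp; omega
      -- Both letters `a` belong to the contiguous block `p.word`, so `b` lies in that block as
      -- well, contrary to `b ≥ r`.
      · exfalso
        obtain ⟨l1, l2, h12, h1, h2⟩ := List.sublist_append_iff.1 hab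
        obtain ⟨l3, l4, h34, h3, h4⟩ := List.sublist_append_iff.1 h1
        have h30 : l3 = [] := by
          rcases l3 with _ | ⟨c, l3⟩
          · rfl
          · have : c = a := by
              rw [h34] at h12; simp at h12; exact h12.1.symm
            have h5 := hge c (by have := h3.subset (List.mem_cons_self); simp [this])
            omega
        have h20 : l2 = [] := by
          rcases List.eq_nil_or_concat l2 with h | ⟨l, c, rfl⟩
          · exact h
          · have : c = a := by
              have := congrArg List.getLast? h12
              simp at this; exact this.symm
            have h5 := hge c (by have : c ∈ v := h2.subset (by simp)
                                 simp [this])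
            omega
        subst h30 h20
        have : b ∈ l4 := by
          rw [h34] at h12; simp at h12; rw [← h12]; simp
        exact hb (hlt b (h4.subset this))
    · by_cases hb : b < r
      · omega
      · have h1 := sublist_mid (p := fun c => decide (r ≤ c)) hab (by simp; omega) (by simp; omega)
        rw [List.filter_append, List.filter_append, List.filter_eq_self.2,
          List.filter_eq_nil_iff.2, List.filter_eq_self.2, List.append_nil, huv] at h1
        · have h2 : [a - r, b - r, a - r].Sublist q.word := by
            have := h1.map (· - r)
            simpa [Function.comp_def] using this
          have := hq.le_of_sublist _ _ h2
          omega
        · intro c hc; have := hge c (by simp [hc]); simpa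
        · intro c hc; have := hlt c hc; simp; omega
        · intro c hc; have := hge c (by simp [hc]); simpa

theorem IsKWord.wordMul {deg : X → ℕ} {p q : ColWord X} (hp : IsKWord deg p)
    (hq : IsKWord deg q) (i : ℕ) : IsKWord deg (wordMul i p q) :=
  isKWord_iff.2 ⟨hp.admissible.wordMul hq.admissible i, by
    have := hp.ne_nil
    simp [Presh.wordMul, this]⟩

end
end Presh

namespace Presh
open scoped TensorProduct
noncomputable section
variable {K : Type u} {X : Type v}
variable [Field K] {deg : X → ℕ}

/-! ### Bilinear identities -/

/-- With `s` a condition on the length or the shape of words, this reduces multilinear statements to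
single words. -/
theorem supported_induction {ι : Type*} {s : Set ι}
    {p : (v : ι →₀ K) → v ∈ Finsupp.supported K K s → Prop}
    (single : ∀ i (hi : i ∈ s), p (Finsupp.single i 1) (Finsupp.single_mem_supported K 1 hi))
    (zero : p 0 (zero_mem _))
    (add : ∀ x y hx hy, p x hx → p y hy → p (x + y) (add_mem hx hy))
    (smul : ∀ (c : K) x hx, p x hx → p (c • x) (Submodule.smul_mem _ c hx))
    {v : ι →₀ K} (hv : v ∈ Finsupp.supported K K s) : p v hv := by
  suffices h : ∃ h, p v h from h.2
  have hv' := hv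
  rw [Finsupp.supported_eq_span_single] at hv'
  refine Submodule.span_induction (p := fun v _ => ∃ h, p v h) ?_ ⟨_, zero⟩
    (fun x y _ _ hx hy => ⟨_, add x y _ _ hx.2 hy.2⟩)
    (fun c x _ hx => ⟨_, smul c x _ hx.2⟩) hv'
  rintro _ ⟨i, hi, rfl⟩
  exact ⟨_, single i hi⟩

theorem single_mem_homog (w : ColWord X) : Finsupp.single w (1 : K) ∈ homog K X w.length :=
  Finsupp.single_mem_supported K 1 rfl

theorem single_mem_kSpace {w : ColWord X} (h : IsKWord deg w) :
    Finsupp.single w (1 : K) ∈ kSpace K deg :=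
  Finsupp.single_mem_supported K 1 h

theorem wordSpace_induction {p : WordSpace K X → Prop}
    (single : ∀ i, p (Finsupp.single i 1)) (zero : p 0)
    (add : ∀ x y, p x → p y → p (x + y)) (smul : ∀ (c : K) x, p x → p (c • x))
    (v : WordSpace K X) : p v :=
  supported_induction (s := Set.univ) (p := fun v _ => p v) (fun i _ => single i) zero
    (fun x y _ _ => add x y) (fun c x _ => smul c x) (by simp)

@[simp] theorem bul_single (i : ℕ) (p q : ColWord X) :
    bul i (Finsupp.single p (1 : K)) (Finsupp.single q 1) = Finsupp.single (wordMul i p q) 1 := by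
  simp [bul]

/-- The empty word. -/
def unit : WordSpace K X := Finsupp.single ⟨[], []⟩ 1

@[simp] theorem bul_unit_left (i : ℕ) (q : WordSpace K X) : bul i unit q = q := by
  induction q using wordSpace_induction with
  | single w => simp [unit]
  | zero => simp
  | add x y hx hy => simp [hx, hy]
  | smul c x hx => simp [hx]

@[simp] theorem bul_unit_right (i : ℕ) (q : WordSpace K X) : bul i q unit = q := by
  induction q using wordSpace_induction with
  | single w => simp [unit]
  | zero => simp
  | add x y hx hy => simp [hx, hy]
  | smul c x hx => simp [hx]

theorem bul_assoc (a b c : WordSpace K X) :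
    bul 0 (bul 0 a b) c = bul 0 a (bul 0 b c) := by
  induction a using wordSpace_induction with
  | single a =>
    induction b using wordSpace_induction with
    | single b =>
      induction c using wordSpace_induction with
      | single c => simp [wordMul_assoc]
      | zero => simp
      | add x y hx hy => simp only [map_add, hx, hy]
      | smul c x hx => simp only [map_smul, hx]
    | zero => simp
    | add x y hx hy => simp only [map_add, LinearMap.add_apply, hx, hy]
    | smul c x hx => simp only [map_smul, LinearMap.smul_apply, hx]
  | zero => simp
  | add x y hx hy => simp only [map_add, LinearMap.add_apply, hx, hy]
  | smul c x hx => simp only [map_smul, LinearMap.smul_apply, hx]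

theorem bul_bul {i j m n : ℕ} {b c : WordSpace K X} (a : WordSpace K X) (hb : b ∈ homog K X m)
    (hc : c ∈ homog K X n) (hi : i ≤ m) (hj : j ≤ n) :
    bul j (bul i a b) c = bul (i + j) a (bul j b c) := by
  induction a using wordSpace_induction with
  | single a =>
    induction hb using supported_induction with
    | single b hb =>
      induction hc using supported_induction with
      | single c hc =>
        rw [Set.mem_ofPred_eq] at hb hc
        simp [wordMul_wordMul (hi.trans hb.ge) (hj.trans hc.ge)]
      | zero => simp
      | add x y _ _ hx hy => simp only [map_add, hx, hy]
      | smul c x _ hx => simp only [map_smul, hx]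
    | zero => simp
    | add x y _ _ hx hy => simp only [map_add, LinearMap.add_apply, hx, hy]
    | smul c x _ hx => simp only [map_smul, LinearMap.smul_apply, hx]
  | zero => simp
  | add x y hx hy => simp only [map_add, LinearMap.add_apply, hx, hy]
  | smul c x hx => simp only [map_smul, LinearMap.smul_apply, hx]

/-- The inner position `0` is within range for every word, so `b` need not be homogeneous. -/
theorem bul_zero_bul {j n : ℕ} {c : WordSpace K X} (a b : WordSpace K X)
    (hc : c ∈ homog K X n) (hj : j ≤ n) :
    bul j (bul 0 a b) c = bul j a (bul j b c) := by
  induction b using wordSpace_induction with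
  | single b => rw [bul_bul a (single_mem_homog b) hc (Nat.zero_le _) hj, zero_add]
  | zero => simp
  | add x y hx hy => simp only [map_add, LinearMap.add_apply, hx, hy]
  | smul c x hx => simp only [map_smul, LinearMap.smul_apply, hx]

theorem bul_bul_zero {i m : ℕ} {b : WordSpace K X} (a c : WordSpace K X) (hb : b ∈ homog K X m)
    (hi : i ≤ m) : bul i a (bul 0 b c) = bul 0 (bul i a b) c := by
  induction a using wordSpace_induction with
  | single a =>
    induction hb using supported_induction with
    | single b hb =>
      rw [Set.mem_ofPred_eq] at hb
      induction c using wordSpace_induction with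
      | single c => simp [wordMul_wordMul_zero (hi.trans hb.ge)]
      | zero => simp
      | add x y hx hy => simp only [map_add, hx, hy]
      | smul c x hx => simp only [map_smul, hx]
    | zero => simp
    | add x y _ _ hx hy => simp only [map_add, LinearMap.add_apply, hx, hy]
    | smul c x _ hx => simp only [map_smul, LinearMap.smul_apply, hx]
  | zero => simp
  | add x y hx hy => simp only [map_add, LinearMap.add_apply, hx, hy]
  | smul c x hx => simp only [map_smul, LinearMap.smul_apply, hx]

theorem bul_mem {s t r : Set (ColWord X)} {i : ℕ}
    (h : ∀ a ∈ s, ∀ b ∈ t, wordMul i a b ∈ r) {a b : WordSpace K X}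
    (ha : a ∈ Finsupp.supported K K s) (hb : b ∈ Finsupp.supported K K t) :
    bul i a b ∈ Finsupp.supported K K r := by
  induction ha using supported_induction with
  | single a ha =>
    induction hb using supported_induction with
    | single b hb => rw [bul_single]; exact Finsupp.single_mem_supported K 1 (h a ha b hb)
    | zero => simp
    | add x y _ _ hx hy => rw [map_add]; exact add_mem hx hy
    | smul c x _ hx => rw [map_smul]; exact Submodule.smul_mem _ _ hx
  | zero => simp
  | add x y _ _ hx hy => rw [map_add]; exact add_mem hx hy
  | smul c x _ hx => rw [map_smul]; exact Submodule.smul_mem _ _ hx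

theorem bul_mem_homog {i m n : ℕ} {a b : WordSpace K X} (ha : a ∈ homog K X m)
    (hb : b ∈ homog K X n) : bul i a b ∈ homog K X (m + n) :=
  bul_mem (fun a ha b hb => by simp_all) ha hb

theorem bul_mem_kSpace (i : ℕ) {a b : WordSpace K X} (ha : a ∈ kSpace K deg)
    (hb : b ∈ kSpace K deg) : bul i a b ∈ kSpace K deg :=
  bul_mem (fun _ ha _ hb => IsKWord.wordMul ha hb i) ha hb

/-! ### The operations on homogeneous elements -/

@[simp] theorem concat_nil : concat ([] : List (WordSpace K X)) = unit := rfl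

@[simp] theorem concat_cons (x : WordSpace K X) (xs : List (WordSpace K X)) :
    concat (x :: xs) = bul 0 x (concat xs) := rfl

theorem concat_append (xs ys : List (WordSpace K X)) :
    concat (xs ++ ys) = bul 0 (concat xs) (concat ys) := by
  induction xs with
  | nil => simp
  | cons x xs ih => simp [ih, bul_assoc]

/-- The lists of pairs (degree, homogeneous element of `S` of this degree). -/
def HomogIn (S : Submodule K (WordSpace K X)) (xs : List (ℕ × WordSpace K X)) : Prop :=
  ∀ x ∈ xs, x.2 ∈ S ∧ x.2 ∈ homog K X x.1

theorem homogIn_cons {S : Submodule K (WordSpace K X)} {x : ℕ × WordSpace K X}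
    {xs : List (ℕ × WordSpace K X)} :
    HomogIn S (x :: xs) ↔ (x.2 ∈ S ∧ x.2 ∈ homog K X x.1) ∧ HomogIn S xs := by
  simp [HomogIn]

theorem HomogIn.take {S : Submodule K (WordSpace K X)} {xs : List (ℕ × WordSpace K X)}
    (h : HomogIn S xs) (r : ℕ) : HomogIn S (xs.take r) :=
  fun x hx => h x (List.mem_of_mem_take hx)

theorem HomogIn.drop {S : Submodule K (WordSpace K X)} {xs : List (ℕ × WordSpace K X)}
    (h : HomogIn S xs) (r : ℕ) : HomogIn S (xs.drop r) :=
  fun x hx => h x (List.mem_of_mem_drop hx)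

section elts
variable {V : Type w}

@[simp] theorem elts_nil : elts ([] : List (ℕ × V)) = [] := rfl
@[simp] theorem elts_cons (x : ℕ × V) (xs : List (ℕ × V)) : elts (x :: xs) = x.2 :: elts xs := rfl
@[simp] theorem elts_append (xs ys : List (ℕ × V)) : elts (xs ++ ys) = elts xs ++ elts ys := by
  simp [elts]
@[simp] theorem degs_nil : degs ([] : List (ℕ × V)) = 0 := rfl
@[simp] theorem degs_cons (x : ℕ × V) (xs : List (ℕ × V)) : degs (x :: xs) = x.1 + degs xs := by
  simp [degs]
@[simp] theorem degs_append (xs ys : List (ℕ × V)) : degs (xs ++ ys) = degs xs + degs ys := by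
  simp [degs]
theorem degs_take_add_drop (xs : List (ℕ × V)) (r : ℕ) :
    degs (xs.take r) + degs (xs.drop r) = degs xs := by
  rw [← degs_append, List.take_append_drop]
theorem mem_elts {v : V} {xs : List (ℕ × V)} : v ∈ elts xs ↔ ∃ x ∈ xs, x.2 = v := by
  simp [elts]

end elts

theorem concat_mem_homog {S : Submodule K (WordSpace K X)} {xs : List (ℕ × WordSpace K X)}
    (h : HomogIn S xs) : concat (elts xs) ∈ homog K X (degs xs) := by
  induction xs with
  | nil => exact single_mem_homog (⟨[], []⟩ : ColWord X)
  | cons x xs ih =>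
    rw [homogIn_cons] at h
    simpa using bul_mem_homog h.1.2 (ih h.2)

/-- In `insertAfter` and `primOp` the position depends on the length of a word. On homogeneous
arguments it is constant, and the operations become plain insertions. -/
theorem linearCombination_congr_homog {M : Type*} [AddCommGroup M] [Module K M] {n : ℕ}
    {f g : ColWord X → M} (h : ∀ t, t.length = n → f t = g t) {v : WordSpace K X}
    (hv : v ∈ homog K X n) :
    Finsupp.linearCombination K f v = Finsupp.linearCombination K g v := by
  induction hv using supported_induction with
  | single t ht => simpa using h t ht
  | zero => simp
  | add x y _ _ hx hy => simp [hx, hy]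
  | smul c x _ hx => simp [hx]

theorem linearCombination_bul (f : WordSpace K X →ₗ[K] WordSpace K X) (v : WordSpace K X) :
    Finsupp.linearCombination K (fun t : ColWord X => f (Finsupp.single t 1)) v = f v := by
  induction v using wordSpace_induction with
  | single t => simp
  | zero => simp
  | add x y hx hy => simp [hx, hy]
  | smul c x hx => simp [hx]

theorem insertAfter_eq {S : Submodule K (WordSpace K X)} {xs : List (ℕ × WordSpace K X)}
    (h : HomogIn S xs) (p : ℕ) (y z : WordSpace K X) :
    insertAfter (elts xs) p y z = bul (p + degs xs) z (bul 0 (concat (elts xs)) y) := by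
  unfold insertAfter
  rw [linearCombination_congr_homog (g := fun t =>
    (bul (p + degs xs) z ∘ₗ (bul 0).flip y) (Finsupp.single t 1)) (fun t ht => by simp [ht])
    (concat_mem_homog h), linearCombination_bul]
  simp

theorem primOp_nil {m p : ℕ} {y : WordSpace K X} (hy : y ∈ homog K X m) (z : WordSpace K X) :
    primOp [] p y z = bul p z y - if p = m then bul 0 y z else 0 := by
  simp only [primOp]
  rw [linearCombination_congr_homog (g := fun t =>
    ((if p = m then (1 : K) else 0) • (bul 0).flip z) (Finsupp.single t 1))
    (fun t ht => by subst ht; split_ifs <;> simp) hy, linearCombination_bul]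
  split_ifs <;> simp

theorem primOp_cons {S : Submodule K (WordSpace K X)} {x : ℕ × WordSpace K X}
    {xs : List (ℕ × WordSpace K X)} (h : HomogIn S (x :: xs)) (p : ℕ) (y z : WordSpace K X) :
    primOp (elts (x :: xs)) p y z =
      bul (p + degs (x :: xs)) z (bul 0 (concat (elts (x :: xs))) y) -
        bul 0 x.2 (bul (p + degs xs) z (bul 0 (concat (elts xs)) y)) := by
  rw [← insertAfter_eq h, ← insertAfter_eq (homogIn_cons.1 h).2]
  rfl

/-- The decomposition of `z •_{j + n} (x₁ •₀ ⋯ •₀ x_q •₀ y)` into products of values of the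
operations. -/
theorem bul_concat_eq {S : Submodule K (WordSpace K X)} {xs : List (ℕ × WordSpace K X)}
    (h : HomogIn S xs) {m : ℕ} (j : ℕ) {y : WordSpace K X} (hy : y ∈ homog K X m)
    (z : WordSpace K X) :
    bul (j + degs xs) z (bul 0 (concat (elts xs)) y) =
      (∑ r ∈ Finset.range (xs.length + 1),
        bul 0 (concat (elts (xs.take r))) (primOp (elts (xs.drop r)) j y z)) +
      if j = m then bul 0 (concat (elts xs)) (bul 0 y z) else 0 := by
  induction xs with
  | nil => simp [primOp_nil hy]
  | cons x xs ih =>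
    have h1 := primOp_cons h j y z
    -- By `primOp_cons`, the left side for `x :: xs` is `primOp` plus `x •₀` the left side for `xs`.
    -- This telescopes, and the new value of `primOp` is the summand `r = 0`.
    rw [sub_eq_iff_eq_add.1 h1.symm, ih (homogIn_cons.1 h).2, List.length_cons,
      Finset.sum_range_succ' _ (xs.length + 1)]
    simp only [List.take_succ_cons, List.drop_succ_cons, List.take_zero, List.drop_zero, elts_cons,
      elts_nil, concat_cons, concat_nil, bul_unit_left, bul_assoc, map_add, map_sum]
    split_ifs <;> (try simp only [map_zero]) <;> abel

theorem primOp_mem_homog {S : Submodule K (WordSpace K X)} {xs : List (ℕ × WordSpace K X)}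
    (h : HomogIn S xs) {m n : ℕ} (j : ℕ) {y z : WordSpace K X} (hy : y ∈ homog K X m)
    (hz : z ∈ homog K X n) : primOp (elts xs) j y z ∈ homog K X (degs xs + m + n) := by
  cases xs with
  | nil =>
    rw [elts_nil, primOp_nil hy]
    refine sub_mem ?_ ?_
    · simpa [add_comm] using bul_mem_homog (i := j) hz hy
    · split_ifs
      · simpa using bul_mem_homog (i := 0) hy hz
      · exact zero_mem _
  | cons x xs =>
    rw [primOp_cons h]
    have h2 := homogIn_cons.1 h
    refine sub_mem ?_ ?_
    · convert bul_mem_homog hz (bul_mem_homog (concat_mem_homog h) hy) using 2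
      omega
    · convert bul_mem_homog h2.1.2 (bul_mem_homog hz
        (bul_mem_homog (concat_mem_homog h2.2) hy)) using 2
      simp; omega

/-! ### Multilinearity -/

theorem concat_add (xs xs' : List (WordSpace K X)) (a b : WordSpace K X) :
    concat (xs ++ (a + b) :: xs') = concat (xs ++ a :: xs') + concat (xs ++ b :: xs') := by
  simp [concat_append]

theorem concat_smul (xs xs' : List (WordSpace K X)) (c : K) (a : WordSpace K X) :
    concat (xs ++ (c • a) :: xs') = c • concat (xs ++ a :: xs') := by
  simp [concat_append]

theorem primOp_add_left (xs xs' : List (WordSpace K X)) (a b : WordSpace K X) (j : ℕ)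
    (y z : WordSpace K X) : primOp (xs ++ (a + b) :: xs') j y z =
      primOp (xs ++ a :: xs') j y z + primOp (xs ++ b :: xs') j y z := by
  cases xs with
  | nil =>
    have := concat_add [] xs' a b
    simp only [List.nil_append] at this
    simp only [List.nil_append, primOp, insertAfter, this, map_add, LinearMap.add_apply]
    abel
  | cons x xs =>
    have h1 := concat_add (x :: xs) xs' a b
    have h2 := concat_add xs xs' a b
    simp only [List.cons_append] at h1
    simp only [List.cons_append, primOp, insertAfter, h1, h2, map_add]
    abel

theorem primOp_smul_left (xs xs' : List (WordSpace K X)) (c : K) (a : WordSpace K X) (j : ℕ)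
    (y z : WordSpace K X) : primOp (xs ++ (c • a) :: xs') j y z =
      c • primOp (xs ++ a :: xs') j y z := by
  cases xs with
  | nil =>
    have := concat_smul [] xs' c a
    simp only [List.nil_append] at this
    simp only [List.nil_append, primOp, insertAfter, this, map_smul, LinearMap.smul_apply, smul_sub]
  | cons x xs =>
    have h1 := concat_smul (x :: xs) xs' c a
    have h2 := concat_smul xs xs' c a
    simp only [List.cons_append] at h1
    simp only [List.cons_append, primOp, insertAfter, h1, h2, map_smul, smul_sub]

theorem linearCombination_add_fun {M ι : Type*} [AddCommGroup M] [Module K M] (f g : ι → M)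
    (v : ι →₀ K) : Finsupp.linearCombination K (fun t => f t + g t) v =
      Finsupp.linearCombination K f v + Finsupp.linearCombination K g v := by
  simp [Finsupp.linearCombination_apply, Finsupp.sum_add]

theorem linearCombination_smul_fun {M ι : Type*} [AddCommGroup M] [Module K M] (c : K) (f : ι → M)
    (v : ι →₀ K) : Finsupp.linearCombination K (fun t => c • f t) v =
      c • Finsupp.linearCombination K f v := by
  simp [Finsupp.linearCombination_apply, Finsupp.smul_sum, smul_comm c]

theorem primOp_add_mid (xs : List (WordSpace K X)) (j : ℕ) (y y' z : WordSpace K X) :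
    primOp xs j (y + y') z = primOp xs j y z + primOp xs j y' z := by
  cases xs with
  | nil => simp only [primOp, map_add]; abel
  | cons x xs =>
    simp only [primOp, insertAfter, map_add, linearCombination_add_fun]
    abel

theorem primOp_smul_mid (xs : List (WordSpace K X)) (j : ℕ) (c : K) (y z : WordSpace K X) :
    primOp xs j (c • y) z = c • primOp xs j y z := by
  cases xs with
  | nil => simp only [primOp, map_smul, smul_sub]
  | cons x xs => simp only [primOp, insertAfter, map_smul, linearCombination_smul_fun, smul_sub]

theorem primOp_add_right (xs : List (WordSpace K X)) (j : ℕ) (y z z' : WordSpace K X) :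
    primOp xs j y (z + z') = primOp xs j y z + primOp xs j y z' := by
  cases xs with
  | nil =>
    have : (fun t : ColWord X => if j = t.length then
        bul 0 (Finsupp.single t (1 : K)) (z + z') else 0) =
      fun t => (if j = t.length then bul 0 (Finsupp.single t (1 : K)) z else 0) +
        (if j = t.length then bul 0 (Finsupp.single t (1 : K)) z' else 0) := by
      funext t; split_ifs <;> simp
    simp only [primOp]
    rw [this, linearCombination_add_fun]
    simp only [map_add, LinearMap.add_apply]
    abel
  | cons x xs =>
    simp only [primOp, insertAfter, map_add, LinearMap.add_apply, linearCombination_add_fun]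
    abel

theorem primOp_smul_right (xs : List (WordSpace K X)) (j : ℕ) (c : K) (y z : WordSpace K X) :
    primOp xs j y (c • z) = c • primOp xs j y z := by
  cases xs with
  | nil =>
    have : (fun t : ColWord X => if j = t.length then
        bul 0 (Finsupp.single t (1 : K)) (c • z) else 0) =
      fun t => c • (if j = t.length then bul 0 (Finsupp.single t (1 : K)) z else 0) := by
      funext t; split_ifs <;> simp
    simp only [primOp]
    rw [this, linearCombination_smul_fun]
    simp only [map_smul, LinearMap.smul_apply, smul_sub]
  | cons x xs =>
    simp only [primOp, insertAfter, map_smul, LinearMap.smul_apply, linearCombination_smul_fun,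
      smul_sub]

end
end Presh

namespace Presh
open scoped TensorProduct
noncomputable section
variable {K : Type u} {X : Type v}
variable [Field K] {deg : X → ℕ}

/-! ### Standardization -/

@[simp] theorem length_stdize (p : List ℕ) : (stdize p).length = p.length := by simp [stdize]

/-- All letters of `p` lie below the shifted letters of `U`. The rank of a letter of `p` is
therefore its rank within `p`, and a letter of `U` gains the number of distinct letters of `p`. -/
theorem stdize_insert {U p : List ℕ} {r : ℕ} (J : ℕ) (hp : ∀ a ∈ p, a < r) :
    stdize ((U.take J).map (· + r) ++ p ++ (U.drop J).map (· + r)) =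
      ((stdize U).take J).map (· + p.toFinset.card) ++ stdize p ++
        ((stdize U).drop J).map (· + p.toFinset.card) := by
  have hset : ((U.take J).map (· + r) ++ p ++ (U.drop J).map (· + r)).toFinset =
      p.toFinset ∪ U.toFinset.image (· + r) := by
    have h1 : U.toFinset = (U.take J).toFinset ∪ (U.drop J).toFinset := by
      rw [← List.toFinset_append, List.take_append_drop]
    rw [h1]
    ext a
    simp only [List.toFinset_append, Finset.mem_union, List.mem_toFinset, List.mem_map,
      Finset.mem_image]
    constructor
    · rintro ((⟨b, hb, rfl⟩ | h) | ⟨b, hb, rfl⟩)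
      · exact .inr ⟨b, .inl hb, rfl⟩
      · exact .inl h
      · exact .inr ⟨b, .inr hb, rfl⟩
    · rintro (h | ⟨b, hb | hb, rfl⟩)
      · exact .inl (.inr h)
      · exact .inl (.inl ⟨b, hb, rfl⟩)
      · exact .inr ⟨b, hb, rfl⟩
  have hlow : ∀ a ∈ p, ((p.toFinset ∪ U.toFinset.image (· + r)).filter (· < a)).card =
      (p.toFinset.filter (· < a)).card := by
    intro a ha
    congr 1
    ext b
    have := hp a ha
    simp only [Finset.mem_filter, Finset.mem_union, Finset.mem_image]
    constructor
    · rintro ⟨h | ⟨c, -, rfl⟩, h'⟩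
      · exact ⟨h, h'⟩
      · omega
    · exact fun h => ⟨.inl h.1, h.2⟩
  have hhigh : ∀ a, ((p.toFinset ∪ U.toFinset.image (· + r)).filter (· < a + r)).card =
      (U.toFinset.filter (· < a)).card + p.toFinset.card := by
    intro a
    have h1 : (p.toFinset ∪ U.toFinset.image (· + r)).filter (· < a + r) =
        (U.toFinset.filter (· < a)).image (· + r) ∪ p.toFinset := by
      ext b
      simp only [Finset.mem_filter, Finset.mem_union, Finset.mem_image, List.mem_toFinset]
      constructor
      · rintro ⟨h | ⟨c, hc, rfl⟩, h'⟩
        · exact .inr h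
        · exact .inl ⟨c, ⟨hc, by omega⟩, rfl⟩
      · rintro (⟨c, ⟨hc, hca⟩, rfl⟩ | h)
        · exact ⟨.inr ⟨c, hc, rfl⟩, by omega⟩
        · exact ⟨.inl h, by have := hp b h; omega⟩
    rw [h1, Finset.card_union_of_disjoint, Finset.card_image_of_injective]
    · intro x y h; simpa using h
    · rw [Finset.disjoint_left]
      intro b hb hb'
      simp only [Finset.mem_image] at hb
      obtain ⟨c, -, rfl⟩ := hb
      have := hp _ (List.mem_toFinset.1 hb')
      omega
  unfold stdize
  rw [hset]
  simp only [List.map_append, List.map_map, ← List.map_take, ← List.map_drop]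
  congr 1
  · congr 1
    · refine List.map_congr_left fun a _ => ?_
      simpa using hhigh a
    · exact List.map_congr_left fun a ha => hlow a ha
  · refine List.map_congr_left fun a _ => ?_
    simpa using hhigh a

theorem stdize_eq_self (hdeg : ∀ x, 1 ≤ deg x) {w : ColWord X} (h : Admissible deg w) :
    stdize w.word = w.word := by
  unfold stdize
  conv_rhs => rw [← List.map_id w.word]
  refine List.map_congr_left fun a ha => ?_
  have : w.word.toFinset.filter (· < a) = Finset.range a := by
    ext b
    simp only [Finset.mem_filter, List.mem_toFinset, h.mem_iff hdeg, Finset.mem_range]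
    have := h.lt_length ha
    omega
  rw [this]
  simp

/-- The shift in `stdize_insert` is a number of distinct letters, whereas `wordMul` shifts by a
number of colours. The right side is the form in which `splitColors_mem` counts the colours. -/
theorem card_toFinset_eq_sum {p : List ℕ} {n : ℕ} (h : ∀ a ∈ p, a < n) :
    p.toFinset.card = ∑ i ∈ Finset.range n, if p.count i = 0 then 0 else 1 := by
  have : p.toFinset = (Finset.range n).filter fun i => ¬ p.count i = 0 := by
    ext a
    simp only [List.mem_toFinset, Finset.mem_filter, Finset.mem_range, List.count_eq_zero,
      not_not]
    exact ⟨fun ha => ⟨h a ha, ha⟩, fun h => h.2⟩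
  rw [this, Finset.card_filter]
  exact Finset.sum_congr rfl fun i _ => by split_ifs <;> rfl

/-! ### Distribution of the colours -/

/-- Concatenation of pairs of lists of colours, extended bilinearly. -/
def pairMul : (List X × List X →₀ K) →ₗ[K] (List X × List X →₀ K) →ₗ[K] (List X × List X →₀ K) :=
  Finsupp.linearCombination K fun s =>
    Finsupp.linearCombination K fun t => Finsupp.single (s.1 ++ t.1, s.2 ++ t.2) 1

@[simp] theorem pairMul_single (s t : List X × List X) :
    pairMul (Finsupp.single s (1 : K)) (Finsupp.single t 1) =
      Finsupp.single (s.1 ++ t.1, s.2 ++ t.2) 1 := by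
  simp [pairMul]

theorem finsupp_induction {ι : Type*} {p : (ι →₀ K) → Prop}
    (single : ∀ i, p (Finsupp.single i 1)) (zero : p 0)
    (add : ∀ x y, p x → p y → p (x + y)) (smul : ∀ (c : K) x, p x → p (c • x))
    (v : ι →₀ K) : p v :=
  supported_induction (s := Set.univ) (p := fun v _ => p v) (fun i _ => single i) zero
    (fun x y _ _ => add x y) (fun c x _ => smul c x) (by simp)

theorem pairMul_assoc (a b c : List X × List X →₀ K) :
    pairMul (pairMul a b) c = pairMul a (pairMul b c) := by
  induction a using finsupp_induction with
  | single a =>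
    induction b using finsupp_induction with
    | single b =>
      induction c using finsupp_induction with
      | single c => simp
      | zero => simp
      | add x y hx hy => simp only [map_add, hx, hy]
      | smul c x hx => simp only [map_smul, hx]
    | zero => simp
    | add x y hx hy => simp only [map_add, LinearMap.add_apply, hx, hy]
    | smul c x hx => simp only [map_smul, LinearMap.smul_apply, hx]
  | zero => simp
  | add x y hx hy => simp only [map_add, LinearMap.add_apply, hx, hy]
  | smul c x hx => simp only [map_smul, LinearMap.smul_apply, hx]

theorem pairMul_nil (a : List X × List X →₀ K) :
    pairMul (Finsupp.single ([], []) 1) a = a := by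
  induction a using finsupp_induction with
  | single a => simp
  | zero => simp
  | add x y hx hy => simp only [map_add, hx, hy]
  | smul c x hx => simp only [map_smul, hx]

theorem splitColors_cons (Θ : GradedCoproduct K deg) (p : List ℕ) (k : ℕ) (x : X) (xs : List X) :
    splitColors Θ p k (x :: xs) =
      pairMul (splitColor Θ (p.count k) x) (splitColors Θ p (k + 1) xs) := by
  simp only [splitColors, pairMul, Finsupp.linearCombination_apply, Finsupp.sum,
    LinearMap.sum_apply, LinearMap.smul_apply, Finset.smul_sum, Finsupp.smul_single, smul_eq_mul,
    mul_one]

theorem splitColors_append (Θ : GradedCoproduct K deg) (p : List ℕ) (k : ℕ) (xs ys : List X) :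
    splitColors Θ p k (xs ++ ys) =
      pairMul (splitColors Θ p k xs) (splitColors Θ p (k + xs.length) ys) := by
  induction xs generalizing k with
  | nil => simp [splitColors, pairMul_nil]
  | cons x xs ih =>
    rw [List.cons_append, splitColors_cons, splitColors_cons, ih, pairMul_assoc]
    congr 3
    simp; omega

theorem splitColors_congr (Θ : GradedCoproduct K deg) {p p' : List ℕ} {k k' : ℕ} {xs : List X}
    (h : ∀ i < xs.length, p.count (k + i) = p'.count (k' + i)) :
    splitColors Θ p k xs = splitColors Θ p' k' xs := by
  induction xs generalizing k k' with
  | nil => rfl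
  | cons x xs ih =>
    rw [splitColors_cons, splitColors_cons, ih (k := k + 1) (k' := k' + 1), show p.count k = p'.count k' from h 0 (by simp)]
    intro i hi
    have := h (i + 1) (by simpa using hi)
    rwa [show k + 1 + i = k + (i + 1) by omega, show k' + 1 + i = k' + (i + 1) by omega]

/-- The pairs of lists of prescribed lengths. -/
def pairLen (m n : ℕ) : Set (List X × List X) := {s | s.1.length = m ∧ s.2.length = n}

/-- A side of the cut receives a colour precisely when the letter occurs on that side. -/
theorem splitColor_mem (hdeg : ∀ x, 1 ≤ deg x) (Θ : GradedCoproduct K deg) {m m' : ℕ} {x : X}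
    (h : m + m' = deg x) :
    splitColor Θ m x ∈ Finsupp.supported K K
      (pairLen (if m = 0 then 0 else 1) (if m' = 0 then 0 else 1)) := by
  have := hdeg x
  unfold splitColor
  split_ifs <;> first | omega | skip
  · exact Finsupp.single_mem_supported K 1 (by simp [pairLen])
  · exact Finsupp.single_mem_supported K 1 (by simp [pairLen])
  · refine Submodule.sum_mem _ fun ab _ => ?_
    dsimp only
    split_ifs
    · exact Finsupp.single_mem_supported K _ (by simp [pairLen])
    · exact zero_mem _

theorem pairMul_mem {m n m' n' : ℕ} {a b : List X × List X →₀ K}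
    (ha : a ∈ Finsupp.supported K K (pairLen m n))
    (hb : b ∈ Finsupp.supported K K (pairLen m' n')) :
    pairMul a b ∈ Finsupp.supported K K (pairLen (m + m') (n + n')) := by
  induction ha using supported_induction with
  | single a ha =>
    induction hb using supported_induction with
    | single b hb =>
      rw [pairMul_single]
      refine Finsupp.single_mem_supported K 1 ?_
      simp only [pairLen, Set.mem_ofPred_eq] at ha hb ⊢
      simp [ha, hb]
    | zero => simp
    | add x y _ _ hx hy => rw [map_add]; exact add_mem hx hy
    | smul c x _ hx => rw [map_smul]; exact Submodule.smul_mem _ _ hx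
  | zero => simp
  | add x y _ _ hx hy => rw [map_add]; exact add_mem hx hy
  | smul c x _ hx => rw [map_smul]; exact Submodule.smul_mem _ _ hx

theorem splitColors_mem (hdeg : ∀ x, 1 ≤ deg x) (Θ : GradedCoproduct K deg) {p p' : List ℕ}
    {k : ℕ} {xs : List X}
    (h : ∀ (i : ℕ) (hi : i < xs.length), p.count (k + i) + p'.count (k + i) = deg xs[i]) :
    splitColors Θ p k xs ∈ Finsupp.supported K K
      (pairLen (∑ i ∈ Finset.range xs.length, if p.count (k + i) = 0 then 0 else 1)
        (∑ i ∈ Finset.range xs.length, if p'.count (k + i) = 0 then 0 else 1)) := by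
  induction xs generalizing k with
  | nil => exact Finsupp.single_mem_supported K 1 (by simp [pairLen])
  | cons x xs ih =>
    rw [splitColors_cons, List.length_cons, Finset.sum_range_succ', Finset.sum_range_succ',
      add_comm, add_comm (∑ i ∈ _, _)]
    have h0 := splitColor_mem hdeg Θ (h 0 (by simp))
    have h1 := ih (k := k + 1) fun i hi => by
      have := h (i + 1) (by simpa using hi)
      simpa [add_assoc, add_comm 1] using this
    have := pairMul_mem h0 h1
    simpa [add_assoc, add_comm 1] using this

/-! ### Cuts -/

/-- The summand of `Δ_Θ` that cuts a word after the position `l`. -/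
def cutAt (Θ : GradedCoproduct K deg) (l : ℕ) (w : ColWord X) :
    WordSpace K X ⊗[K] WordSpace K X :=
  Finsupp.linearCombination K (fun s : List X × List X =>
    Finsupp.single (⟨stdize (w.word.take l), s.1⟩ : ColWord X) (1 : K) ⊗ₜ[K]
      Finsupp.single (⟨stdize (w.word.drop l), s.2⟩ : ColWord X) (1 : K))
    (splitColors Θ (w.word.take l) 0 w.col)

theorem wordCoproduct_eq (Θ : GradedCoproduct K deg) (w : ColWord X) :
    wordCoproduct Θ w = ∑ l ∈ Finset.Ico 1 w.length, cutAt Θ l w := rfl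

theorem splitColors_nil_left (Θ : GradedCoproduct K deg) (k : ℕ) (xs : List X) :
    splitColors Θ [] k xs = Finsupp.single ([], xs) 1 := by
  induction xs generalizing k with
  | nil => rfl
  | cons x xs ih => rw [splitColors_cons, ih]; simp [splitColor]

theorem splitColors_full (hdeg : ∀ x, 1 ≤ deg x) (Θ : GradedCoproduct K deg) {p : List ℕ} {k : ℕ}
    {xs : List X} (h : ∀ (i : ℕ) (hi : i < xs.length), p.count (k + i) = deg xs[i]) :
    splitColors Θ p k xs = Finsupp.single (xs, []) 1 := by
  induction xs generalizing k with
  | nil => rfl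
  | cons x xs ih =>
    rw [splitColors_cons, ih]
    · have h0 := h 0 (by simp)
      have := hdeg x
      simp only [add_zero, List.getElem_cons_zero] at h0
      simp only [splitColor, h0, if_true]
      rw [if_neg (by omega)]
      simp
    · intro i hi
      have := h (i + 1) (by simpa using hi)
      simpa [add_assoc, add_comm 1] using this

theorem Admissible.count_getElem {w : ColWord X} (h : Admissible deg w) (i : ℕ)
    (hi : i < w.col.length) : w.word.count i = deg w.col[i] := by
  rw [h.count i, List.getElem?_eq_getElem hi]; rfl

theorem cutAt_zero (hdeg : ∀ x, 1 ≤ deg x) (Θ : GradedCoproduct K deg) {w : ColWord X}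
    (h : Admissible deg w) : cutAt Θ 0 w = unit ⊗ₜ Finsupp.single w 1 := by
  simp [cutAt, splitColors_nil_left, stdize_eq_self hdeg h, unit]
  simp [stdize]

theorem cutAt_length (hdeg : ∀ x, 1 ≤ deg x) (Θ : GradedCoproduct K deg) {w : ColWord X}
    (h : Admissible deg w) {l : ℕ} (hl : w.length ≤ l) :
    cutAt Θ l w = Finsupp.single w 1 ⊗ₜ unit := by
  unfold ColWord.length at hl
  unfold cutAt
  rw [List.take_of_length_le hl, List.drop_of_length_le hl,
    splitColors_full hdeg Θ (fun i hi => by simpa using h.count_getElem i hi)]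
  simp [stdize_eq_self hdeg h, unit]
  simp [stdize]

/-- The componentwise product `(a ⊗ b), (c ⊗ d) ↦ (a •ᵢ c) ⊗ (b •ⱼ d)`. -/
abbrev tensorBul (i j : ℕ) : WordSpace K X ⊗[K] WordSpace K X →ₗ[K]
    WordSpace K X ⊗[K] WordSpace K X →ₗ[K] WordSpace K X ⊗[K] WordSpace K X :=
  TensorProduct.map₂ (bul i) (bul j)

theorem linearCombination_pairMul {s : Set (List X × List X)} {M : Type*} [AddCommGroup M]
    [Module K M] {F G H : List X × List X → M} {B : M →ₗ[K] M →ₗ[K] M}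
    (h : ∀ a ∈ s, ∀ b, F (a.1 ++ b.1, a.2 ++ b.2) = B (G a) (H b))
    {a b : List X × List X →₀ K} (ha : a ∈ Finsupp.supported K K s) :
    Finsupp.linearCombination K F (pairMul a b) =
      B (Finsupp.linearCombination K G a) (Finsupp.linearCombination K H b) := by
  induction ha using supported_induction with
  | single a ha =>
    induction b using finsupp_induction with
    | single b => simpa using h a ha b
    | zero => simp
    | add x y hx hy => simp only [map_add, hx, hy]
    | smul c x hx => simp only [map_smul, hx]
  | zero => simp
  | add x y _ _ hx hy => simp only [map_add, LinearMap.add_apply, hx, hy]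
  | smul c x _ hx => simp only [map_smul, LinearMap.smul_apply, hx]

/-- The cut puts the first `a` letters of `z` and the first `b` letters of `u` on the left; on
either side the part of `z` is still inserted in the part of `u`. The three cases below, a cut
before, in or after the block of `z`, differ only in `a` and `b`. The truncated difference `J - b`
is `0` once the cut has passed the beginning of the block. -/
theorem cutAt_wordMul_of_eq (hdeg : ∀ x, 1 ≤ deg x) (Θ : GradedCoproduct K deg)
    {z u : ColWord X} (hz : Admissible deg z) {J l a b : ℕ}
    (h1 : (wordMul J z u).word.take l = ((u.word.take b).take J).map (· + z.col.length) ++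
      z.word.take a ++ ((u.word.take b).drop J).map (· + z.col.length))
    (h2 : (wordMul J z u).word.drop l = ((u.word.drop b).take (J - b)).map (· + z.col.length) ++
      z.word.drop a ++ ((u.word.drop b).drop (J - b)).map (· + z.col.length)) :
    cutAt Θ l (wordMul J z u) = tensorBul J (J - b) (cutAt Θ a z) (cutAt Θ b u) := by
  have hta : ∀ c ∈ z.word.take a, c < z.col.length :=
    fun c hc => hz.lt_length (List.mem_of_mem_take hc)
  have hda : ∀ c ∈ z.word.drop a, c < z.col.length :=
    fun c hc => hz.lt_length (List.mem_of_mem_drop hc)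
  have hs : splitColors Θ ((wordMul J z u).word.take l) 0 (wordMul J z u).col =
      pairMul (splitColors Θ (z.word.take a) 0 z.col)
        (splitColors Θ (u.word.take b) 0 u.col) := by
    have hc : ∀ c, ((wordMul J z u).word.take l).count c =
        ((u.word.take b).map (· + z.col.length)).count c + (z.word.take a).count c := by
      intro c
      rw [h1]
      conv_rhs => rw [← List.take_append_drop J (u.word.take b)]
      simp only [List.count_append, List.map_append]
      omega
    have : (wordMul J z u).col = z.col ++ u.col := rfl
    rw [this, splitColors_append]
    congr 1
    · congr 1
      refine splitColors_congr Θ fun i hi => ?_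
      rw [zero_add, hc, List.count_eq_zero.2, zero_add]
      intro hm
      obtain ⟨c, -, hc⟩ := List.mem_map.1 hm
      omega
    · refine splitColors_congr Θ fun i hi => ?_
      rw [zero_add, zero_add, hc, add_comm z.col.length i,
        List.count_map_of_injective _ (· + z.col.length) (fun x y h => by simpa using h),
        (List.count_eq_zero (l := z.word.take a)).2, add_zero]
      intro hm
      have := hta _ hm
      omega
  -- The colours assigned to each part of `z` are as many as its distinct letters, so
  -- standardization and `wordMul` use the same shifts.
  have hmem := splitColors_mem hdeg Θ (p := z.word.take a) (p' := z.word.drop a) (k := 0)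
    (xs := z.col) fun i hi => by
      rw [zero_add, ← List.count_append, List.take_append_drop]
      exact hz.count_getElem i hi
  simp only [zero_add] at hmem
  rw [← card_toFinset_eq_sum hta, ← card_toFinset_eq_sum hda] at hmem
  unfold cutAt
  rw [hs]
  refine linearCombination_pairMul
    (F := fun s : List X × List X =>
      Finsupp.single (⟨stdize ((wordMul J z u).word.take l), s.1⟩ : ColWord X) (1 : K) ⊗ₜ[K]
        Finsupp.single (⟨stdize ((wordMul J z u).word.drop l), s.2⟩ : ColWord X) (1 : K))
    (G := fun s : List X × List X =>
      Finsupp.single (⟨stdize (z.word.take a), s.1⟩ : ColWord X) (1 : K) ⊗ₜ[K]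
        Finsupp.single (⟨stdize (z.word.drop a), s.2⟩ : ColWord X) (1 : K))
    (H := fun s : List X × List X =>
      Finsupp.single (⟨stdize (u.word.take b), s.1⟩ : ColWord X) (1 : K) ⊗ₜ[K]
        Finsupp.single (⟨stdize (u.word.drop b), s.2⟩ : ColWord X) (1 : K))
    (B := tensorBul J (J - b)) (fun s hs t => ?_) hmem
  rw [TensorProduct.map₂_apply_tmul, TensorProduct.map_tmul, bul_single, bul_single, h1, h2, stdize_insert _ hta,
    stdize_insert _ hda]
  simp only [wordMul, hs.1, hs.2]

theorem cutAt_wordMul_left (hdeg : ∀ x, 1 ≤ deg x) (Θ : GradedCoproduct K deg)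
    {z u : ColWord X} (hz : Admissible deg z) {J l : ℕ} (hJ : J ≤ u.length) (hl : l ≤ J) :
    cutAt Θ l (wordMul J z u) =
      tensorBul J (J - l) (unit ⊗ₜ Finsupp.single z 1) (cutAt Θ l u) := by
  unfold ColWord.length at hJ
  rw [← cutAt_zero hdeg Θ hz]
  apply cutAt_wordMul_of_eq hdeg Θ hz
  · simp only [wordMul, List.take_zero, List.append_nil, ← List.map_take, List.take_append, List.length_map, List.length_take,
      List.take_take]
    have e1 : l - min J u.word.length = 0 := by omega
    have e2 : (u.word.take l).drop J = [] := List.drop_eq_nil_of_le (by simp; omega)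
    have e3 : l - (min J u.word.length + z.word.length) = 0 := by omega
    simp [e1, e2, e3, min_comm]
  · simp only [wordMul, List.drop_zero, ← List.map_drop, List.drop_append, List.length_map, List.length_take,
      List.drop_drop, List.length_append]
    have e1 : l - min J u.word.length = 0 := by omega
    have e3 : l - (min J u.word.length + z.word.length) = 0 := by omega
    have e4 : l + (J - l) = J := by omega
    simp [e1, e3, e4, List.drop_take]

theorem cutAt_wordMul_mid (hdeg : ∀ x, 1 ≤ deg x) (Θ : GradedCoproduct K deg)
    {z u : ColWord X} (hz : Admissible deg z) {J l : ℕ} (hJ : J ≤ u.length) (hl : J ≤ l)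
    (hl' : l ≤ J + z.length) :
    cutAt Θ l (wordMul J z u) = tensorBul J 0 (cutAt Θ (l - J) z) (cutAt Θ J u) := by
  unfold ColWord.length at hJ hl'
  have h := cutAt_wordMul_of_eq hdeg Θ hz (J := J) (l := l) (a := l - J) (b := J) (u := u) ?_ ?_
  · rw [h, Nat.sub_self]
  · have e2 : (u.word.take J).drop J = [] := List.drop_eq_nil_of_le (by simp)
    have e3 : l - (J + z.word.length) = 0 := by omega
    have e4 : ((u.word.take J).map (· + z.col.length)).take l =
        (u.word.take J).map (· + z.col.length) := List.take_of_length_le (by simp; omega)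
    have e5 : min J u.word.length = J := by omega
    rw [wordMul, List.take_append, List.take_append, e4, e2]
    simp [e3, e5, List.take_take]
  · have e3 : l - (J + z.word.length) = 0 := by omega
    have e4 : ((u.word.take J).map (· + z.col.length)).drop l = [] :=
      List.drop_eq_nil_of_le (by simp; omega)
    have e5 : min J u.word.length = J := by omega
    rw [wordMul, List.drop_append, List.drop_append, e4]
    simp [e3, e5]

theorem cutAt_wordMul_right (hdeg : ∀ x, 1 ≤ deg x) (Θ : GradedCoproduct K deg)
    {z u : ColWord X} (hz : Admissible deg z) {J l : ℕ} (hJ : J ≤ u.length)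
    (hl : J ≤ l) :
    cutAt Θ (l + z.length) (wordMul J z u) =
      tensorBul J 0 (Finsupp.single z 1 ⊗ₜ unit) (cutAt Θ l u) := by
  rw [← cutAt_length hdeg Θ hz le_rfl]
  unfold ColWord.length at hJ ⊢
  have h := cutAt_wordMul_of_eq hdeg Θ hz (J := J) (l := l + z.word.length) (a := z.word.length)
    (b := l) (u := u) ?_ ?_
  · rw [h, Nat.sub_eq_zero_of_le hl]
  · have e4 : ((u.word.take J).map (· + z.col.length)).take (l + z.word.length) =
        (u.word.take J).map (· + z.col.length) := List.take_of_length_le (by simp; omega)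
    have e5 : min J u.word.length = J := by omega
    have e6 : z.word.take (l + z.word.length - J) = z.word :=
      List.take_of_length_le (by omega)
    have e7 : l + z.word.length - (J + z.word.length) = l - J := by omega
    have e8 : min J l = J := by omega
    rw [wordMul, List.take_append, List.take_append, e4]
    simp [e5, e6, e7, e8, List.take_take, List.drop_take, List.map_take, List.map_drop]
  · have e4 : ((u.word.take J).map (· + z.col.length)).drop (l + z.word.length) = [] :=
      List.drop_eq_nil_of_le (by simp; omega)
    have e5 : min J u.word.length = J := by omega
    have e6 : z.word.drop (l + z.word.length - J) = [] :=
      List.drop_eq_nil_of_le (by omega)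
    have e7 : l + z.word.length - (J + z.word.length) = l - J := by omega
    have e8 : J + (l - J) = l := by omega
    have e9 : J - l = 0 := by omega
    rw [wordMul, List.drop_append, List.drop_append, e4]
    simp [e5, e6, e7, e8, e9, ← List.map_drop, List.drop_drop]

end
end Presh

namespace Presh
open scoped TensorProduct
noncomputable section
variable {K : Type u} {X : Type v}
variable [Field K] {deg : X → ℕ}

/-! ### The coproduct of a product -/

/-- The linear extension of `cutAt`. -/
def cut (Θ : GradedCoproduct K deg) (l : ℕ) :
    WordSpace K X →ₗ[K] WordSpace K X ⊗[K] WordSpace K X :=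
  Finsupp.linearCombination K (cutAt Θ l)

@[simp] theorem cut_single (Θ : GradedCoproduct K deg) (l : ℕ) (w : ColWord X) :
    cut Θ l (Finsupp.single w 1) = cutAt Θ l w := by simp [cut]

@[simp] theorem coproduct_single (Θ : GradedCoproduct K deg) (w : ColWord X) :
    coproduct Θ (Finsupp.single w 1) = wordCoproduct Θ w := by simp [coproduct]

/-- The homogeneous elements of degree `n` in the span of `K[𝒦_∞, X]` and the empty word. -/
def admHomog (K : Type u) [Field K] (deg : X → ℕ) (n : ℕ) : Submodule K (WordSpace K X) :=
  Finsupp.supported K K {w | Admissible deg w ∧ w.length = n}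

theorem admHomog_le_homog (n : ℕ) : admHomog K deg n ≤ homog K X n :=
  Finsupp.supported_mono fun _ h => h.2

theorem unit_mem_admHomog : (unit : WordSpace K X) ∈ admHomog K deg 0 :=
  Finsupp.single_mem_supported K 1 ⟨admissible_nil, rfl⟩

theorem mem_admHomog_of_mem {n : ℕ} {v : WordSpace K X} (h1 : v ∈ kSpace K deg)
    (h2 : v ∈ homog K X n) : v ∈ admHomog K deg n := by
  rw [admHomog, Finsupp.mem_supported]
  exact fun w hw => ⟨((Finsupp.mem_supported _ _).1 h1 hw).admissible,
    (Finsupp.mem_supported _ _).1 h2 hw⟩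

theorem bul_mem_admHomog {i m n : ℕ} {a b : WordSpace K X} (ha : a ∈ admHomog K deg m)
    (hb : b ∈ admHomog K deg n) : bul i a b ∈ admHomog K deg (m + n) :=
  bul_mem (r := {w | Admissible deg w ∧ w.length = m + n})
    (fun a ha b hb => ⟨ha.1.wordMul hb.1 i, by rw [length_wordMul, ha.2, hb.2]⟩) ha hb

theorem coproduct_eq_sum_cut (Θ : GradedCoproduct K deg) {n : ℕ} {v : WordSpace K X}
    (hv : v ∈ homog K X n) : coproduct Θ v = ∑ l ∈ Finset.Ico 1 n, cut Θ l v := by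
  induction hv using supported_induction with
  | single w hw =>
    rw [Set.mem_ofPred_eq] at hw
    simp [wordCoproduct_eq, hw]
  | zero => simp
  | add x y _ _ hx hy => simp only [map_add, hx, hy, Finset.sum_add_distrib]
  | smul c x _ hx => simp only [map_smul, hx, Finset.smul_sum]

theorem cut_zero (hdeg : ∀ x, 1 ≤ deg x) (Θ : GradedCoproduct K deg) {n : ℕ} {v : WordSpace K X}
    (hv : v ∈ admHomog K deg n) : cut Θ 0 v = unit ⊗ₜ v := by
  induction hv using supported_induction with
  | single w hw => rw [cut_single, cutAt_zero hdeg Θ hw.1]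
  | zero => simp
  | add x y _ _ hx hy => simp only [map_add, hx, hy, TensorProduct.tmul_add]
  | smul c x _ hx => simp only [map_smul, hx, TensorProduct.tmul_smul]

theorem cut_length (hdeg : ∀ x, 1 ≤ deg x) (Θ : GradedCoproduct K deg) {n : ℕ}
    {v : WordSpace K X} (hv : v ∈ admHomog K deg n) : cut Θ n v = v ⊗ₜ unit := by
  induction hv using supported_induction with
  | single w hw => rw [cut_single, cutAt_length hdeg Θ hw.1 hw.2.le]
  | zero => simp
  | add x y _ _ hx hy => simp only [map_add, hx, hy, TensorProduct.add_tmul]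
  | smul c x _ hx => simp only [map_smul, hx, TensorProduct.smul_tmul']

theorem tensorBul_unit_tmul (i j : ℕ) (z : WordSpace K X)
    (t : WordSpace K X ⊗[K] WordSpace K X) :
    tensorBul i j (unit ⊗ₜ z) t = (bul j z).lTensor _ t := by
  induction t with
  | zero => simp
  | tmul a b => simp
  | add x y hx hy => simp only [map_add, hx, hy]

theorem tensorBul_tmul_unit (i j : ℕ) (z : WordSpace K X)
    (t : WordSpace K X ⊗[K] WordSpace K X) :
    tensorBul i j (z ⊗ₜ unit) t = (bul i z).rTensor _ t := by
  induction t with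
  | zero => simp
  | tmul a b => simp
  | add x y hx hy => simp only [map_add, hx, hy]

theorem cut_bul_left (hdeg : ∀ x, 1 ≤ deg x) (Θ : GradedCoproduct K deg) {m n J l : ℕ}
    {z u : WordSpace K X} (hz : z ∈ admHomog K deg n) (hu : u ∈ admHomog K deg m) (hJ : J ≤ m)
    (hl : l ≤ J) : cut Θ l (bul J z u) = (bul (J - l) z).lTensor _ (cut Θ l u) := by
  rw [← tensorBul_unit_tmul J]
  induction hz using supported_induction with
  | single z hz =>
    induction hu using supported_induction with
    | single u hu =>
      rw [bul_single, cut_single, cut_single, cutAt_wordMul_left hdeg Θ hz.1 (hu.2 ▸ hJ) hl]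
    | zero => simp
    | add x y _ _ hx hy => simp only [map_add, hx, hy]
    | smul c x _ hx => simp only [map_smul, hx]
  | zero => simp
  | add x y _ _ hx hy =>
    simp only [map_add, LinearMap.add_apply, hx, hy, TensorProduct.tmul_add]
  | smul c x _ hx =>
    simp only [map_smul, LinearMap.smul_apply, hx, TensorProduct.tmul_smul]

theorem cut_bul_mid (hdeg : ∀ x, 1 ≤ deg x) (Θ : GradedCoproduct K deg) {m n J l : ℕ}
    {z u : WordSpace K X} (hz : z ∈ admHomog K deg n) (hu : u ∈ admHomog K deg m) (hJ : J ≤ m)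
    (hl : J ≤ l) (hl' : l ≤ J + n) :
    cut Θ l (bul J z u) = tensorBul J 0 (cut Θ (l - J) z) (cut Θ J u) := by
  induction hz using supported_induction with
  | single z hz =>
    induction hu using supported_induction with
    | single u hu =>
      rw [bul_single, cut_single, cut_single, cut_single,
        cutAt_wordMul_mid hdeg Θ hz.1 (hu.2 ▸ hJ) hl (hz.2 ▸ hl')]
    | zero => simp
    | add x y _ _ hx hy => simp only [map_add, hx, hy]
    | smul c x _ hx => simp only [map_smul, hx]
  | zero => simp
  | add x y _ _ hx hy => simp only [map_add, LinearMap.add_apply, hx, hy]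
  | smul c x _ hx => simp only [map_smul, LinearMap.smul_apply, hx]

theorem cut_bul_right (hdeg : ∀ x, 1 ≤ deg x) (Θ : GradedCoproduct K deg) {m n J l : ℕ}
    {z u : WordSpace K X} (hz : z ∈ admHomog K deg n) (hu : u ∈ admHomog K deg m) (hJ : J ≤ m)
    (hl : J ≤ l) : cut Θ (l + n) (bul J z u) = (bul J z).rTensor _ (cut Θ l u) := by
  rw [← tensorBul_tmul_unit J 0]
  induction hz using supported_induction with
  | single z hz =>
    induction hu using supported_induction with
    | single u hu =>
      rw [bul_single, cut_single, cut_single, ← hz.2,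
        cutAt_wordMul_right hdeg Θ hz.1 (hu.2 ▸ hJ) hl]
    | zero => simp
    | add x y _ _ hx hy => simp only [map_add, hx, hy]
    | smul c x _ hx => simp only [map_smul, hx]
  | zero => simp
  | add x y _ _ hx hy =>
    simp only [map_add, LinearMap.add_apply, hx, hy, TensorProduct.add_tmul]
  | smul c x _ hx =>
    simp only [map_smul, LinearMap.smul_apply, hx, ← TensorProduct.smul_tmul']

/-! ### Homogeneous components of primitive elements -/

/-- The homogeneous component of degree `n`. -/
def comp (n : ℕ) : WordSpace K X →ₗ[K] WordSpace K X :=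
  Finsupp.linearCombination K fun w => if w.length = n then Finsupp.single w 1 else 0

@[simp] theorem comp_single (n : ℕ) (w : ColWord X) :
    comp n (Finsupp.single w (1 : K)) = if w.length = n then Finsupp.single w 1 else 0 := by
  simp [comp]

theorem comp_mem_homog (n : ℕ) (v : WordSpace K X) : comp n v ∈ homog K X n := by
  refine Submodule.sum_mem _ fun w _ => Submodule.smul_mem _ _ ?_
  dsimp only
  split_ifs with h
  · exact h ▸ single_mem_homog w
  · exact zero_mem _

theorem comp_of_mem {n : ℕ} {v : WordSpace K X} (h : v ∈ homog K X n) : comp n v = v := by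
  induction h using supported_induction with
  | single w hw => rw [Set.mem_ofPred_eq] at hw; simp [hw]
  | zero => simp
  | add x y _ _ hx hy => simp only [map_add, hx, hy]
  | smul c x _ hx => simp only [map_smul, hx]

theorem comp_of_mem_ne {m n : ℕ} {v : WordSpace K X} (h : v ∈ homog K X m) (hmn : m ≠ n) :
    comp n v = 0 := by
  induction h using supported_induction with
  | single w hw => rw [Set.mem_ofPred_eq] at hw; simp [hw, hmn]
  | zero => simp
  | add x y _ _ hx hy => simp only [map_add, hx, hy, add_zero]
  | smul c x _ hx => simp only [map_smul, hx, smul_zero]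

theorem comp_mem_kSpace (n : ℕ) {v : WordSpace K X} (h : v ∈ kSpace K deg) :
    comp n v ∈ kSpace K deg := by
  induction h using supported_induction with
  | single w hw =>
    rw [comp_single]
    split_ifs
    · exact single_mem_kSpace hw
    · exact zero_mem _
  | zero => simp
  | add x y _ _ hx hy => rw [map_add]; exact add_mem hx hy
  | smul c x _ hx => rw [map_smul]; exact Submodule.smul_mem _ _ hx

theorem exists_sum_comp (v : WordSpace K X) :
    ∃ N, ∀ n, N ≤ n → ∑ i ∈ Finset.range n, comp i v = v := by
  induction v using wordSpace_induction with
  | single w =>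
    refine ⟨w.length + 1, fun n hn => ?_⟩
    simp only [comp_single, Finset.sum_ite_eq, Finset.mem_range]
    rw [if_pos (by omega)]
  | zero => exact ⟨0, fun n _ => by simp⟩
  | add x y hx hy =>
    obtain ⟨N, hN⟩ := hx
    obtain ⟨M, hM⟩ := hy
    refine ⟨max N M, fun n hn => ?_⟩
    simp only [map_add, Finset.sum_add_distrib]
    rw [hN n (by omega), hM n (by omega)]
  | smul c x hx =>
    obtain ⟨N, hN⟩ := hx
    refine ⟨N, fun n hn => ?_⟩
    simp only [map_smul, ← Finset.smul_sum, hN n hn]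

theorem comp_cutAt (Θ : GradedCoproduct K deg) {i m n : ℕ} {w : ColWord X} (hi : i ≤ w.length) :
    TensorProduct.map (comp m) (comp n) (cutAt Θ i w) =
      if i = m ∧ w.length = m + n then cutAt Θ i w else 0 := by
  unfold cutAt
  generalize splitColors Θ (w.word.take i) 0 w.col = s
  induction s using finsupp_induction with
  | single s =>
    unfold ColWord.length at hi ⊢
    simp only [Finsupp.linearCombination_single, one_smul, TensorProduct.map_tmul, comp_single,
      ColWord.length, length_stdize, List.length_take, List.length_drop, Nat.min_eq_left hi]
    by_cases h1 : i = m
    · subst h1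
      by_cases h2 : w.word.length - i = n
      · rw [if_pos rfl, if_pos h2, if_pos ⟨rfl, by omega⟩]
      · rw [if_pos rfl, if_neg h2, if_neg (by omega), TensorProduct.tmul_zero]
    · rw [if_neg h1, TensorProduct.zero_tmul, if_neg fun h => h1 h.1]
  | zero => simp
  | add x y hx hy => simp only [map_add, hx, hy]; split_ifs <;> simp
  | smul c x hx => simp only [map_smul, hx]; split_ifs <;> simp

/-- A cut at `m` of a word of length `m + n` has bidegree `(m, n)`, so different cuts cannot cancel.
Primitivity of a homogeneous element thus means that each proper cut vanishes. -/
theorem cut_comp (Θ : GradedCoproduct K deg) {m n : ℕ} (hm : 1 ≤ m) (hn : 1 ≤ n)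
    (v : WordSpace K X) :
    cut Θ m (comp (m + n) v) = TensorProduct.map (comp m) (comp n) (coproduct Θ v) := by
  induction v using wordSpace_induction with
  | single w =>
    rw [coproduct_single, wordCoproduct_eq, map_sum]
    rw [Finset.sum_congr rfl fun i hi => comp_cutAt Θ (by
      have := (Finset.mem_Ico.1 hi).2; omega)]
    rw [comp_single]
    split_ifs with h
    · rw [Finset.sum_eq_single m]
      · simp [h]
      · intro b _ hb; simp [hb]
      · intro h'; simp at h'; omega
    · simp [h]
  | zero => simp
  | add x y hx hy => simp only [map_add, hx, hy]
  | smul c x hx => simp only [map_smul, hx]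

theorem cut_eq_zero (Θ : GradedCoproduct K deg) {n l : ℕ} {v : WordSpace K X}
    (hv : v ∈ homog K X n) (h : coproduct Θ v = 0) (hl : 1 ≤ l) (hln : l < n) :
    cut Θ l v = 0 := by
  have := cut_comp Θ hl (show 1 ≤ n - l by omega) v
  rwa [h, map_zero, Nat.add_sub_cancel' hln.le, comp_of_mem hv] at this

theorem coproduct_eq_zero_iff (Θ : GradedCoproduct K deg) {n : ℕ} {v : WordSpace K X}
    (hv : v ∈ homog K X n) : coproduct Θ v = 0 ↔ ∀ l, 1 ≤ l → l < n → cut Θ l v = 0 := by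
  refine ⟨fun h l => cut_eq_zero Θ hv h, fun h => ?_⟩
  rw [coproduct_eq_sum_cut Θ hv]
  exact Finset.sum_eq_zero fun l hl => h l (Finset.mem_Ico.1 hl).1 (Finset.mem_Ico.1 hl).2

theorem comp_mem_primitives (Θ : GradedCoproduct K deg) (n : ℕ) {v : WordSpace K X}
    (h : v ∈ primitives Θ) : comp n v ∈ primitives Θ := by
  refine ⟨comp_mem_kSpace n h.1, ?_⟩
  rw [SetLike.mem_coe, LinearMap.mem_ker, coproduct_eq_zero_iff Θ (comp_mem_homog n v)]
  intro l h1 h2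
  have := cut_comp Θ h1 (show 1 ≤ n - l by omega) v
  rwa [LinearMap.mem_ker.1 h.2, map_zero, Nat.add_sub_cancel' h2.le] at this

/-! ### Closure of the primitive elements under the operations -/

/-- A subspace which contains the homogeneous components of its elements. -/
def IsGraded (S : Submodule K (WordSpace K X)) : Prop := ∀ n, ∀ v ∈ S, comp n v ∈ S

theorem IsGraded.induction {S : Submodule K (WordSpace K X)} (hS : IsGraded S)
    {p : WordSpace K X → Prop} (homog : ∀ n, ∀ v ∈ S, v ∈ homog K X n → p v) (zero : p 0)
    (add : ∀ x y, p x → p y → p (x + y)) {v : WordSpace K X} (hv : v ∈ S) : p v := by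
  obtain ⟨N, hN⟩ := exists_sum_comp v
  rw [← hN N le_rfl]
  exact Finset.sum_induction _ p (fun x y => add x y) zero
    fun i _ => homog i _ (hS i v hv) (comp_mem_homog i v)

/-- By multilinearity, the entries of `xs` and the last argument may be replaced by their
homogeneous components, which stay in `S`. -/
theorem primOp_mem_of_homog {S T : Submodule K (WordSpace K X)} (hS : IsGraded S) {j : ℕ}
    {y : WordSpace K X}
    (h : ∀ (xs : List (ℕ × WordSpace K X)) (n : ℕ) (z : WordSpace K X), HomogIn S xs →
      z ∈ S → z ∈ homog K X n → primOp (elts xs) j y z ∈ T)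
    (xs : List (WordSpace K X)) (hxs : ∀ x ∈ xs, x ∈ S) {z : WordSpace K X} (hz : z ∈ S) :
    primOp xs j y z ∈ T := by
  -- The prefix `ys` collects the entries that have already been replaced by homogeneous ones.
  suffices H : ∀ ys : List (ℕ × WordSpace K X), HomogIn S ys → primOp (elts ys ++ xs) j y z ∈ T by
    simpa using H [] (by simp [HomogIn])
  induction xs with
  | nil =>
    intro ys hys
    rw [List.append_nil]
    exact hS.induction (fun n z hz hz' => h ys n z hys hz hz')
      (by
        have := primOp_smul_right (elts ys) j (0 : K) y 0
        rw [zero_smul, zero_smul] at this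
        rw [this]; exact zero_mem T)
      (fun z z' hz hz' => by rw [primOp_add_right]; exact add_mem hz hz') hz
  | cons x xs ih =>
    intro ys hys
    refine hS.induction (p := fun x => primOp (elts ys ++ x :: xs) j y z ∈ T) (fun n v hv hv' => ?_)
      ?_ (fun a b ha hb => ?_) (hxs x (by simp))
    · have := ih (fun x hx => hxs x (by simp [hx])) (ys ++ [(n, v)]) (by
        intro x hx
        simp only [List.mem_append, List.mem_singleton] at hx
        rcases hx with hx | rfl
        · exact hys x hx
        · exact ⟨hv, hv'⟩)
      simpa using this
    · have := primOp_smul_left (elts ys) xs (0 : K) 0 j y z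
      rw [zero_smul, zero_smul] at this
      rw [this]
      exact zero_mem T
    · rw [primOp_add_left]
      exact add_mem ha hb

theorem primitives_homog_mem {Θ : GradedCoproduct K deg} {n : ℕ} {v : WordSpace K X}
    (h : v ∈ primitives Θ) (h' : v ∈ homog K X n) : v ∈ admHomog K deg n :=
  mem_admHomog_of_mem h.1 h'

theorem concat_mem_admHomog {Θ : GradedCoproduct K deg} {xs : List (ℕ × WordSpace K X)}
    (h : HomogIn (primitives Θ) xs) : concat (elts xs) ∈ admHomog K deg (degs xs) := by
  induction xs with
  | nil => exact unit_mem_admHomog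
  | cons x xs ih =>
    rw [homogIn_cons] at h
    simpa using bul_mem_admHomog (primitives_homog_mem h.1.1 h.1.2) (ih h.2)

theorem cut_bul_zero_of_lt (hdeg : ∀ x, 1 ≤ deg x) {Θ : GradedCoproduct K deg} {m n l : ℕ}
    {x u : WordSpace K X} (hx : x ∈ primitives Θ) (hx' : x ∈ homog K X n)
    (hu : u ∈ admHomog K deg m) (h1 : 1 ≤ l) (hl : l < n) : cut Θ l (bul 0 x u) = 0 := by
  rw [cut_bul_mid hdeg Θ (primitives_homog_mem hx hx') hu (Nat.zero_le _) (Nat.zero_le _)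
    (by omega), Nat.sub_zero, cut_eq_zero Θ hx' hx.2 h1 hl, map_zero, LinearMap.zero_apply]

theorem cut_bul_zero_of_le (hdeg : ∀ x, 1 ≤ deg x) {Θ : GradedCoproduct K deg} {m n l : ℕ}
    {x u : WordSpace K X} (hx : x ∈ admHomog K deg n)
    (hu : u ∈ admHomog K deg m) (hl : n ≤ l) :
    cut Θ l (bul 0 x u) = (bul 0 x).rTensor _ (cut Θ (l - n) u) := by
  conv_lhs => rw [← Nat.sub_add_cancel hl]
  exact cut_bul_right hdeg Θ hx hu (Nat.zero_le _) (Nat.zero_le _)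

/-- The cut falls strictly inside the last factor: the other factors go to the left tensor factor
undivided, and the cut of the primitive element `y` is zero. -/
theorem cut_concat_eq_zero (hdeg : ∀ x, 1 ≤ deg x) {Θ : GradedCoproduct K deg} {m l : ℕ}
    {y : WordSpace K X} (hy : y ∈ primitives Θ) (hy' : y ∈ homog K X m)
    {xs : List (ℕ × WordSpace K X)} (h : HomogIn (primitives Θ) xs) (hl : degs xs < l)
    (hl' : l < degs xs + m) : cut Θ l (bul 0 (concat (elts xs)) y) = 0 := by
  induction xs generalizing l with
  | nil =>
    simp only [degs_nil, zero_add] at hl hl'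
    simpa using cut_eq_zero Θ hy' hy.2 hl hl'
  | cons x xs ih =>
    rw [homogIn_cons] at h
    rw [degs_cons] at hl hl'
    rw [elts_cons, concat_cons, bul_assoc, cut_bul_zero_of_le hdeg
      (primitives_homog_mem h.1.1 h.1.2) (bul_mem_admHomog (concat_mem_admHomog h.2)
      (primitives_homog_mem hy hy')) (by omega), ih h.2 (by omega) (by omega), map_zero]

theorem lTensor_rTensor (f g : WordSpace K X →ₗ[K] WordSpace K X)
    (t : WordSpace K X ⊗[K] WordSpace K X) :
    f.lTensor _ (g.rTensor _ t) = g.rTensor _ (f.lTensor _ t) := by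
  induction t with
  | zero => simp
  | tmul a b => simp
  | add x y hx hy => simp only [map_add, hx, hy]

/-- A cut inside the block of `z` vanishes because `z` is primitive, and a cut behind it vanishes
because, by `1 ≤ j`, it is a cut strictly inside `y`. A cut before the block survives only at a
boundary of factors, and there the subtracted product has the same cut. -/
theorem primOp_mem_primitives (hdeg : ∀ x, 1 ≤ deg x) {Θ : GradedCoproduct K deg} {m n j : ℕ}
    {y z : WordSpace K X} (hy : y ∈ primitives Θ) (hy' : y ∈ homog K X m)
    (hz : z ∈ primitives Θ) (hz' : z ∈ homog K X n) (hj : 1 ≤ j) (hjm : j ≤ m)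
    {xs : List (ℕ × WordSpace K X)} (h : HomogIn (primitives Θ) xs) :
    primOp (elts xs) j y z ∈ primitives Θ := by
  have hya := primitives_homog_mem hy hy'
  have hza := primitives_homog_mem hz hz'
  cases xs with
  | nil =>
    have hmem := primOp_mem_homog (S := primitives Θ) (xs := []) h j hy' hz'
    refine ⟨?_, ?_⟩
    · rw [elts_nil, primOp_nil hy']
      refine sub_mem (bul_mem_kSpace _ hz.1 hy.1) ?_
      split_ifs
      · exact bul_mem_kSpace _ hy.1 hz.1
      · exact zero_mem _
    rw [SetLike.mem_coe, LinearMap.mem_ker, coproduct_eq_zero_iff Θ hmem]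
    intro l h1 h2
    rw [degs_nil, zero_add] at h2
    rw [elts_nil, primOp_nil hy', map_sub, sub_eq_zero]
    rcases le_or_gt l j with hlj | hlj
    · rw [cut_bul_left hdeg Θ hza hya hjm hlj]
      rcases (hlj.trans hjm).eq_or_lt with rfl | hlm
      · obtain rfl : j = l := le_antisymm hjm hlj
        rw [cut_length hdeg Θ hya, if_pos rfl, cut_bul_zero_of_le hdeg hya hza le_rfl, Nat.sub_self,
          cut_zero hdeg Θ hza]
        simp
      · rw [cut_eq_zero Θ hy' hy.2 h1 hlm, map_zero]
        split_ifs
        · rw [cut_bul_zero_of_lt hdeg hy hy' hza h1 hlm]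
        · simp
    rcases lt_or_ge l (j + n) with hln | hln
    · rw [cut_bul_mid hdeg Θ hza hya hjm hlj.le hln.le,
        cut_eq_zero Θ hz' hz.2 (by omega) (by omega), map_zero, LinearMap.zero_apply]
      split_ifs with hjm'
      · rw [cut_bul_zero_of_le hdeg hya hza (by omega),
          cut_eq_zero Θ hz' hz.2 (by omega) (by omega), map_zero]
      · simp
    · obtain ⟨l, rfl⟩ : ∃ l', l = l' + n := ⟨l - n, by omega⟩
      rw [cut_bul_right hdeg Θ hza hya hjm (by omega),
        cut_eq_zero Θ hy' hy.2 (by omega) (by omega), map_zero, if_neg (by omega), map_zero]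
  | cons x xs =>
    have hmem := primOp_mem_homog (S := primitives Θ) h j hy' hz'
    have hx := homogIn_cons.1 h
    have hxa := primitives_homog_mem hx.1.1 hx.1.2
    have hua := bul_mem_admHomog (i := 0) (concat_mem_admHomog hx.2) hya
    have hCa := bul_mem_admHomog (i := j + degs xs) hza hua
    have hwa := bul_mem_admHomog (i := 0) hxa hua
    refine ⟨?_, ?_⟩
    · have hk : ∀ (xs : List (ℕ × WordSpace K X)), HomogIn (primitives Θ) xs →
          bul 0 (concat (elts xs)) y ∈ kSpace K deg := by
        intro xs hxs
        induction xs with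
        | nil => simpa using hy.1
        | cons x xs ih =>
          rw [homogIn_cons] at hxs
          rw [elts_cons, concat_cons, bul_assoc]
          exact bul_mem_kSpace _ hxs.1.1.1 (ih hxs.2)
      rw [primOp_cons h]
      exact sub_mem (bul_mem_kSpace _ hz.1 (hk _ h))
        (bul_mem_kSpace _ hx.1.1.1 (bul_mem_kSpace _ hz.1 (hk _ hx.2)))
    rw [SetLike.mem_coe, LinearMap.mem_ker, coproduct_eq_zero_iff Θ hmem]
    intro l h1 h2
    rw [degs_cons] at h2
    rw [primOp_cons h, map_sub, sub_eq_zero, degs_cons, elts_cons, concat_cons, bul_assoc]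
    set u := bul 0 (concat (elts xs)) y with hu
    have hJ : j + (x.1 + degs xs) ≤ x.1 + (degs xs + m) := by omega
    rcases le_or_gt l (j + (x.1 + degs xs)) with hlJ | hlJ
    · rw [cut_bul_left hdeg Θ hza hwa hJ hlJ]
      -- Cuts inside `x` vanish. From the end of `x` on, splitting off `x` acts on the left tensor
      -- factor and inserting `z` on the right one, so the two terms have equal cuts.
      rcases lt_or_ge l x.1 with hlx | hlx
      · rw [cut_bul_zero_of_lt hdeg hx.1.1 hx.1.2 hua h1 hlx,
          cut_bul_zero_of_lt hdeg hx.1.1 hx.1.2 hCa h1 hlx, map_zero]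
      · rw [cut_bul_zero_of_le hdeg hxa hua hlx, cut_bul_zero_of_le hdeg hxa hCa hlx,
          cut_bul_left hdeg Θ hza hua (by omega) (by omega), lTensor_rTensor,
          show j + (x.1 + degs xs) - l = j + degs xs - (l - x.1) by omega]
    rw [cut_bul_zero_of_le hdeg hxa hCa (by omega)]
    rcases lt_or_ge l (j + (x.1 + degs xs) + n) with hln | hln
    · rw [cut_bul_mid hdeg Θ hza hwa hJ hlJ.le hln.le,
        cut_eq_zero Θ hz' hz.2 (by omega) (by omega), map_zero, LinearMap.zero_apply,
        cut_bul_mid hdeg Θ hza hua (by omega) (by omega) (by omega),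
        cut_eq_zero Θ hz' hz.2 (by omega) (by omega), map_zero, LinearMap.zero_apply, map_zero]
    · obtain ⟨l, rfl⟩ : ∃ l', l = l' + n := ⟨l - n, by omega⟩
      rw [cut_bul_right hdeg Θ hza hwa hJ (by omega), cut_bul_zero_of_le hdeg hxa hua (by omega),
        cut_concat_eq_zero hdeg hy hy' hx.2 (by omega) (by omega),
        show l + n - x.1 = l - x.1 + n by omega,
        cut_bul_right hdeg Θ hza hua (by omega) (by omega),
        cut_concat_eq_zero hdeg hy hy' hx.2 (by omega) (by omega)]
      simp

theorem isGraded_primitives (Θ : GradedCoproduct K deg) : IsGraded (primitives Θ) :=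
  fun n _ hv => comp_mem_primitives Θ n hv

theorem closedUnderPrimOp_primitives (hdeg : ∀ x, 1 ≤ deg x) (Θ : GradedCoproduct K deg) :
    ClosedUnderPrimOp (primitives Θ) := by
  intro xs m p y z hxs hy hy' h1 hpm hz
  exact primOp_mem_of_homog (isGraded_primitives Θ) (fun xs n z h hz hz' =>
    primOp_mem_primitives hdeg hy hy' hz hz' h1 hpm h) xs hxs hz

end
end Presh

namespace Presh
open scoped TensorProduct
noncomputable section
variable {K : Type u} {X : Type v}
variable [Field K] {deg : X → ℕ}

/-! ### The elements `e(x)` -/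

theorem GradedCoproduct.map_single (Θ : GradedCoproduct K deg) (x : X) :
    Θ.map (Finsupp.single x 1) = (Θ.coeff x).sum fun ab c =>
      c • (Finsupp.single ab.1 (1 : K) ⊗ₜ[K] Finsupp.single ab.2 (1 : K)) := by
  apply (finsuppTensorFinsupp' K X X).injective
  rw [Finsupp.sum, map_sum]
  simp only [map_smul, finsuppTensorFinsupp'_single_tmul_single, mul_one, Finsupp.smul_single,
    smul_eq_mul]
  exact (Finsupp.sum_single _).symm

theorem GradedCoproduct.deg_add (Θ : GradedCoproduct K deg) {x : X} {ab : X × X}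
    (h : ab ∈ (Θ.coeff x).support) : deg ab.1 + deg ab.2 = deg x :=
  Θ.graded x ab.1 ab.2 (Finsupp.mem_support_iff.1 h)

theorem xiWord_append_singleton (deg : X → ℕ) (l : List X) (b : X) :
    xiWord deg (l ++ [b]) = wordMul 0 (xiWord deg l) (corolla deg b) := by
  rw [wordMul_zero]
  ext1
  · simp only [xiWord, corolla]
    induction l with
    | nil => simp [xiList]
    | cons x l ih => simp [xiList, ih]
  · rfl

theorem iterCoproduct_eq_zero (hdeg : ∀ x, 1 ≤ deg x) (Θ : GradedCoproduct K deg) {r : ℕ} {x : X}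
    (h : deg x ≤ r) : iterCoproduct Θ r x = 0 := by
  induction r generalizing x with
  | zero => have := hdeg x; omega
  | succ r ih =>
    rw [iterCoproduct, Finsupp.sum]
    refine Finset.sum_eq_zero fun ab hab => ?_
    have h1 := Θ.deg_add hab
    have h2 := hdeg ab.2
    rw [ih (by omega), Finsupp.mapDomain_zero, smul_zero]

theorem mapDomain_xiWord_append (l : List X →₀ K) (b : X) :
    (l.mapDomain fun l => l ++ [b]).mapDomain (xiWord deg) =
      bul 0 (l.mapDomain (xiWord deg)) (Finsupp.single (corolla deg b) 1) := by
  induction l using finsupp_induction with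
  | single l => simp [Finsupp.mapDomain_single, xiWord_append_singleton]
  | zero => simp
  | add x y hx hy => simp only [Finsupp.mapDomain_add, hx, hy, map_add, LinearMap.add_apply]
  | smul c x hx => simp only [Finsupp.mapDomain_smul, hx, map_smul, LinearMap.smul_apply]

theorem xiWord_singleton (deg : X → ℕ) (x : X) : xiWord deg [x] = corolla deg x := by
  simp [xiWord, xiList, corolla]

/-- The recursion `e(x) = (ξ; x) - ∑ e(x₍₁₎) •₀ (ξ; x₍₂₎)`. -/
theorem eElt_eq (hdeg : ∀ x, 1 ≤ deg x) (Θ : GradedCoproduct K deg) (x : X) :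
    eElt Θ x = Finsupp.single (corolla deg x) 1 - (Θ.coeff x).sum fun ab c =>
      c • bul 0 (eElt Θ ab.1) (Finsupp.single (corolla deg ab.2) 1) := by
  obtain ⟨d, hd⟩ : ∃ d, deg x = d + 1 := ⟨deg x - 1, by have := hdeg x; omega⟩
  -- The range depends on `deg ab.1`; the added terms vanish, and a common range `d` allows the two
  -- sums to be exchanged.
  have he : ∀ ab ∈ (Θ.coeff x).support, eElt Θ ab.1 =
      ∑ r ∈ Finset.range d, (-1 : K) ^ r • (iterCoproduct Θ r ab.1).mapDomain (xiWord deg) := by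
    intro ab hab
    have h1 := Θ.deg_add hab
    have h2 := hdeg ab.2
    refine Finset.sum_subset (fun i => by simp only [Finset.mem_range]; omega) fun r _ hr => ?_
    rw [iterCoproduct_eq_zero hdeg Θ (by simpa using hr), Finsupp.mapDomain_zero, smul_zero]
  rw [Finsupp.sum, Finset.sum_congr rfl fun ab hab => by rw [he ab hab], eElt, hd,
    Finset.sum_range_succ']
  simp only [pow_zero, one_smul, iterCoproduct, Finsupp.mapDomain_single, xiWord_singleton]
  rw [add_comm, sub_eq_add_neg]
  congr 1
  simp only [map_sum, LinearMap.sum_apply, Finset.smul_sum]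
  rw [Finset.sum_comm, ← Finset.sum_neg_distrib]
  refine Finset.sum_congr rfl fun r _ => ?_
  rw [Finsupp.sum, Finsupp.mapDomain_finsetSum, Finset.smul_sum, ← Finset.sum_neg_distrib]
  refine Finset.sum_congr rfl fun ab _ => ?_
  rw [Finsupp.mapDomain_smul, mapDomain_xiWord_append, map_smul, LinearMap.smul_apply, pow_succ,
    smul_comm, mul_neg_one, neg_smul, smul_neg]

theorem corolla_mem_admHomog (x : X) :
    Finsupp.single (corolla deg x) (1 : K) ∈ admHomog K deg (deg x) :=
  Finsupp.single_mem_supported K 1 ⟨admissible_corolla deg x, length_corolla deg x⟩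

theorem isKWord_corolla (hdeg : ∀ x, 1 ≤ deg x) (x : X) : IsKWord deg (corolla deg x) :=
  isKWord_iff.2 ⟨admissible_corolla deg x, by have := hdeg x; simp [corolla]; omega⟩

theorem eElt_mem_kSpace_homog (hdeg : ∀ x, 1 ≤ deg x) (Θ : GradedCoproduct K deg) (x : X) :
    eElt Θ x ∈ kSpace K deg ∧ eElt Θ x ∈ homog K X (deg x) := by
  induction hn : deg x using Nat.strong_induction_on generalizing x with
  | _ n ih =>
    subst hn
    rw [eElt_eq hdeg]
    have hx := isKWord_corolla hdeg x
    refine ⟨sub_mem (single_mem_kSpace hx) (Submodule.sum_mem _ fun ab hab => ?_),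
      sub_mem (admHomog_le_homog _ (corolla_mem_admHomog x))
        (Submodule.sum_mem _ fun ab hab => ?_)⟩
    all_goals
      have h1 := Θ.deg_add hab
      have h2 := hdeg ab.2
      have h3 := ih (deg ab.1) (by omega) ab.1 rfl
      refine Submodule.smul_mem _ _ ?_
    · exact bul_mem_kSpace 0 h3.1 (single_mem_kSpace (isKWord_corolla hdeg _))
    · rw [← h1]
      exact bul_mem_homog h3.2 (admHomog_le_homog _ (corolla_mem_admHomog _))

theorem eElt_mem_homog (hdeg : ∀ x, 1 ≤ deg x) (Θ : GradedCoproduct K deg) (x : X) :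
    eElt Θ x ∈ homog K X (deg x) := (eElt_mem_kSpace_homog hdeg Θ x).2

theorem stdize_replicate_zero (n : ℕ) : stdize (List.replicate n 0) = List.replicate n 0 := by
  simp [stdize]

theorem pairMul_nil_right (a : List X × List X →₀ K) :
    pairMul a (Finsupp.single ([], []) 1) = a := by
  induction a using finsupp_induction with
  | single a => simp
  | zero => simp
  | add x y hx hy => simp only [map_add, LinearMap.add_apply, hx, hy]
  | smul c x hx => simp only [map_smul, LinearMap.smul_apply, hx]

theorem cutAt_corolla (Θ : GradedCoproduct K deg) {x : X} {l : ℕ} (h1 : 1 ≤ l) (hl : l < deg x) :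
    cutAt Θ l (corolla deg x) = (Θ.coeff x).sum fun ab c => if deg ab.1 = l then
      c • (Finsupp.single (corolla deg ab.1) (1 : K) ⊗ₜ[K]
        Finsupp.single (corolla deg ab.2) (1 : K)) else 0 := by
  have h2 : (corolla deg x).word.take l = List.replicate l 0 := by
    simp [corolla, hl.le]
  have h3 : (corolla deg x).word.drop l = List.replicate (deg x - l) 0 := by
    simp [corolla]
  have h4 : splitColors Θ (List.replicate l 0) 0 (corolla deg x).col =
      (Θ.coeff x).sum fun ab c => if deg ab.1 = l then Finsupp.single ([ab.1], [ab.2]) c else 0 := by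
    change splitColors Θ (List.replicate l 0) 0 [x] = _
    rw [splitColors_cons, splitColors, pairMul_nil_right, List.count_replicate_self, splitColor,
      if_neg (by omega), if_neg (by omega)]
  rw [cutAt, h2, h3, h4, stdize_replicate_zero, stdize_replicate_zero, Finsupp.sum, map_sum,
    Finsupp.sum]
  refine Finset.sum_congr rfl fun ab hab => ?_
  have h5 := Θ.deg_add hab
  split_ifs with h
  · rw [Finsupp.linearCombination_single]
    simp only [corolla, h, show deg x - l = deg ab.2 by omega]
  · simp

theorem wordCoproduct_corolla (hdeg : ∀ x, 1 ≤ deg x) (Θ : GradedCoproduct K deg) (x : X) :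
    wordCoproduct Θ (corolla deg x) = (Θ.coeff x).sum fun ab c =>
      c • (Finsupp.single (corolla deg ab.1) (1 : K) ⊗ₜ[K]
        Finsupp.single (corolla deg ab.2) (1 : K)) := by
  rw [wordCoproduct_eq, length_corolla, Finset.sum_congr rfl fun l hl =>
    cutAt_corolla Θ (Finset.mem_Ico.1 hl).1 (Finset.mem_Ico.1 hl).2]
  simp only [Finsupp.sum]
  rw [Finset.sum_comm]
  refine Finset.sum_congr rfl fun ab hab => ?_
  have h1 := Θ.deg_add hab
  have h2 := hdeg ab.1
  have h3 := hdeg ab.2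
  rw [Finset.sum_ite_eq, if_pos (Finset.mem_Ico.2 (by omega))]

/-- The coproduct of a product whose first factor is primitive. -/
theorem coproduct_bul_zero (hdeg : ∀ x, 1 ≤ deg x) {Θ : GradedCoproduct K deg} {m n : ℕ}
    {a b : WordSpace K X} (ha : a ∈ primitives Θ) (ha' : a ∈ homog K X n) (hn : 1 ≤ n)
    (hb : b ∈ admHomog K deg m) (hm : 1 ≤ m) :
    coproduct Θ (bul 0 a b) = a ⊗ₜ b + (bul 0 a).rTensor _ (coproduct Θ b) := by
  have haa := primitives_homog_mem ha ha'
  rw [coproduct_eq_sum_cut Θ (bul_mem_homog ha' (admHomog_le_homog m hb)),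
    ← Finset.sum_Ico_consecutive _ hn (show n ≤ n + m by omega),
    Finset.sum_eq_zero, zero_add, Finset.sum_Ico_eq_sum_range, Nat.add_sub_cancel_left]
  · obtain ⟨m, rfl⟩ : ∃ m', m = m' + 1 := ⟨m - 1, by omega⟩
    rw [Finset.sum_range_succ', add_zero, cut_bul_zero_of_le hdeg haa hb le_rfl, Nat.sub_self,
      cut_zero hdeg Θ hb, LinearMap.rTensor_tmul, bul_unit_right, add_comm,
      coproduct_eq_sum_cut Θ (admHomog_le_homog _ hb), map_sum, Finset.sum_Ico_eq_sum_range]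
    congr 1
    refine Finset.sum_congr (by simp) fun i _ => ?_
    rw [cut_bul_zero_of_le hdeg haa hb (by omega), show n + (i + 1) - n = 1 + i by omega]
  · intro l hl
    rw [Finset.mem_Ico] at hl
    exact cut_bul_zero_of_lt hdeg ha ha' hb hl.1 hl.2

/-- The linear map `x ↦ (ξ; x)`. -/
def corollaMap (K : Type u) [Field K] (deg : X → ℕ) : (X →₀ K) →ₗ[K] WordSpace K X :=
  Finsupp.linearCombination K fun x => Finsupp.single (corolla deg x) 1

/-- The linear map `x ↦ e(x)`. -/
def eMap (Θ : GradedCoproduct K deg) : (X →₀ K) →ₗ[K] WordSpace K X :=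
  Finsupp.linearCombination K (eElt Θ)

/-- The product `•₀` on the tensor square. -/
def mulMap (K : Type u) [Field K] (X : Type v) :
    WordSpace K X ⊗[K] WordSpace K X →ₗ[K] WordSpace K X :=
  TensorProduct.lift (bul 0)

/-- The recursion `eElt_eq` as an identity of linear maps, the form to which coassociativity of `Θ`
applies. -/
theorem eMap_eq (hdeg : ∀ x, 1 ≤ deg x) (Θ : GradedCoproduct K deg) :
    eMap Θ + (mulMap K X ∘ₗ TensorProduct.map (eMap Θ) (corollaMap K deg)) ∘ₗ Θ.map =
      corollaMap K deg := by
  refine Finsupp.lhom_ext' fun x => LinearMap.ext_ring ?_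
  simp only [LinearMap.comp_apply, LinearMap.add_apply, Finsupp.lsingle_apply, Θ.map_single,
    Finsupp.sum, map_sum, map_smul, TensorProduct.map_tmul, mulMap, TensorProduct.lift.tmul, eMap,
    corollaMap, Finsupp.linearCombination_single, one_smul]
  rw [eElt_eq hdeg Θ x]
  exact sub_add_cancel _ _

theorem map_corolla_assoc (Θ : GradedCoproduct K deg)
    (t : (X →₀ K) ⊗[K] ((X →₀ K) ⊗[K] (X →₀ K))) :
    TensorProduct.map (mulMap K X ∘ₗ TensorProduct.map (eMap Θ) (corollaMap K deg))
      (corollaMap K deg) ((TensorProduct.assoc K _ _ _).symm t) =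
    TensorProduct.map (mulMap K X) LinearMap.id ((TensorProduct.assoc K _ _ _).symm
      (TensorProduct.map (eMap Θ)
        (TensorProduct.map (corollaMap K deg) (corollaMap K deg)) t)) := by
  induction t with
  | zero => simp
  | add x y hx hy => simp only [map_add, hx, hy]
  | tmul a t =>
    induction t with
    | zero => simp
    | add x y hx hy => simp only [TensorProduct.tmul_add, map_add, hx, hy]
    | tmul b c => simp

theorem mulMap_rTensor (a : WordSpace K X) (t : WordSpace K X ⊗[K] WordSpace K X) :
    TensorProduct.map (mulMap K X) LinearMap.id ((TensorProduct.assoc K _ _ _).symm (a ⊗ₜ t)) =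
      (bul 0 a).rTensor _ t := by
  induction t with
  | zero => simp
  | add x y hx hy => simp only [TensorProduct.tmul_add, map_add, hx, hy]
  | tmul b c => simp [mulMap]

theorem coproduct_corollaMap (hdeg : ∀ x, 1 ≤ deg x) (Θ : GradedCoproduct K deg) (v : X →₀ K) :
    coproduct Θ (corollaMap K deg v) =
      TensorProduct.map (corollaMap K deg) (corollaMap K deg) (Θ.map v) := by
  induction v using finsupp_induction with
  | single x =>
    simp [corollaMap, wordCoproduct_corolla hdeg, Θ.map_single, Finsupp.sum]
  | zero => simp
  | add x y hx hy => simp only [map_add, hx, hy]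
  | smul c x hx => simp only [map_smul, hx]

theorem eq_zero_of_eq_add_self {G : Type*} [AddCommGroup G] {a b : G} (h : b = a + b) : a = 0 := by
  simpa using h

/-- Write `C` for `corollaMap`, `E` for `eMap` and `μ` for `•₀`, so that `C = E + μ(E ⊗ C)Θ`. By
induction the left factors in `μ(E ⊗ C)Θ(x)` are primitive, so its coproduct is `(E ⊗ C)Θ(x) + (μ(E
⊗ C) ⊗ C)(1 ⊗ Θ)Θ(x)` up to reassociation. Coassociativity turns this into `((E + μ(E ⊗ C)Θ) ⊗
C)Θ(x) = (C ⊗ C)Θ(x)`, which is the coproduct of `C(x)`. Nothing is left for `E(x)`. -/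
theorem eElt_mem_primitives (hdeg : ∀ x, 1 ≤ deg x) (Θ : GradedCoproduct K deg) (x : X) :
    eElt Θ x ∈ primitives Θ := by
  induction hn : deg x using Nat.strong_induction_on generalizing x with
  | _ n ih =>
    subst hn
    refine ⟨(eElt_mem_kSpace_homog hdeg Θ x).1, ?_⟩
    rw [SetLike.mem_coe, LinearMap.mem_ker]
    set C := corollaMap K deg with hC
    set E := eMap Θ with hE
    have hex : eElt Θ x + mulMap K X (TensorProduct.map E C (Θ.map (Finsupp.single x 1))) =
        C (Finsupp.single x 1) := by
      have := LinearMap.congr_fun (eMap_eq hdeg Θ) (Finsupp.single x 1)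
      simpa [eMap, hE] using this
    have key : coproduct Θ (mulMap K X (TensorProduct.map E C (Θ.map (Finsupp.single x 1)))) =
        TensorProduct.map E C (Θ.map (Finsupp.single x 1)) +
          TensorProduct.map (mulMap K X) LinearMap.id ((TensorProduct.assoc K _ _ _).symm
            (TensorProduct.map E (TensorProduct.map C C)
              (Θ.map.lTensor _ (Θ.map (Finsupp.single x 1))))) := by
      rw [Θ.map_single, Finsupp.sum]
      simp only [map_sum, map_smul, ← Finset.sum_add_distrib, ← smul_add]
      refine Finset.sum_congr rfl fun ab hab => ?_
      have h1 := Θ.deg_add hab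
      have h2 := hdeg ab.1
      have h3 := hdeg ab.2
      rw [TensorProduct.map_tmul, LinearMap.lTensor_tmul, TensorProduct.map_tmul, mulMap_rTensor,
        ← coproduct_corollaMap hdeg]
      have h4 : E (Finsupp.single ab.1 1) = eElt Θ ab.1 := by simp [hE, eMap]
      have h5 : C (Finsupp.single ab.2 1) = Finsupp.single (corolla deg ab.2) 1 := by
        simp [hC, corollaMap]
      rw [h4, h5]
      simp only [mulMap, TensorProduct.lift.tmul]
      rw [coproduct_bul_zero hdeg (ih _ (by omega) ab.1 rfl) (eElt_mem_homog hdeg Θ _) h2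
        (corolla_mem_admHomog _) h3]
    have hco : Θ.map.lTensor _ (Θ.map (Finsupp.single x 1)) =
        TensorProduct.assoc K _ _ _ (Θ.map.rTensor _ (Θ.map (Finsupp.single x 1))) :=
      (LinearMap.congr_fun Θ.coassoc (Finsupp.single x 1)).symm
    rw [hco, ← map_corolla_assoc, LinearEquiv.symm_apply_apply, LinearMap.rTensor,
      TensorProduct.map_map, LinearMap.comp_id, ← LinearMap.add_apply, ← hE, ← hC,
      ← TensorProduct.map_add_left, hE, hC, eMap_eq hdeg Θ, ← coproduct_corollaMap hdeg, ← hE,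
      ← hC, ← hex, map_add] at key
    exact eq_zero_of_eq_add_self (G := WordSpace K X ⊗[K] WordSpace K X) key

end
end Presh

namespace Presh
open scoped TensorProduct
noncomputable section
variable {K : Type u} {X : Type v}

/-! ### Irreducible words and normal forms -/

theorem not_isIrr_iff {f : List ℕ} : ¬ IsIrr f ↔ ∃ c r, 0 < c ∧ c < f.length ∧
    (∀ a ∈ f.take c, a < r) ∧ ∀ a ∈ f.drop c, r ≤ a := by
  rw [IsIrr, not_not]
  constructor
  · rintro ⟨g, h, r, hg, hh, hgr, rfl⟩
    refine ⟨g.length, r, List.length_pos_iff.2 hg, ?_, ?_, ?_⟩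
    · have := List.length_pos_iff.2 hh
      simpa
    · simpa using hgr
    · intro a ha
      rw [List.drop_left] at ha
      obtain ⟨b, -, rfl⟩ := List.mem_map.1 ha
      omega
  · rintro ⟨c, r, h0, h1, h2, h3⟩
    refine ⟨f.take c, (f.drop c).map (· - r), r, ?_, ?_, h2, ?_⟩
    · exact List.ne_nil_of_length_pos (by simp; omega)
    · exact List.ne_nil_of_length_pos (by simp; omega)
    · conv_lhs => rw [← List.take_append_drop c f, ← List.map_id (f.drop c)]
      rw [List.map_map]
      congr 1
      refine List.map_congr_left fun a ha => ?_
      have := h3 a ha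
      simp only [id, Function.comp]
      omega

theorem not_isIrr_wordMul {deg : X → ℕ} {p q : ColWord X} (hp : IsKWord deg p)
    (hq : q.word ≠ []) : ¬ IsIrr (wordMul 0 p q).word := by
  rw [IsIrr, not_not]
  exact ⟨p.word, q.word, p.col.length, hp.ne_nil, hq, hp.lt_length, by simp [wordMul]⟩

theorem corolla_word_pos (deg : X → ℕ) (hdeg : ∀ x, 1 ≤ deg x) (x : X) :
    ∃ d, (corolla deg x).word = List.replicate (d + 1) 0 :=
  ⟨deg x - 1, by have := hdeg x; simp only [corolla]; congr 1; omega⟩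

theorem isIrr_corolla (deg : X → ℕ) (x : X) : IsIrr (corolla deg x).word := by
  by_contra h
  obtain ⟨c, r, h0, h1, h2, h3⟩ := not_isIrr_iff.1 h
  simp only [corolla, List.length_replicate, List.take_replicate, List.drop_replicate,
    List.mem_replicate, ne_eq] at h1 h2 h3
  have h4 := h2 0 ⟨by omega, rfl⟩
  have h5 := h3 0 ⟨by omega, rfl⟩
  omega

/-- A splitting must come after the inserted block of zeros. Removing the zeros leaves a splitting
of `T •₀ s` at a place strictly inside `s`, because `J` is beyond `T`, and this splits `s`. -/
theorem isIrr_wordMul_corolla {deg : X → ℕ} (hdeg : ∀ x, 1 ≤ deg x) (x : X) {T s : ColWord X}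
    (hs : IsIrr s.word) {J : ℕ} (h1 : T.length < J) (h2 : J ≤ T.length + s.length) :
    IsIrr (wordMul J (corolla deg x) (wordMul 0 T s)).word := by
  by_contra h
  obtain ⟨c, r, h0, hc, hlt, hge⟩ := not_isIrr_iff.1 h
  refine not_isIrr_iff.2 ?_ hs
  obtain ⟨d, hd⟩ := corolla_word_pos deg hdeg x
  set U := T.word ++ s.word.map (· + T.col.length) with hU
  have hu : (wordMul 0 T s).word = U := by simp [wordMul_zero, hU]
  have hw : (wordMul J (corolla deg x) (wordMul 0 T s)).word =
      (U.take J).map (· + 1) ++ List.replicate (d + 1) 0 ++ (U.drop J).map (· + 1) := by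
    rw [wordMul, hu, hd]; rfl
  have hUl : U.length = T.word.length + s.word.length := by simp [hU]
  clear_value U
  unfold ColWord.length at h1 h2
  rw [hw] at hc hlt hge
  -- Otherwise a `0` stands to the right of the cut, which forces `r = 0`, while the nonempty left
  -- part has letters below `r`.
  have hcJ : J + d + 1 ≤ c := by
    by_contra hcon
    have h3 : (U.take J).map (· + 1) ++ List.replicate (d + 1) 0 ++ (U.drop J).map (· + 1) =
        ((U.take J).map (· + 1) ++ List.replicate d 0) ++ 0 :: (U.drop J).map (· + 1) := by
      rw [List.replicate_succ']; simp
    rw [h3] at hge hlt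
    have h4 : 0 ∈ List.drop c (((U.take J).map (· + 1) ++ List.replicate d 0) ++
        0 :: (U.drop J).map (· + 1)) := by
      rw [List.drop_append_of_le_length (by simp; omega)]
      simp
    have h5 := hge 0 h4
    obtain ⟨a, ha⟩ : ∃ a, a ∈ List.take c (((U.take J).map (· + 1) ++ List.replicate d 0) ++
        0 :: (U.drop J).map (· + 1)) := by
      refine List.exists_mem_of_length_pos ?_
      simp; omega
    have := hlt a ha
    omega
  have hlen : ((U.take J).map (· + 1) ++ List.replicate (d + 1) 0).length = J + d + 1 := by
    simp; omega
  rw [List.take_append, hlen] at hlt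
  rw [List.drop_append, hlen] at hge
  have hUlt : ∀ a ∈ U.take (c - (d + 1)), a + 1 < r := by
    intro a ha
    apply hlt
    have h3 : c - (d + 1) = J + (c - (J + d + 1)) := by omega
    rw [h3, List.take_add, List.mem_append] at ha
    rw [List.mem_append]
    rcases ha with ha | ha
    · left
      rw [List.take_of_length_le (by rw [hlen]; omega), List.mem_append]
      exact .inl (List.mem_map.2 ⟨a, ha, rfl⟩)
    · right
      rw [← List.map_take]
      exact List.mem_map.2 ⟨a, ha, rfl⟩
  have hUge : ∀ a ∈ U.drop (c - (d + 1)), r ≤ a + 1 := by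
    intro a ha
    apply hge
    have h3 : c - (d + 1) = J + (c - (J + d + 1)) := by omega
    rw [h3, ← List.drop_drop] at ha
    rw [List.mem_append]
    right
    rw [← List.map_drop]
    exact List.mem_map.2 ⟨a, ha, rfl⟩
  have hc2 : c - (d + 1) < U.length := by
    simp only [List.length_append, hlen, List.length_map, List.length_drop] at hc
    omega
  -- The cut and the bound in `s`: the `d + 1` zeros and the letters of `T` are dropped from the
  -- position, and the shifts by `1` and by the colours of `T` are undone.
  refine ⟨c - (d + 1) - T.word.length, r - 1 - T.col.length, by omega, by omega,
    fun a ha => ?_, fun a ha => ?_⟩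
  · have := hUlt (a + T.col.length) (by
      rw [hU, List.take_append, List.mem_append, ← List.map_take]
      exact .inr (List.mem_map.2 ⟨a, ha, rfl⟩))
    omega
  · have := hUge (a + T.col.length) (by
      rw [hU, List.drop_append, List.mem_append, ← List.map_drop]
      exact .inr (List.mem_map.2 ⟨a, ha, rfl⟩))
    omega

/-! ### Unique factorization into irreducible words. -/

/-- The product `w₁ •₀ ⋯ •₀ w_k` of a list of words. -/
def prodW (l : List (ColWord X)) : ColWord X := l.foldr (wordMul 0) ⟨[], []⟩

@[simp] theorem prodW_nil : prodW ([] : List (ColWord X)) = ⟨[], []⟩ := rfl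

@[simp] theorem prodW_cons (p : ColWord X) (l : List (ColWord X)) :
    prodW (p :: l) = wordMul 0 p (prodW l) := rfl

theorem prodW_append (l l' : List (ColWord X)) :
    prodW (l ++ l') = wordMul 0 (prodW l) (prodW l') := by
  induction l with
  | nil => simp
  | cons p l ih => rw [List.cons_append, prodW_cons, prodW_cons, ih, wordMul_assoc]

theorem foldr_wordMul (l : List (ColWord X)) (s : ColWord X) :
    l.foldr (wordMul 0) s = wordMul 0 (prodW l) s := by
  induction l with
  | nil => simp
  | cons p l ih => rw [List.foldr_cons, prodW_cons, ih, wordMul_assoc]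

theorem length_prodW (l : List (ColWord X)) : (prodW l).length = (l.map ColWord.length).sum := by
  induction l with
  | nil => rfl
  | cons p l ih => simp [ih]

theorem admissible_prodW {deg : X → ℕ} {l : List (ColWord X)} (h : ∀ p ∈ l, IsKWord deg p) :
    Admissible deg (prodW l) := by
  induction l with
  | nil => exact admissible_nil
  | cons p l ih =>
    rw [List.forall_mem_cons] at h
    exact h.1.admissible.wordMul (ih h.2) 0

theorem NormalForm.length_alpha (deg : X → ℕ) (t : NormalForm X) :
    (t.alpha deg).length = t.degree deg := by
  induction t with
  | gen x => simp [alpha, degree]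
  | op q ts s j x iht ihs =>
    simp only [alpha, degree, foldr_wordMul, length_wordMul, length_prodW, List.map_ofFn,
      List.sum_ofFn, length_corolla, ihs, Function.comp_def, iht]
    omega

theorem NormalForm.degree_pos {deg : X → ℕ} (hdeg : ∀ x, 1 ≤ deg x) (t : NormalForm X) :
    1 ≤ t.degree deg := by
  cases t with
  | gen x => exact hdeg x
  | op q ts s j x => have := hdeg x; simp only [degree]; omega

theorem NormalForm.alpha_spec {deg : X → ℕ} (hdeg : ∀ x, 1 ≤ deg x) {t : NormalForm X}
    (ht : t.IsLegal deg) : IsKWord deg (t.alpha deg) ∧ IsIrr (t.alpha deg).word := by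
  induction t with
  | gen x => exact ⟨isKWord_corolla hdeg x, isIrr_corolla deg x⟩
  | op q ts s j x iht ihs =>
    obtain ⟨h1, h2, h3, h4⟩ := ht
    have hs := ihs h2
    have hl : (prodW (List.ofFn fun i => (ts i).alpha deg)).length =
        ∑ i, (ts i).degree deg := by
      simp [length_prodW, List.map_ofFn, List.sum_ofFn, Function.comp_def, length_alpha]
    have hT : Admissible deg (prodW (List.ofFn fun i => (ts i).alpha deg)) :=
      admissible_prodW fun p hp => by
        obtain ⟨i, rfl⟩ := (List.mem_ofFn' _ _).1 hp
        exact (iht i (h1 i)).1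
    simp only [alpha, foldr_wordMul]
    refine ⟨isKWord_iff.2 ⟨(admissible_corolla deg x).wordMul (hT.wordMul hs.1.admissible 0) _, ?_⟩,
      isIrr_wordMul_corolla hdeg x hs.2 (by omega) (by rw [hl, length_alpha]; omega)⟩
    obtain ⟨d, hd⟩ := corolla_word_pos deg hdeg x
    simp [wordMul, hd]

theorem IsKWord.length_pos {deg : X → ℕ} {w : ColWord X} (h : IsKWord deg w) : 1 ≤ w.length :=
  List.length_pos_iff.2 h.ne_nil

/-- If `p` were shorter than `p'`, then `p'` would consist of `p` followed by letters of the shifted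
`q`, which is a splitting of `p'`. -/
theorem wordMul_cancel_aux {deg : X → ℕ} {p p' q q' : ColWord X} (hp : IsKWord deg p)
    (hirr' : IsIrr p'.word) (h : wordMul 0 p q = wordMul 0 p' q') :
    p'.length ≤ p.length := by
  by_contra hlt
  unfold ColWord.length at hlt
  rw [wordMul_zero, wordMul_zero, ColWord.mk.injEq] at h
  refine not_isIrr_iff.2 ⟨p.word.length, p.col.length, hp.length_pos, by omega, ?_, ?_⟩ hirr'
  · intro a ha
    have h1 := congrArg (List.take p.word.length) h.1
    rw [List.take_left, List.take_append_of_le_length (by omega)] at h1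
    exact hp.lt_length a (h1 ▸ ha)
  · intro a ha
    have h1 := congrArg (List.drop p.word.length) h.1
    rw [List.drop_left, List.drop_append_of_le_length (by omega)] at h1
    have h2 : a ∈ q.word.map (· + p.col.length) := by rw [h1]; simp [ha]
    obtain ⟨b, -, rfl⟩ := List.mem_map.1 h2
    omega

theorem wordMul_cancel {deg : X → ℕ} (hdeg : ∀ x, 1 ≤ deg x) {p p' q q' : ColWord X}
    (hp : IsKWord deg p) (hp' : IsKWord deg p') (hirr : IsIrr p.word) (hirr' : IsIrr p'.word)
    (h : wordMul 0 p q = wordMul 0 p' q') : p = p' ∧ q = q' := by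
  have hl : p.word.length = p'.word.length :=
    le_antisymm (wordMul_cancel_aux hp' hirr h.symm) (wordMul_cancel_aux hp hirr' h)
  rw [wordMul_zero, wordMul_zero, ColWord.mk.injEq] at h
  obtain ⟨h1, h2⟩ := List.append_inj h.1 hl
  -- The number of colours is determined by the set of letters.
  have h3 : p.col.length = p'.col.length := by
    have h4 : ∀ a, a < p.col.length ↔ a < p'.col.length := fun a => by
      rw [← hp.admissible.mem_iff hdeg, ← hp'.admissible.mem_iff hdeg, h1]
    have h5 := h4 p.col.length
    have h6 := h4 p'.col.length
    omega
  obtain ⟨h4, h5⟩ := List.append_inj h.2 h3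
  refine ⟨ColWord.ext h1 h4, ColWord.ext ?_ h5⟩
  rw [h3] at h2
  exact List.map_injective_iff.2 (fun x y hxy => by simpa using hxy) h2

theorem prodW_injective {deg : X → ℕ} (hdeg : ∀ x, 1 ≤ deg x) {l l' : List (ColWord X)}
    (h : ∀ p ∈ l, IsKWord deg p ∧ IsIrr p.word) (h' : ∀ p ∈ l', IsKWord deg p ∧ IsIrr p.word)
    (heq : prodW l = prodW l') : l = l' := by
  induction l generalizing l' with
  | nil =>
    cases l' with
    | nil => rfl
    | cons p l' =>
      have h1 := (h' p (by simp)).1.length_pos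
      have := congrArg ColWord.length heq
      simp only [prodW_nil, prodW_cons, length_wordMul] at this
      simp only [ColWord.length, List.length_nil] at this h1
      omega
  | cons p l ih =>
    cases l' with
    | nil =>
      have h1 := (h p (by simp)).1.length_pos
      have := congrArg ColWord.length heq
      simp only [prodW_nil, prodW_cons, length_wordMul] at this
      simp only [ColWord.length, List.length_nil] at this h1
      omega
    | cons p' l' =>
      rw [List.forall_mem_cons] at h h'
      obtain ⟨h1, h2⟩ := wordMul_cancel hdeg h.1.1 h'.1.1 h.1.2 h'.1.2 heq
      rw [h1, ih h.2 h'.2 h2]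

/-- A reducible word is cut where its letters split, the colours are cut at the bound `r`, and both
shorter pieces are admissible. -/
theorem exists_prodW {deg : X → ℕ} (hdeg : ∀ x, 1 ≤ deg x) {w : ColWord X}
    (hw : Admissible deg w) :
    ∃ l, (∀ p ∈ l, IsKWord deg p ∧ IsIrr p.word) ∧ prodW l = w := by
  induction hn : w.length using Nat.strong_induction_on generalizing w with
  | _ n ih =>
    subst hn
    by_cases h0 : w.word = []
    · exact ⟨[], by simp, (hw.col_eq_nil hdeg h0).symm⟩
    by_cases hirr : IsIrr w.word
    · exact ⟨[w], by simp [hirr, isKWord_iff, hw, h0], by simp⟩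
    obtain ⟨c, r, hc0, hc, hlt, hge⟩ := not_isIrr_iff.1 hirr
    have hr : r ≤ w.col.length := by
      obtain ⟨a, ha⟩ : ∃ a, a ∈ w.word.drop c :=
        List.exists_mem_of_length_pos (by simp; omega)
      exact (hge a ha).trans (hw.lt_length (List.mem_of_mem_drop ha)).le
    have hcount : ∀ i, (w.word.take c).count i + (w.word.drop c).count i = w.word.count i := by
      intro i; rw [← List.count_append, List.take_append_drop]
    have hdrop : w.word.drop c = ((w.word.drop c).map (· - r)).map (· + r) := by
      conv_lhs => rw [← List.map_id (w.word.drop c)]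
      rw [List.map_map]
      refine List.map_congr_left fun a ha => ?_
      have := hge a ha
      simp only [id, Function.comp]
      omega
    have hp : Admissible deg (⟨w.word.take c, w.col.take r⟩ : ColWord X) := by
      refine ⟨fun i => ?_, fun a b h => hw.le_of_sublist a b (h.trans (List.take_sublist _ _))⟩
      by_cases hi : i < r
      · have h1 : (w.word.drop c).count i = 0 :=
          List.count_eq_zero.2 fun hm => by have := hge i hm; omega
        have := hcount i
        have h2 := hw.count i
        simp only [List.getElem?_take_of_lt hi]
        omega
      · rw [List.count_eq_zero.2 fun hm => hi (hlt i hm), List.getElem?_eq_none (by simp; omega)]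
        rfl
    have hq : Admissible deg (⟨(w.word.drop c).map (· - r), w.col.drop r⟩ : ColWord X) := by
      refine ⟨fun i => ?_, fun a b h => ?_⟩
      · have h1 : ((w.word.drop c).map (· - r)).count i = (w.word.drop c).count (i + r) := by
          conv_rhs => rw [hdrop]
          exact (List.count_map_of_injective _ (· + r) (fun x y h => by simpa using h) _).symm
        have h2 : (w.word.take c).count (i + r) = 0 :=
          List.count_eq_zero.2 fun hm => by have := hlt _ hm; omega
        have h3 := hcount (i + r)
        have h4 := hw.count (i + r)
        simp only [List.getElem?_drop, add_comm r i]
        omega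
      · have h1 := h.map (· + r)
        rw [← hdrop] at h1
        have := hw.le_of_sublist (a + r) (b + r) (h1.trans (List.drop_sublist _ _))
        omega
    have hwpq : w = wordMul 0 ⟨w.word.take c, w.col.take r⟩
        ⟨(w.word.drop c).map (· - r), w.col.drop r⟩ := by
      rw [wordMul_zero]
      ext1
      · dsimp only
        rw [List.length_take, min_eq_left hr, ← hdrop, List.take_append_drop]
      · exact (List.take_append_drop _ _).symm
    unfold ColWord.length at ih
    obtain ⟨l1, h1, e1⟩ := ih _ (by simp; omega) hp rfl
    obtain ⟨l2, h2, e2⟩ := ih _ (by simp; omega) hq rfl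
    refine ⟨l1 ++ l2, fun p hp => ?_, by rw [prodW_append, e1, e2, ← hwpq]⟩
    rcases List.mem_append.1 hp with hp | hp
    · exact h1 p hp
    · exact h2 p hp

/-! ### The block of the smallest letter. -/

theorem exists_replicate_zero {l : List ℕ} (h0 : 0 ∈ l)
    (h : ∀ a b, [a, b, a].Sublist l → b ≤ a) :
    ∃ A B d, l = A ++ List.replicate d 0 ++ B ∧ 0 ∉ A ∧ 0 ∉ B := by
  obtain ⟨A, R, rfl, hA⟩ := List.eq_append_cons_of_mem h0
  by_cases hR : 0 ∈ R
  · obtain ⟨B, M, hM, hB⟩ := List.eq_append_cons_of_mem (List.mem_reverse.2 hR)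
    have hRe : R = M.reverse ++ 0 :: B.reverse := by
      rw [← List.reverse_reverse R, hM]; simp
    refine ⟨A, B.reverse, M.length + 2, ?_, hA, by simpa using hB⟩
    have hz : M.reverse = List.replicate M.length 0 := by
      rw [List.eq_replicate_iff]
      refine ⟨by simp, fun b hb => ?_⟩
      have : b ≤ 0 := by
        refine h 0 b ?_
        rw [hRe]
        refine List.Sublist.trans ?_ (List.sublist_append_right _ _)
        refine List.Sublist.cons_cons _ ?_
        exact (List.singleton_sublist.2 hb).append
          (List.singleton_sublist.2 (List.mem_cons_self (a := 0) (l := B.reverse)))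
      omega
    have h2 : List.replicate (M.length + 2) 0 = 0 :: (List.replicate M.length 0 ++ [0]) := by
      rw [← List.replicate_succ', ← List.replicate_succ]
    rw [hRe, hz, h2]
    simp
  · exact ⟨A, R, 1, by simp, hA, hR⟩

/-- The zeros form one block; `u` arises by deleting them and lowering the other letters by one. The
clauses on colours serve to keep words inside a given set of colours. -/
theorem exists_wordMul_corolla {deg : X → ℕ} (hdeg : ∀ x, 1 ≤ deg x) {w : ColWord X}
    (hw : IsKWord deg w) : ∃ J x u, Admissible deg u ∧ J ≤ u.length ∧ x ∈ w.col ∧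
      (∀ y ∈ u.col, y ∈ w.col) ∧ w = wordMul J (corolla deg x) u := by
  obtain ⟨f, col⟩ := w
  have ha := hw.admissible
  obtain ⟨a, haf⟩ : ∃ a, a ∈ f := List.exists_mem_of_ne_nil _ hw.ne_nil
  cases col with
  | nil => exact absurd (hw.lt_length a haf) (by simp)
  | cons x cs =>
    have h0 : 0 ∈ f := (ha.mem_iff hdeg).2 (by simp)
    obtain ⟨A, B, d, rfl, hA, hB⟩ := exists_replicate_zero h0 ha.le_of_sublist
    have hd : d = deg x := by
      have := ha.count 0
      simpa [List.count_append, List.count_eq_zero.2 hA, List.count_eq_zero.2 hB] using this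
    have hA' : A = (A.map (· - 1)).map (· + 1) := by
      rw [List.map_map]
      conv_lhs => rw [← List.map_id A]
      refine List.map_congr_left fun b hb => ?_
      have : b ≠ 0 := fun h => hA (h ▸ hb)
      simp only [id, Function.comp]
      omega
    have hB' : B = (B.map (· - 1)).map (· + 1) := by
      rw [List.map_map]
      conv_lhs => rw [← List.map_id B]
      refine List.map_congr_left fun b hb => ?_
      have : b ≠ 0 := fun h => hB (h ▸ hb)
      simp only [id, Function.comp]
      omega
    have hAB : A ++ B = (A.map (· - 1) ++ B.map (· - 1)).map (· + 1) := by
      rw [List.map_append, ← hA', ← hB']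
    refine ⟨A.length, x, ⟨A.map (· - 1) ++ B.map (· - 1), cs⟩, ⟨fun i => ?_, fun a b h => ?_⟩,
      by simp [ColWord.length], by simp, fun y hy => by simpa using .inr hy, ?_⟩
    · have h1 := ha.count (i + 1)
      have h2 : (A ++ B).count (i + 1) = (A.map (· - 1) ++ B.map (· - 1)).count i := by
        rw [hAB]
        exact List.count_map_of_injective _ (· + 1) (fun x y h => by simpa using h) _
      rw [List.getElem?_cons_succ] at h1
      rw [← h1, ← h2]
      simp [List.count_append, List.count_replicate]
    · have h1 := h.map (· + 1)
      rw [← hAB] at h1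
      have h2 : (A ++ B).Sublist (A ++ List.replicate d 0 ++ B) :=
        (List.sublist_append_left A _).append (List.Sublist.refl B)
      have := ha.le_of_sublist (a + 1) (b + 1) (h1.trans h2)
      omega
    · ext1
      · have e1 : (A.map (· - 1) ++ B.map (· - 1)).take A.length = A.map (· - 1) :=
          List.take_left' (by simp)
        have e2 : (A.map (· - 1) ++ B.map (· - 1)).drop A.length = B.map (· - 1) :=
          List.drop_left' (by simp)
        simp only [wordMul, e1, e2, corolla, List.length_singleton, ← hA', ← hB', hd]
      · rfl

/-- The first colour is `x`, and `J` is the number of letters before the first `0`. -/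
theorem wordMul_corolla_injective {deg : X → ℕ} (hdeg : ∀ x, 1 ≤ deg x) {J J' : ℕ} {x x' : X}
    {u u' : ColWord X} (hJ : J ≤ u.length) (hJ' : J' ≤ u'.length)
    (h : wordMul J (corolla deg x) u = wordMul J' (corolla deg x') u') :
    x = x' ∧ J = J' ∧ u = u' := by
  rw [wordMul, wordMul, ColWord.mk.injEq] at h
  obtain ⟨h1, h2⟩ := h
  simp only [corolla, List.cons_append, List.nil_append, List.cons.injEq] at h2
  obtain ⟨rfl, h2⟩ := h2
  obtain ⟨d, hd⟩ := corolla_word_pos deg hdeg x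
  have key : ∀ (A B : List ℕ), List.takeWhile (· ≠ 0)
      (A.map (· + 1) ++ List.replicate (d + 1) 0 ++ B) = A.map (· + 1) := by
    intro A B
    rw [List.append_assoc, List.takeWhile_append_of_pos]
    · simp [List.replicate_succ]
    · simp
  rw [hd] at h1
  simp only [corolla, List.length_singleton] at h1
  have h3 := congrArg (List.takeWhile (· ≠ 0)) h1
  rw [key, key] at h3
  have h4 := congrArg List.length h3
  unfold ColWord.length at hJ hJ'
  simp only [List.length_map, List.length_take, min_eq_left hJ, min_eq_left hJ'] at h4
  subst h4
  have hinj : Function.Injective (List.map (· + 1) : List ℕ → List ℕ) :=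
    List.map_injective_iff.2 fun x y hxy => by simpa using hxy
  rw [h3, List.append_cancel_left_eq] at h1
  refine ⟨rfl, rfl, ColWord.ext ?_ h2⟩
  rw [← List.take_append_drop J u.word, ← List.take_append_drop J u'.word, hinj h3, hinj h1]

/-! ### Bijectivity of `α`. -/

/-- The word attached to a list of normal forms. -/
def listWord (deg : X → ℕ) (ts : List (NormalForm X)) : ColWord X :=
  prodW (ts.map (NormalForm.alpha deg))

theorem NormalForm.alpha_op (deg : X → ℕ) {q : ℕ} (ts : Fin q → NormalForm X) (s : NormalForm X)
    (j : ℕ) (x : X) : (NormalForm.op q ts s j x).alpha deg =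
      wordMul (j + ∑ i, (ts i).degree deg) (corolla deg x)
        (listWord deg (List.ofFn ts ++ [s])) := by
  simp [NormalForm.alpha, foldr_wordMul, listWord, prodW_append, List.map_ofFn, Function.comp_def]

theorem length_listWord (deg : X → ℕ) (ts : List (NormalForm X)) :
    (listWord deg ts).length = (ts.map (NormalForm.degree deg)).sum := by
  simp [listWord, length_prodW, Function.comp_def, NormalForm.length_alpha]

theorem sum_degree_ofFn (deg : X → ℕ) {q : ℕ} (ts : Fin q → NormalForm X) :
    ((List.ofFn ts).map (NormalForm.degree deg)).sum = ∑ i, (ts i).degree deg := by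
  simp [List.map_ofFn, List.sum_ofFn]

/-- Injectivity of `α` is only assumed at the entries of `ts`, so that the lemma can be applied to
the induction hypothesis of `NormalForm.alpha_injective`. -/
theorem map_alpha_injective {deg : X → ℕ} {ts ts' : List (NormalForm X)}
    (h : ∀ t ∈ ts, ∀ t', t'.IsLegal deg → t.alpha deg = t'.alpha deg → t = t')
    (h' : ∀ t ∈ ts', t.IsLegal deg)
    (heq : ts.map (NormalForm.alpha deg) = ts'.map (NormalForm.alpha deg)) : ts = ts' := by
  induction ts generalizing ts' with
  | nil => simpa using heq.symm
  | cons t ts ih =>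
    cases ts' with
    | nil => simp at heq
    | cons t' ts' =>
      simp only [List.map_cons, List.cons.injEq] at heq
      rw [List.forall_mem_cons] at h h'
      rw [h.1 t' h'.1 heq.1, ih h.2 h'.2 heq.2]

theorem forall_mem_ofFn_append {q : ℕ} {ts : Fin q → NormalForm X} {s : NormalForm X}
    {p : NormalForm X → Prop} (h1 : ∀ i, p (ts i)) (h2 : p s) :
    ∀ t ∈ List.ofFn ts ++ [s], p t := by
  intro t ht
  rcases List.mem_append.1 ht with ht | ht
  · obtain ⟨i, rfl⟩ := (List.mem_ofFn' _ _).1 ht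
    exact h1 i
  · rw [List.mem_singleton.1 ht]; exact h2

/-- The word determines `x`, the position and the word without its zeros. The irreducible factors of
the latter are the words of `t₁, …, t_q, s`, with `s` last, and then the position determines `j`. -/
theorem NormalForm.alpha_injective {deg : X → ℕ} (hdeg : ∀ x, 1 ≤ deg x) {t t' : NormalForm X}
    (ht : t.IsLegal deg) (ht' : t'.IsLegal deg) (h : t.alpha deg = t'.alpha deg) : t = t' := by
  have hgen : ∀ x, (NormalForm.gen x).alpha deg = wordMul 0 (corolla deg x) ⟨[], []⟩ := by
    intro x; simp [alpha]
  have hlen : ∀ {q : ℕ} (ts : Fin q → NormalForm X) (s : NormalForm X) (j : ℕ),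
      j ≤ s.degree deg → j + ∑ i, (ts i).degree deg ≤
        (listWord deg (List.ofFn ts ++ [s])).length := by
    intro q ts s j hj
    rw [length_listWord, List.map_append, List.sum_append, sum_degree_ofFn]
    simp; omega
  induction t generalizing t' with
  | gen x =>
    cases t' with
    | gen x' =>
      rw [hgen, hgen] at h
      rw [(wordMul_corolla_injective hdeg (Nat.zero_le _) (Nat.zero_le _) h).1]
    | op q ts s j x' =>
      rw [hgen, alpha_op] at h
      have := (wordMul_corolla_injective hdeg (Nat.zero_le _) (hlen ts s j ht'.2.2.2) h).2.1
      -- A generator has position `0`, an operation a position at least `j ≥ 1`.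
      have := ht'.2.2.1
      omega
  | op q ts s j x iht ihs =>
    cases t' with
    | gen x' =>
      rw [hgen, alpha_op] at h
      have := (wordMul_corolla_injective hdeg (hlen ts s j ht.2.2.2) (Nat.zero_le _) h).2.1
      have := ht.2.2.1
      omega
    | op q' ts' s' j' x' =>
      rw [alpha_op, alpha_op] at h
      obtain ⟨rfl, h1, h2⟩ := wordMul_corolla_injective hdeg (hlen ts s j ht.2.2.2)
        (hlen ts' s' j' ht'.2.2.2) h
      have hl := forall_mem_ofFn_append (p := fun t => t.IsLegal deg) ht.1 ht.2.1
      have hl' := forall_mem_ofFn_append (p := fun t => t.IsLegal deg) ht'.1 ht'.2.1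
      have h3 := prodW_injective hdeg (fun p hp => by
          obtain ⟨t, ht, rfl⟩ := List.mem_map.1 hp
          exact NormalForm.alpha_spec hdeg (hl t ht)) (fun p hp => by
          obtain ⟨t, ht, rfl⟩ := List.mem_map.1 hp
          exact NormalForm.alpha_spec hdeg (hl' t ht)) h2
      have h4 := map_alpha_injective (forall_mem_ofFn_append
        (p := fun t => ∀ t', t'.IsLegal deg → t.alpha deg = t'.alpha deg → t = t')
        (fun i t' => iht i (ht.1 i)) (fun t' => ihs ht.2.1)) hl' h3
      have h5 := List.append_inj' h4 rfl
      obtain rfl : s = s' := by simpa using h5.2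
      obtain rfl : q = q' := by simpa using congrArg List.length h5.1
      obtain rfl : ts = ts' := List.ofFn_injective h5.1
      obtain rfl : j = j' := by omega
      rfl

theorem listWord_injective {deg : X → ℕ} (hdeg : ∀ x, 1 ≤ deg x) {ts ts' : List (NormalForm X)}
    (h : ∀ t ∈ ts, t.IsLegal deg) (h' : ∀ t ∈ ts', t.IsLegal deg)
    (heq : listWord deg ts = listWord deg ts') : ts = ts' := by
  refine map_alpha_injective (fun t ht t' ht' => NormalForm.alpha_injective hdeg (h t ht) ht') h'
    (prodW_injective hdeg (fun p hp => ?_) (fun p hp => ?_) heq)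
  · obtain ⟨t, ht, rfl⟩ := List.mem_map.1 hp
    exact NormalForm.alpha_spec hdeg (h t ht)
  · obtain ⟨t, ht, rfl⟩ := List.mem_map.1 hp
    exact NormalForm.alpha_spec hdeg (h' t ht)

theorem exists_map_alpha {deg : X → ℕ} {l : List (ColWord X)}
    (h : ∀ p ∈ l, ∃ t : NormalForm X, t.IsLegal deg ∧ t.alpha deg = p) :
    ∃ ts : List (NormalForm X), (∀ t ∈ ts, t.IsLegal deg) ∧ ts.map (NormalForm.alpha deg) = l := by
  induction l with
  | nil => exact ⟨[], by simp, rfl⟩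
  | cons p l ih =>
    rw [List.forall_mem_cons] at h
    obtain ⟨ts, h1, h2⟩ := ih h.2
    obtain ⟨t, h3, h4⟩ := h.1
    exact ⟨t :: ts, by simpa using ⟨h3, h1⟩, by simp [h2, h4]⟩

theorem le_sum_of_mem_prodW {l : List (ColWord X)} {p : ColWord X} (hp : p ∈ l) :
    p.length ≤ (prodW l).length := by
  rw [length_prodW]
  exact List.single_le_sum (fun _ _ => Nat.zero_le _) _ (List.mem_map.2 ⟨p, hp, rfl⟩)

/-- After removal of the zeros, the last irreducible factor gives the middle argument, the others
give `t₁, …, t_q`, and the upper index is the position relative to the last factor. -/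
theorem NormalForm.exists_alpha_eq {deg : X → ℕ} (hdeg : ∀ x, 1 ≤ deg x) {w : ColWord X}
    (hw : IsKWord deg w) (hirr : IsIrr w.word) :
    ∃ t : NormalForm X, t.IsLegal deg ∧ t.alpha deg = w := by
  induction hn : w.length using Nat.strong_induction_on generalizing w with
  | _ n ih =>
    subst hn
    obtain ⟨J, x, u, hu, hJ, -, -, rfl⟩ := exists_wordMul_corolla hdeg hw
    obtain ⟨l, hl, rfl⟩ := exists_prodW hdeg hu
    rcases List.eq_nil_or_concat l with rfl | ⟨l, s, rfl⟩
    · exact ⟨.gen x, trivial, by simp [alpha]⟩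
    rw [List.concat_eq_append] at *
    have hx := hdeg x
    obtain ⟨ts, h1, h2⟩ := exists_map_alpha fun p hp =>
      ih p.length (by
        have := le_sum_of_mem_prodW hp
        rw [length_wordMul, length_corolla]
        omega) (hl p hp).1 (hl p hp).2 rfl
    rcases List.eq_nil_or_concat ts with rfl | ⟨ts, t, rfl⟩
    · simp at h2
    rw [List.concat_eq_append] at *
    rw [List.map_append] at h2
    obtain ⟨h3, h4⟩ := List.append_inj' h2 rfl
    have h4 : t.alpha deg = s := by simpa using h4
    have hlen : (prodW l).length = (ts.map (NormalForm.degree deg)).sum := by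
      rw [← h3]; exact length_listWord deg ts
    -- Otherwise the zeros are inserted among the earlier factors, and `s` splits off on the right.
    have hJl : (prodW l).length < J := by
      by_contra hcon
      rw [prodW_append, wordMul_wordMul_zero (by omega)] at hirr
      refine not_isIrr_wordMul (deg := deg) (isKWord_iff.2 ⟨(admissible_corolla deg x).wordMul
        (admissible_prodW fun p hp => (hl p (by simp [hp])).1) J, ?_⟩) ?_ hirr
      · obtain ⟨d, hd⟩ := corolla_word_pos deg hdeg x
        simp [wordMul, hd]
      · simpa using (hl s (by simp)).1.ne_nil
    have hJs : J ≤ (prodW l).length + s.length := by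
      rw [prodW_append, length_wordMul] at hJ
      simpa using hJ
    refine ⟨.op ts.length ts.get t (J - (prodW l).length) x,
      ⟨fun i => h1 _ (by simp), h1 t (by simp), by omega, ?_⟩, ?_⟩
    · rw [← length_alpha, h4]; omega
    · rw [alpha_op, ← sum_degree_ofFn, List.ofFn_get, ← hlen, Nat.sub_add_cancel hJl.le, listWord,
        List.map_append, h3]
      simp [h4]

theorem admissible_listWord {deg : X → ℕ} (hdeg : ∀ x, 1 ≤ deg x) {ts : List (NormalForm X)}
    (h : ∀ t ∈ ts, t.IsLegal deg) : Admissible deg (listWord deg ts) :=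
  admissible_prodW fun p hp => by
    obtain ⟨t, ht, rfl⟩ := List.mem_map.1 hp
    exact (NormalForm.alpha_spec hdeg (h t ht)).1

theorem bijOn_alpha {deg : X → ℕ} (hdeg : ∀ x, 1 ≤ deg x) :
    Set.BijOn (NormalForm.alpha deg) {t | t.IsLegal deg}
      {c | IsKWord deg c ∧ IsIrr c.word} :=
  ⟨fun _ ht => NormalForm.alpha_spec hdeg ht,
    fun _ ht _ ht' h => NormalForm.alpha_injective hdeg ht ht' h,
    fun _ hw => NormalForm.exists_alpha_eq hdeg hw.1 hw.2⟩

end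
end Presh

namespace Presh
open scoped TensorProduct
noncomputable section
variable {K : Type u} {X : Type v}
variable [Field K] {deg : X → ℕ}

/-! ### Products of values of normal forms span -/

/-- The product of the values of a list of normal forms. -/
def evalList (Θ : GradedCoproduct K deg) (ts : List (NormalForm X)) : WordSpace K X :=
  concat (ts.map (NormalForm.eval Θ))

/-- A list of normal forms with their degrees, evaluated. -/
def evalPairs (Θ : GradedCoproduct K deg) (ts : List (NormalForm X)) :
    List (ℕ × WordSpace K X) :=
  ts.map fun t => (t.degree deg, t.eval Θ)

@[simp] theorem elts_evalPairs (Θ : GradedCoproduct K deg) (ts : List (NormalForm X)) :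
    elts (evalPairs Θ ts) = ts.map (NormalForm.eval Θ) := by
  simp [elts, evalPairs]

@[simp] theorem degs_evalPairs (Θ : GradedCoproduct K deg) (ts : List (NormalForm X)) :
    degs (evalPairs Θ ts) = (listWord deg ts).length := by
  simp [degs, evalPairs, length_listWord, Function.comp_def]

theorem evalPairs_ofFn (Θ : GradedCoproduct K deg) {q : ℕ} (ts : Fin q → NormalForm X) :
    elts (evalPairs Θ (List.ofFn ts)) = List.ofFn fun i => (ts i).eval Θ := by
  simp [List.map_ofFn, Function.comp_def]

theorem NormalForm.eval_mem_homog (hdeg : ∀ x, 1 ≤ deg x) (Θ : GradedCoproduct K deg)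
    (t : NormalForm X) : t.eval Θ ∈ homog K X (t.degree deg) := by
  induction t with
  | gen x => exact eElt_mem_homog hdeg Θ x
  | op q ts s j x iht ihs =>
    have h : HomogIn (⊤ : Submodule K (WordSpace K X)) (evalPairs Θ (List.ofFn ts)) := by
      intro p hp
      obtain ⟨t, ht, rfl⟩ := List.mem_map.1 hp
      obtain ⟨i, rfl⟩ := (List.mem_ofFn' _ _).1 ht
      exact ⟨trivial, iht i⟩
    have := primOp_mem_homog h j ihs (eElt_mem_homog hdeg Θ x)
    rw [evalPairs_ofFn, degs_evalPairs, length_listWord, sum_degree_ofFn] at this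
    exact this

theorem homogIn_evalPairs (hdeg : ∀ x, 1 ≤ deg x) {Θ : GradedCoproduct K deg}
    {S : Submodule K (WordSpace K X)} {ts : List (NormalForm X)} (h : ∀ t ∈ ts, t.eval Θ ∈ S) :
    HomogIn S (evalPairs Θ ts) := by
  intro p hp
  obtain ⟨t, ht, rfl⟩ := List.mem_map.1 hp
  exact ⟨h t ht, t.eval_mem_homog hdeg Θ⟩

theorem NormalForm.eval_mem_of_closed (hdeg : ∀ x, 1 ≤ deg x) {Θ : GradedCoproduct K deg}
    {S : Submodule K (WordSpace K X)} (h1 : ∀ x, eElt Θ x ∈ S) (h2 : ClosedUnderPrimOp S)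
    {t : NormalForm X} (ht : t.IsLegal deg) : t.eval Θ ∈ S := by
  induction t with
  | gen x => exact h1 x
  | op q ts s j x iht ihs =>
    refine h2 _ _ j _ _ (fun y hy => ?_) (ihs ht.2.1) (s.eval_mem_homog hdeg Θ) ht.2.2.1
      ht.2.2.2 (h1 x)
    obtain ⟨i, rfl⟩ := (List.mem_ofFn' _ _).1 hy
    exact iht i (ht.1 i)

theorem NormalForm.eval_mem_primitives (hdeg : ∀ x, 1 ≤ deg x) (Θ : GradedCoproduct K deg)
    {t : NormalForm X} (ht : t.IsLegal deg) : t.eval Θ ∈ primitives Θ :=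
  eval_mem_of_closed hdeg (eElt_mem_primitives hdeg Θ) (closedUnderPrimOp_primitives hdeg Θ) ht

theorem evalList_append (Θ : GradedCoproduct K deg) (ts ts' : List (NormalForm X)) :
    evalList Θ (ts ++ ts') = bul 0 (evalList Θ ts) (evalList Θ ts') := by
  simp [evalList, concat_append]

@[simp] theorem evalList_nil (Θ : GradedCoproduct K deg) : evalList Θ [] = unit := rfl

@[simp] theorem evalList_cons (Θ : GradedCoproduct K deg) (t : NormalForm X)
    (ts : List (NormalForm X)) :
    evalList Θ (t :: ts) = bul 0 (t.eval Θ) (evalList Θ ts) := rfl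

/-- The normal form `L_q^j(t₁, …, t_q; s; x)` with the arguments given as a list. -/
def opList (ts : List (NormalForm X)) (s : NormalForm X) (j : ℕ) (x : X) : NormalForm X :=
  .op ts.length ts.get s j x

theorem eval_opList (Θ : GradedCoproduct K deg) (ts : List (NormalForm X)) (s : NormalForm X)
    (j : ℕ) (x : X) :
    (opList ts s j x).eval Θ = primOp (ts.map (NormalForm.eval Θ)) j (s.eval Θ) (eElt Θ x) := by
  have : (List.ofFn fun i => (ts.get i).eval Θ) = ts.map (NormalForm.eval Θ) := by
    conv_rhs => rw [← List.ofFn_get ts, List.map_ofFn]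
    rfl
  rw [opList, NormalForm.eval, this]

/-- The lists of legal normal forms with colours in `S`. -/
def GoodList (deg : X → ℕ) (S : Set X) (ts : List (NormalForm X)) : Prop :=
  (∀ t ∈ ts, t.IsLegal deg) ∧ ∀ c ∈ (listWord deg ts).col, c ∈ S

theorem listWord_append (ts ts' : List (NormalForm X)) :
    listWord deg (ts ++ ts') = wordMul 0 (listWord deg ts) (listWord deg ts') := by
  simp [listWord, prodW_append]

theorem listWord_cons (t : NormalForm X) (ts : List (NormalForm X)) :
    listWord deg (t :: ts) = wordMul 0 (t.alpha deg) (listWord deg ts) := rfl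

theorem goodList_append {S : Set X} {ts ts' : List (NormalForm X)} :
    GoodList deg S (ts ++ ts') ↔ GoodList deg S ts ∧ GoodList deg S ts' := by
  simp only [GoodList, listWord_append, wordMul, List.forall_mem_append]
  tauto

theorem goodList_cons {S : Set X} {t : NormalForm X} {ts : List (NormalForm X)} :
    GoodList deg S (t :: ts) ↔ GoodList deg S [t] ∧ GoodList deg S ts := by
  rw [← goodList_append]; rfl

theorem goodList_gen {S : Set X} {x : X} (hx : x ∈ S) : GoodList deg S [.gen x] := by
  simp [GoodList, NormalForm.IsLegal, listWord, NormalForm.alpha, corolla, hx]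

theorem goodList_opList {S : Set X} {x : X} (hx : x ∈ S) {ts : List (NormalForm X)}
    {s : NormalForm X} (h : GoodList deg S (ts ++ [s])) {j : ℕ} (h1 : 1 ≤ j)
    (h2 : j ≤ s.degree deg) : GoodList deg S [opList ts s j x] := by
  refine ⟨?_, ?_⟩
  · simp only [List.mem_singleton, forall_eq]
    exact ⟨fun i => h.1 _ (List.mem_append_left _ (List.get_mem ts i)), h.1 s (by simp), h1, h2⟩
  · have : (listWord deg [opList ts s j x]).col = x :: (listWord deg (ts ++ [s])).col := by
      rw [listWord_cons, opList, NormalForm.alpha_op, List.ofFn_get]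
      simp [listWord, wordMul, corolla]
    rw [this, List.forall_mem_cons]
    exact ⟨hx, h.2⟩

theorem length_listWord_opList (ts : List (NormalForm X)) (s : NormalForm X) (j : ℕ) (x : X) :
    (opList ts s j x).degree deg =
      (listWord deg ts).length + s.degree deg + deg x := by
  rw [opList, NormalForm.degree, length_listWord, ← sum_degree_ofFn, List.ofFn_get]

/-- The span of the products of degree `n` of values of normal forms with colours in `S`. -/
def goodSpan (Θ : GradedCoproduct K deg) (S : Set X) (n : ℕ) : Submodule K (WordSpace K X) :=
  Submodule.span K {v | ∃ ts, GoodList deg S ts ∧ (listWord deg ts).length = n ∧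
    evalList Θ ts = v}

theorem evalList_mem_goodSpan (Θ : GradedCoproduct K deg) {S : Set X} {n : ℕ}
    {ts : List (NormalForm X)} (h : GoodList deg S ts) (hn : (listWord deg ts).length = n) :
    evalList Θ ts ∈ goodSpan Θ S n :=
  Submodule.subset_span ⟨ts, h, hn, rfl⟩

/-- The factor `s` contains the `J`-th letter, so `J - |a|` is a legal upper index for the middle
argument `s`. -/
theorem exists_split {J : ℕ} (hJ : 1 ≤ J) {ts : List (NormalForm X)}
    (h : J ≤ (listWord deg ts).length) : ∃ a s b, ts = a ++ s :: b ∧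
      (listWord deg a).length < J ∧ J ≤ (listWord deg a).length + s.degree deg := by
  simp only [length_listWord] at h ⊢
  induction ts generalizing J with
  | nil => simp at h; omega
  | cons t ts ih =>
    by_cases hJt : J ≤ t.degree deg
    · exact ⟨[], t, ts, rfl, by simp; omega, by simpa using hJt⟩
    · simp only [List.map_cons, List.sum_cons] at h
      obtain ⟨a, s, b, rfl, h1, h2⟩ := ih (J := J - t.degree deg) (by omega) (by omega)
      refine ⟨t :: a, s, b, rfl, ?_, ?_⟩ <;> simp only [List.map_cons, List.sum_cons] <;> omega

/-- The factors behind the one that contains position `J` are untouched. On the factors up to it,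
`bul_concat_eq` gives products whose new factors are normal forms with last argument `x`, or `x`
itself. -/
theorem bul_eElt_evalList_mem (hdeg : ∀ x, 1 ≤ deg x) (Θ : GradedCoproduct K deg) {S : Set X}
    {x : X} (hx : x ∈ S) {J : ℕ} {ts : List (NormalForm X)} (hts : GoodList deg S ts)
    (hJ : J ≤ (listWord deg ts).length) :
    bul J (eElt Θ x) (evalList Θ ts) ∈ goodSpan Θ S (deg x + (listWord deg ts).length) := by
  rcases Nat.eq_zero_or_pos J with rfl | hJ0
  · refine evalList_mem_goodSpan (ts := .gen x :: ts) Θ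
      (goodList_cons.2 ⟨goodList_gen hx, hts⟩) ?_
    simp [length_listWord, NormalForm.degree]
  obtain ⟨a, s, b, rfl, h1, h2⟩ := exists_split hJ0 hJ
  rw [goodList_append, goodList_cons] at hts
  obtain ⟨ha, hs, hb⟩ := hts
  have hH := homogIn_evalPairs (S := ⊤) hdeg (Θ := Θ) (ts := a) (by simp)
  have hs' := s.eval_mem_homog hdeg Θ
  have hca := concat_mem_homog hH
  rw [elts_evalPairs, degs_evalPairs] at hca
  have key := bul_concat_eq hH (J - (listWord deg a).length) hs' (eElt Θ x)
  rw [degs_evalPairs, Nat.sub_add_cancel h1.le, elts_evalPairs] at key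
  rw [evalList_append, evalList_cons, ← bul_assoc, evalList,
    bul_bul_zero _ _ (bul_mem_homog hca hs') h2, key, map_add, LinearMap.add_apply, map_sum,
    LinearMap.sum_apply]
  refine add_mem (Submodule.sum_mem _ fun r _ => ?_) ?_
  · have h3 : primOp (elts ((evalPairs Θ a).drop r)) (J - (listWord deg a).length) (s.eval Θ)
        (eElt Θ x) = (opList (a.drop r) s (J - (listWord deg a).length) x).eval Θ := by
      rw [eval_opList, evalPairs, ← List.map_drop, ← evalPairs, elts_evalPairs]
    have h4 : concat (elts ((evalPairs Θ a).take r)) = evalList Θ (a.take r) := by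
      rw [evalPairs, ← List.map_take, ← evalPairs, elts_evalPairs]; rfl
    rw [h3, h4, bul_assoc, ← evalList_cons, ← evalList_append]
    have h5 := ha
    rw [← List.take_append_drop r a, goodList_append] at h5
    refine evalList_mem_goodSpan Θ (goodList_append.2 ⟨h5.1, goodList_cons.2
      ⟨goodList_opList hx (goodList_append.2 ⟨h5.2, hs⟩) (by omega) (by omega), hb⟩⟩) ?_
    have h6 : (listWord deg a).length =
        (listWord deg (a.take r)).length + (listWord deg (a.drop r)).length := by
      conv_lhs => rw [← List.take_append_drop r a, listWord_append, length_wordMul]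
    simp only [listWord_append, listWord_cons, length_wordMul, NormalForm.length_alpha,
      length_listWord_opList]
    omega
  · split_ifs
    · have h3 : bul 0 (bul 0 (concat (a.map (NormalForm.eval Θ))) (bul 0 (s.eval Θ) (eElt Θ x)))
          (evalList Θ b) = evalList Θ (a ++ s :: .gen x :: b) := by
        rw [bul_assoc, bul_assoc, evalList_append]; rfl
      refine h3 ▸ evalList_mem_goodSpan Θ (goodList_append.2 ⟨ha, goodList_cons.2
        ⟨hs, goodList_cons.2 ⟨goodList_gen hx, hb⟩⟩⟩) ?_
      simp only [listWord_append, listWord_cons, length_wordMul, NormalForm.length_alpha,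
        NormalForm.degree]
      omega
    · simp

theorem bul_eElt_mem (hdeg : ∀ x, 1 ≤ deg x) (Θ : GradedCoproduct K deg) {S : Set X}
    {x : X} (hx : x ∈ S) {J n : ℕ} (hJ : J ≤ n) {v : WordSpace K X} (hv : v ∈ goodSpan Θ S n) :
    bul J (eElt Θ x) v ∈ goodSpan Θ S (deg x + n) := by
  refine Submodule.span_induction ?_ (by simp) (fun a b _ _ ha hb => ?_) (fun c a _ ha => ?_) hv
  · rintro _ ⟨ts, hts, rfl, rfl⟩
    exact bul_eElt_evalList_mem hdeg Θ hx hts hJ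
  · rw [map_add]; exact add_mem ha hb
  · rw [map_smul]; exact Submodule.smul_mem _ _ ha

/-- A set of colours is closed under `Θ`. -/
def ClosedUnder (Θ : GradedCoproduct K deg) (S : Set X) : Prop :=
  ∀ x ∈ S, ∀ ab ∈ (Θ.coeff x).support, ab.1 ∈ S ∧ ab.2 ∈ S

/-- After writing `(ξ; x) = e(x) + ∑ e(x₍₁₎) •₀ (ξ; x₍₂₎)`, every term inserts some `e` in a word
that is strictly shorter than `w`: in `u`, or in `(ξ; x₍₂₎) •_J u`. Induction on the length applies.
-/
theorem single_mem_goodSpan (hdeg : ∀ x, 1 ≤ deg x) (Θ : GradedCoproduct K deg) {S : Set X}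
    (hS : ClosedUnder Θ S) {w : ColWord X} (hw : Admissible deg w) (hwS : ∀ c ∈ w.col, c ∈ S) :
    Finsupp.single w 1 ∈ goodSpan Θ S w.length := by
  induction hn : w.length using Nat.strong_induction_on generalizing w with
  | _ n ih =>
    subst hn
    by_cases h0 : w.word = []
    · rw [hw.col_eq_nil hdeg h0]
      exact evalList_mem_goodSpan (ts := []) Θ (by simp [GoodList, listWord]) rfl
    obtain ⟨J, x, u, hu, hJ, hx, huc, rfl⟩ := exists_wordMul_corolla hdeg (isKWord_iff.2 ⟨hw, h0⟩)
    have hxS := hwS x hx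
    have huS : ∀ c ∈ u.col, c ∈ S := fun c hc => hwS c (huc c hc)
    have hx1 := hdeg x
    rw [length_wordMul, length_corolla] at ih ⊢
    have h1 : Finsupp.single (corolla deg x) (1 : K) = eElt Θ x + (Θ.coeff x).sum fun ab c =>
        c • bul 0 (eElt Θ ab.1) (Finsupp.single (corolla deg ab.2) 1) := by
      rw [eElt_eq hdeg, sub_add_cancel]
    rw [← bul_single, h1, map_add, LinearMap.add_apply, Finsupp.sum, map_sum, LinearMap.sum_apply]
    refine add_mem (bul_eElt_mem hdeg Θ hxS hJ (ih _ (by omega) hu huS rfl))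
      (Submodule.sum_mem _ fun ab hab => ?_)
    have h2 := Θ.deg_add hab
    have h3 := hdeg ab.1
    have h4 := hS x hxS ab hab
    rw [map_smul, LinearMap.smul_apply, bul_zero_bul _ _ (single_mem_homog u) hJ, bul_single]
    refine Submodule.smul_mem _ _ ?_
    have h5 : deg x + u.length = deg ab.1 + (deg ab.2 + u.length) := by omega
    rw [h5]
    refine bul_eElt_mem hdeg Θ h4.1 (by omega) (ih _ (by omega)
      ((admissible_corolla deg ab.2).wordMul hu J) ?_ (by simp))
    intro c hc
    rcases List.mem_append.1 hc with hc | hc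
    · rw [show c = ab.2 by simpa [corolla] using hc]; exact h4.2
    · exact huS c hc

/-! ### Linear independence -/

/-- Both components in `Θ(x)` have smaller degree than `x`, so only finitely many colours arise by
iteration. This keeps the dimension count finite when `X` is infinite. -/
theorem exists_finite_closed (hdeg : ∀ x, 1 ≤ deg x) (Θ : GradedCoproduct K deg) (x : X) :
    ∃ S : Set X, S.Finite ∧ x ∈ S ∧ ClosedUnder Θ S := by
  induction hn : deg x using Nat.strong_induction_on generalizing x with
  | _ n ih =>
    subst hn
    have h : ∀ ab ∈ (Θ.coeff x).support, ∃ S : Set X, S.Finite ∧ ab.1 ∈ S ∧ ab.2 ∈ S ∧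
        ClosedUnder Θ S := by
      intro ab hab
      have h1 := Θ.deg_add hab
      have h2 := hdeg ab.1
      have h3 := hdeg ab.2
      obtain ⟨S, hS1, hS2, hS3⟩ := ih (deg ab.1) (by omega) ab.1 rfl
      obtain ⟨T, hT1, hT2, hT3⟩ := ih (deg ab.2) (by omega) ab.2 rfl
      refine ⟨S ∪ T, hS1.union hT1, .inl hS2, .inr hT2, ?_⟩
      rintro y (hy | hy) cd hcd
      · exact ⟨.inl (hS3 y hy cd hcd).1, .inl (hS3 y hy cd hcd).2⟩
      · exact ⟨.inr (hT3 y hy cd hcd).1, .inr (hT3 y hy cd hcd).2⟩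
    choose! S h1 h2 h3 h4 using h
    refine ⟨insert x (⋃ ab ∈ (Θ.coeff x).support, S ab),
      (Set.Finite.biUnion (Finset.finite_toSet _) h1).insert x, by simp, ?_⟩
    rintro y (rfl | hy) cd hcd
    · exact ⟨.inr (Set.mem_biUnion hcd (h2 cd hcd)), .inr (Set.mem_biUnion hcd (h3 cd hcd))⟩
    · obtain ⟨ab, hab, hy⟩ := Set.mem_iUnion₂.1 hy
      have := h4 ab hab y hy cd hcd
      exact ⟨.inr (Set.mem_biUnion hab this.1), .inr (Set.mem_biUnion hab this.2)⟩

theorem exists_finite_closed_superset (hdeg : ∀ x, 1 ≤ deg x) (Θ : GradedCoproduct K deg)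
    {T : Set X} (hT : T.Finite) : ∃ S : Set X, S.Finite ∧ T ⊆ S ∧ ClosedUnder Θ S := by
  choose S h1 h2 h3 using exists_finite_closed hdeg Θ
  refine ⟨⋃ x ∈ T, S x, hT.biUnion fun x _ => h1 x, fun x hx => Set.mem_biUnion hx (h2 x), ?_⟩
  intro y hy cd hcd
  obtain ⟨x, hx, hy⟩ := Set.mem_iUnion₂.1 hy
  have := h3 x y hy cd hcd
  exact ⟨Set.mem_biUnion hx this.1, Set.mem_biUnion hx this.2⟩

theorem finite_lists {α : Type*} {S : Set α} (hS : S.Finite) (n : ℕ) :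
    {l : List α | l.length ≤ n ∧ ∀ a ∈ l, a ∈ S}.Finite := by
  have := hS.to_subtype
  have h1 : {l : List S | l.length ≤ n}.Finite := List.finite_length_le S n
  refine (h1.image (List.map Subtype.val)).subset ?_
  rintro l ⟨hl, hlS⟩
  refine ⟨l.attach.map fun a => ⟨a.1, hlS a.1 a.2⟩, by simpa using hl, ?_⟩
  simp [List.map_map, Function.comp_def]

theorem Admissible.length_col_le (hdeg : ∀ x, 1 ≤ deg x) {w : ColWord X} (h : Admissible deg w) :
    w.col.length ≤ w.length := by
  have : w.word.toFinset = Finset.range w.col.length := by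
    ext a; simp [h.mem_iff hdeg]
  have h1 := List.toFinset_card_le w.word
  rw [this, Finset.card_range] at h1
  exact h1

theorem finite_admissible (hdeg : ∀ x, 1 ≤ deg x) {S : Set X} (hS : S.Finite) (n : ℕ) :
    {w : ColWord X | Admissible deg w ∧ (∀ c ∈ w.col, c ∈ S) ∧ w.length ≤ n}.Finite := by
  refine (((finite_lists (Set.finite_Iio n) n).prod (finite_lists hS n)).image
    fun p => (⟨p.1, p.2⟩ : ColWord X)).subset ?_
  rintro w ⟨h1, h2, h3⟩
  have h4 := h1.length_col_le hdeg
  exact ⟨(w.word, w.col), ⟨⟨h3, fun a ha => lt_of_lt_of_le (h1.lt_length ha) (h4.trans h3)⟩,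
    h4.trans h3, h2⟩, rfl⟩

/-- The lists of legal normal forms. -/
abbrev LegalList (deg : X → ℕ) : Type v :=
  {ts : List (NormalForm X) // ∀ t ∈ ts, t.IsLegal deg}

/-- A dimension count, with no triangularity needed. Let `F` be the finite set of lists with colours
in a finite closed set and with bounded length. The words of these lists are distinct and lie in the
span of the `|F|` products, so this span has dimension at least `|F|`. -/
theorem linearIndependent_evalList (hdeg : ∀ x, 1 ≤ deg x) (Θ : GradedCoproduct K deg) :
    LinearIndependent K fun ts : LegalList deg => evalList Θ ts.1 := by
  rw [linearIndependent_iff_finset_linearIndependent]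
  intro s
  obtain ⟨S, hSf, hsS, hS⟩ := exists_finite_closed_superset hdeg Θ
    (T := ⋃ ts ∈ s, {c | c ∈ (listWord deg ts.1).col})
    (Set.Finite.biUnion (Finset.finite_toSet _) fun ts _ => List.finite_toSet _)
  set N := s.sup fun ts => (listWord deg ts.1).length with hN
  set F : Set (LegalList deg) :=
    {ts | (∀ c ∈ (listWord deg ts.1).col, c ∈ S) ∧ (listWord deg ts.1).length ≤ N} with hF
  have hinj : Function.Injective fun ts : LegalList deg => listWord deg ts.1 :=
    fun ts ts' h => Subtype.ext (listWord_injective hdeg ts.2 ts'.2 h)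
  have hFfin : F.Finite := by
    refine Set.Finite.subset ((finite_admissible hdeg hSf N).preimage hinj.injOn) ?_
    exact fun ts hts => ⟨admissible_listWord hdeg ts.2, hts.1, hts.2⟩
  have hsF : ∀ ts ∈ s, ts ∈ F := fun ts hts =>
    ⟨fun c hc => hsS (Set.mem_biUnion hts hc),
      Finset.le_sup (f := fun ts : LegalList deg => (listWord deg ts.1).length) hts⟩
  have := hFfin.fintype
  have hli : LinearIndependent K fun ts : F => evalList Θ ts.1.1 := by
    -- It remains to find `|F|` independent elements in the span; the words of the lists in `F`
    -- serve.
    rw [linearIndependent_iff_card_le_finrank_span]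
    have hmem : ∀ ts : F, Finsupp.single (listWord deg ts.1.1) (1 : K) ∈
        Submodule.span K (Set.range fun ts : F => evalList Θ ts.1.1) := by
      intro ts
      have h1 := single_mem_goodSpan hdeg Θ hS (admissible_listWord hdeg ts.1.2) ts.2.1
      refine Submodule.span_mono ?_ h1
      rintro _ ⟨ts', h2, h3, rfl⟩
      exact ⟨⟨⟨ts', h2.1⟩, h2.2, h3 ▸ ts.2.2⟩, rfl⟩
    have hli' : LinearIndependent K fun ts : F =>
        (⟨_, hmem ts⟩ : Submodule.span K (Set.range fun ts : F => evalList Θ ts.1.1)) := by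
      apply LinearIndependent.of_comp (Submodule.subtype _)
      exact (Finsupp.linearIndependent_single_one K (ColWord X)).comp
        (fun ts : F => listWord deg ts.1.1) (hinj.comp Subtype.val_injective)
    have : Module.Finite K (Submodule.span K (Set.range fun ts : F => evalList Θ ts.1.1)) :=
      Module.Finite.span_of_finite K (Set.finite_range _)
    exact hli'.fintype_card_le_finrank
  exact hli.comp (fun ts : s => ⟨ts.1, hsF ts.1 ts.2⟩) fun a b h => Subtype.ext
    (congrArg (fun z : F => z.1) h)

theorem linearIndependent_eval (hdeg : ∀ x, 1 ≤ deg x) (Θ : GradedCoproduct K deg) :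
    LinearIndependent K fun t : {t : NormalForm X // t.IsLegal deg} => t.1.eval Θ := by
  have := (linearIndependent_evalList hdeg Θ).comp
    (fun t : {t : NormalForm X // t.IsLegal deg} => (⟨[t.1], by simpa using t.2⟩ : LegalList deg))
    fun a b h => by simpa [Subtype.ext_iff] using h
  simpa [Function.comp_def] using this

/-! ### Primitive and decomposable elements in the basis of products. -/

theorem kSpace_le_span (hdeg : ∀ x, 1 ≤ deg x) (Θ : GradedCoproduct K deg) :
    kSpace K deg ≤ Submodule.span K
      ((fun ts : LegalList deg => evalList Θ ts.1) '' {ts | 1 ≤ ts.1.length}) := by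
  intro v hv
  induction hv using supported_induction with
  | single w hw =>
    have hw : IsKWord deg w := hw
    have h1 := single_mem_goodSpan (S := Set.univ) hdeg Θ (fun _ _ _ _ => by simp) hw.admissible
      (by simp)
    refine Submodule.span_mono ?_ h1
    rintro _ ⟨ts, h2, h3, rfl⟩
    refine ⟨⟨ts, h2.1⟩, ?_, rfl⟩
    cases ts with
    | nil =>
      have := hw.length_pos
      rw [← h3] at this
      simp [listWord, ColWord.length] at this
    | cons t ts => simp
  | zero => exact zero_mem _
  | add x y _ _ hx hy => exact add_mem hx hy
  | smul c x _ hx => exact Submodule.smul_mem _ _ hx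

/-- All factors are primitive, so only the cuts between consecutive factors survive. -/
theorem coproduct_evalList (hdeg : ∀ x, 1 ≤ deg x) (Θ : GradedCoproduct K deg)
    {ts : List (NormalForm X)} (h : ∀ t ∈ ts, t.IsLegal deg) :
    coproduct Θ (evalList Θ ts) =
      ∑ i ∈ Finset.Ico 1 ts.length, evalList Θ (ts.take i) ⊗ₜ evalList Θ (ts.drop i) := by
  induction ts with
  | nil =>
    simp only [evalList_nil, unit, coproduct_single, wordCoproduct_eq]
    rfl
  | cons t ts ih =>
    rw [List.forall_mem_cons] at h
    have ht := NormalForm.eval_mem_primitives hdeg Θ h.1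
    rcases ts with _ | ⟨s, ts⟩
    · simpa using ht.2
    have hmem : evalList Θ (s :: ts) ∈ admHomog K deg (listWord deg (s :: ts)).length := by
      have := concat_mem_admHomog (homogIn_evalPairs hdeg (ts := s :: ts)
        fun t ht => NormalForm.eval_mem_primitives hdeg Θ (h.2 t ht))
      rwa [elts_evalPairs, degs_evalPairs] at this
    have hlen : 1 ≤ (listWord deg (s :: ts)).length := by
      have := s.degree_pos hdeg
      rw [listWord_cons, length_wordMul, NormalForm.length_alpha]
      omega
    rw [evalList_cons, coproduct_bul_zero hdeg ht (t.eval_mem_homog hdeg Θ) (t.degree_pos hdeg)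
      hmem hlen, ih h.2, List.length_cons (as := s :: ts),
      Finset.sum_eq_sum_Ico_succ_bot (show 1 < (s :: ts).length + 1 by simp), map_sum,
      ← Finset.sum_Ico_add' _ 1 (s :: ts).length 1]
    simp

/-- For a list `t :: rest` with nonempty `rest`, the term `[t] ⊗ rest` occurs in the deconcatenation
of this list only, and once. Reading off its coefficient after the coproduct is therefore the
coordinate at `t :: rest`. -/
theorem length_le_one_of_coproduct_eq_zero (hdeg : ∀ x, 1 ≤ deg x) (Θ : GradedCoproduct K deg)
    {c : LegalList deg →₀ K}
    (h : coproduct Θ (Finsupp.linearCombination K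
      (fun ts : LegalList deg => evalList Θ ts.1) c) = 0) {ts : LegalList deg}
    (hts : 2 ≤ ts.1.length) : c ts = 0 := by
  -- `G` extends the coordinates with respect to the independent products to the whole word space.
  obtain ⟨G, hG⟩ := LinearMap.exists_leftInverse_of_injective
    (Finsupp.linearCombination K fun ts : LegalList deg => evalList Θ ts.1)
    (LinearMap.ker_eq_bot.2 (linearIndependent_evalList hdeg Θ))
  have hG1 : ∀ ts : LegalList deg, G (evalList Θ ts.1) = Finsupp.single ts 1 := fun ts => by
    have := LinearMap.congr_fun hG (Finsupp.single ts 1)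
    simpa using this
  obtain ⟨ts, hleg⟩ := ts
  rcases ts with _ | ⟨t, rest⟩
  · simp at hts
  rw [List.length_cons] at hts
  rw [List.forall_mem_cons] at hleg
  classical
  let ψ : WordSpace K X ⊗[K] WordSpace K X →ₗ[K] K := TensorProduct.lift
    ((LinearMap.mul K K).compl₁₂ (Finsupp.lapply ⟨[t], by simpa using hleg.1⟩ ∘ₗ G)
      (Finsupp.lapply ⟨rest, hleg.2⟩ ∘ₗ G))
  have hψ : ∀ a b : LegalList deg, ψ (evalList Θ a.1 ⊗ₜ evalList Θ b.1) =
      if a.1 = [t] ∧ b.1 = rest then 1 else 0 := by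
    intro a b
    simp only [ψ, TensorProduct.lift.tmul, LinearMap.compl₁₂_apply, LinearMap.comp_apply, hG1,
      Finsupp.lapply_apply, LinearMap.mul_apply', Finsupp.single_apply, Subtype.ext_iff]
    by_cases h1 : a.1 = [t] <;> by_cases h2 : b.1 = rest <;> simp [h1, h2]
  have key : ψ ∘ₗ coproduct Θ ∘ₗ
      (Finsupp.linearCombination K fun ts : LegalList deg => evalList Θ ts.1) =
      Finsupp.lapply ⟨t :: rest, List.forall_mem_cons.2 hleg⟩ := by
    refine Finsupp.lhom_ext' fun a => LinearMap.ext_ring ?_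
    simp only [LinearMap.comp_apply, Finsupp.lsingle_apply, Finsupp.linearCombination_single,
      one_smul, coproduct_evalList hdeg Θ a.2, map_sum, Finsupp.lapply_apply, Finsupp.single_apply,
      Subtype.ext_iff]
    rw [Finset.sum_congr rfl fun i _ => hψ ⟨a.1.take i, fun t ht => a.2 t (List.mem_of_mem_take ht)⟩
      ⟨a.1.drop i, fun t ht => a.2 t (List.mem_of_mem_drop ht)⟩]
    dsimp only
    split_ifs with ha
    · obtain ⟨a, hal⟩ := a
      obtain rfl : a = t :: rest := ha
      rw [Finset.sum_eq_single 1]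
      · simp
      · intro i hi hi1
        rw [if_neg]
        rintro ⟨h1, -⟩
        have := congrArg List.length h1
        rw [Finset.mem_Ico] at hi
        rw [List.length_cons] at hi
        simp only [List.length_take, List.length_cons, List.length_nil] at this
        omega
      · intro h1
        simp only [List.length_cons, Finset.mem_Ico] at h1
        omega
    · refine Finset.sum_eq_zero fun i _ => if_neg ?_
      rintro ⟨h1, h2⟩
      apply ha
      rw [← List.take_append_drop i a.1, h1, h2]
      rfl
  have := LinearMap.congr_fun key c
  rw [LinearMap.comp_apply, LinearMap.comp_apply, h, map_zero] at this
  exact this.symm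

theorem primitives_le_span (hdeg : ∀ x, 1 ≤ deg x) (Θ : GradedCoproduct K deg) :
    primitives Θ ≤ Submodule.span K
      ((fun ts : LegalList deg => evalList Θ ts.1) '' {ts | ts.1.length = 1}) := by
  intro v hv
  have h1 := kSpace_le_span hdeg Θ hv.1
  rw [Finsupp.mem_span_image_iff_linearCombination] at h1 ⊢
  obtain ⟨c, hc, rfl⟩ := h1
  refine ⟨c, ?_, rfl⟩
  rw [Finsupp.mem_supported] at hc ⊢
  intro ts hts
  have h2 : 1 ≤ ts.1.length := hc hts
  by_contra h3
  have h3 : ts.1.length ≠ 1 := h3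
  exact Finsupp.mem_support_iff.1 hts
    (length_le_one_of_coproduct_eq_zero hdeg Θ hv.2 (by omega))

theorem image_evalList_singleton (Θ : GradedCoproduct K deg) :
    (fun ts : LegalList deg => evalList Θ ts.1) '' {ts | ts.1.length = 1} =
      NormalForm.eval Θ '' {t | t.IsLegal deg} := by
  ext v
  constructor
  · rintro ⟨⟨ts, hts⟩, h1, rfl⟩
    obtain ⟨t, rfl⟩ := List.length_eq_one_iff.1 h1
    exact ⟨t, by simpa using hts, by simp⟩
  · rintro ⟨t, ht, rfl⟩
    exact ⟨⟨[t], by simpa using ht⟩, rfl, by simp⟩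

theorem closedUnderPrimOp_primPsh (Θ : GradedCoproduct K deg) : ClosedUnderPrimOp (primPsh Θ) := by
  intro xs m p y z hxs hy hy' h1 h2 hz
  refine Submodule.mem_sInf.2 fun S hS => ?_
  have h : ∀ v ∈ primPsh Θ, v ∈ S := fun v hv => Submodule.mem_sInf.1 hv S hS
  exact hS.2 xs m p y z (fun x hx => h x (hxs x hx)) (h y hy) hy' h1 h2 (h z hz)

theorem primPsh_le_primitives (hdeg : ∀ x, 1 ≤ deg x) (Θ : GradedCoproduct K deg) :
    primPsh Θ ≤ primitives Θ :=
  sInf_le ⟨eElt_mem_primitives hdeg Θ, closedUnderPrimOp_primitives hdeg Θ⟩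

theorem span_eval_le_primPsh (hdeg : ∀ x, 1 ≤ deg x) (Θ : GradedCoproduct K deg) :
    Submodule.span K (NormalForm.eval Θ '' {t | t.IsLegal deg}) ≤ primPsh Θ := by
  rw [Submodule.span_le]
  rintro _ ⟨t, ht, rfl⟩
  exact NormalForm.eval_mem_of_closed hdeg (eElt_mem Θ) (closedUnderPrimOp_primPsh Θ) ht

/-- A cycle of inclusions: values of normal forms lie in `primPsh Θ`, which lies in the primitive
elements, and these are spanned by the values of normal forms. -/
theorem primPsh_eq_primitives (hdeg : ∀ x, 1 ≤ deg x) (Θ : GradedCoproduct K deg) :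
    primPsh Θ = primitives Θ := by
  refine le_antisymm (primPsh_le_primitives hdeg Θ) ((primitives_le_span hdeg Θ).trans ?_)
  rw [image_evalList_singleton]
  exact span_eval_le_primPsh hdeg Θ

theorem span_eval_eq_primPsh (hdeg : ∀ x, 1 ≤ deg x) (Θ : GradedCoproduct K deg) :
    Submodule.span K (NormalForm.eval Θ '' {t | t.IsLegal deg}) = primPsh Θ := by
  refine le_antisymm (span_eval_le_primPsh hdeg Θ) ?_
  rw [← image_evalList_singleton, primPsh_eq_primitives hdeg]
  exact primitives_le_span hdeg Θ

/-- The span of the products of elements of `K[𝒦_∞, X]`. -/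
def decomposables (K : Type u) [Field K] (deg : X → ℕ) : Submodule K (WordSpace K X) :=
  Submodule.map₂ (bul 0) (kSpace K deg) (kSpace K deg)

theorem bul_mem_decomposables {a b : WordSpace K X} (ha : a ∈ kSpace K deg)
    (hb : b ∈ kSpace K deg) : bul 0 a b ∈ decomposables K deg :=
  Submodule.apply_mem_map₂ _ ha hb

/-- A primitive element that is decomposable vanishes. -/
theorem eq_zero_of_mem_decomposables (hdeg : ∀ x, 1 ≤ deg x) (Θ : GradedCoproduct K deg)
    {v : WordSpace K X} (h : v ∈ primPsh Θ) (h' : v ∈ decomposables K deg) : v = 0 := by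
  -- A product of nonempty products has at least two factors, a primitive element only involves
  -- products with one, and disjoint subfamilies of an independent family span disjoint subspaces.
  have h1 : decomposables K deg ≤ Submodule.span K
      ((fun ts : LegalList deg => evalList Θ ts.1) '' {ts | 2 ≤ ts.1.length}) := by
    refine (Submodule.map₂_le_map₂ (kSpace_le_span hdeg Θ) (kSpace_le_span hdeg Θ)).trans ?_
    rw [Submodule.map₂_span_span, Submodule.span_le]
    rintro _ ⟨_, ⟨a, ha, rfl⟩, _, ⟨b, hb, rfl⟩, rfl⟩
    refine Submodule.subset_span ⟨⟨a.1 ++ b.1, List.forall_mem_append.2 ⟨a.2, b.2⟩⟩, ?_,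
      evalList_append Θ _ _⟩
    have ha : 1 ≤ a.1.length := ha
    have hb : 1 ≤ b.1.length := hb
    simp only [Set.mem_ofPred_eq, List.length_append]
    omega
  have h2 := (linearIndependent_evalList hdeg Θ).disjoint_span_image
    (s := {ts | ts.1.length = 1}) (t := {ts | 2 ≤ ts.1.length}) (by
      rw [Set.disjoint_left]
      intro ts (h1 : ts.1.length = 1) (h2 : 2 ≤ ts.1.length)
      omega)
  rw [primPsh_eq_primitives hdeg] at h
  exact Submodule.disjoint_def.1 h2 v (primitives_le_span hdeg Θ h) (h1 h')

end
end Presh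

namespace Presh
open scoped TensorProduct
noncomputable section
variable {K : Type u} {X : Type v}
variable [Field K] {deg : X → ℕ}

/-! ### Degrees in the relations -/

section Degrees

variable {V : Type w} [AddCommGroup V] [Module K V] {G : ℕ → Submodule K V}
  {L : List V → ℕ → V → V → V}

/-- The operations `L` are of degree zero for the subspaces `G n`. -/
def PreservesGr (G : ℕ → Submodule K V) (L : List V → ℕ → V → V → V) : Prop :=
  ∀ (xs : List (ℕ × V)) (m j r : ℕ) (y z : V), (∀ x ∈ xs, x.2 ∈ G x.1) → y ∈ G m →
    1 ≤ j → j ≤ m → z ∈ G r → L (elts xs) j y z ∈ G (degs xs + m + r)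

theorem mem_of_degree_eq {m n : ℕ} {v : V} (h : v ∈ G m) (hmn : m = n) : v ∈ G n := hmn ▸ h

theorem nest_cons_cons (j : ℕ) (y : V) (xs : List (ℕ × V)) (z : V) {zs : List V} (hzs : zs ≠ []) :
    nest L j y xs (z :: zs) = ∑ p ∈ Finset.range (xs.length + 1),
      L (elts (xs.take p)) (j + degs (xs.drop p)) (nest L j y (xs.drop p) zs) z := by
  cases zs with
  | nil => exact absurd rfl hzs
  | cons z' zs => rw [nest]

/-- The degree of `nest` is also what shows that the upper indices in the relations are legal. -/
theorem nest_mem (hL : PreservesGr G L) {j d : ℕ} {y : V} (hy : y ∈ G d) (h1 : 1 ≤ j)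
    (h2 : j ≤ d) {xs : List (ℕ × V)} (hxs : ∀ x ∈ xs, x.2 ∈ G x.1) {zs : List (ℕ × V)}
    (hzs : ∀ x ∈ zs, x.2 ∈ G x.1) (hne : zs ≠ []) :
    nest L j y xs (elts zs) ∈ G (degs xs + d + degs zs) := by
  induction zs generalizing xs with
  | nil => exact absurd rfl hne
  | cons z zs ih =>
    rw [List.forall_mem_cons] at hzs
    rcases eq_or_ne zs [] with rfl | hne'
    · simpa [nest] using hL xs d j z.1 y z.2 hxs hy h1 h2 hzs.1
    rw [elts_cons, nest_cons_cons _ _ _ _ (by simpa [elts] using hne')]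
    refine Submodule.sum_mem _ fun p _ => ?_
    have h3 := degs_take_add_drop xs p
    refine mem_of_degree_eq (hL (xs.take p) _ (j + degs (xs.drop p)) z.1 _ z.2
      (fun x hx => hxs x (List.mem_of_mem_take hx))
      (ih (fun x hx => hxs x (List.mem_of_mem_drop hx)) hzs.2 hne') (by omega) (by omega) hzs.1) ?_
    rw [degs_cons]
    omega

theorem relSum_mem (hL : PreservesGr G L) {j k d e f : ℕ} {y w t : V} (hy : y ∈ G d) (h1 : 1 ≤ j)
    (h2 : j ≤ d) (hw : w ∈ G e) (h3 : 1 ≤ k) (h4 : k ≤ e) (ht : t ∈ G f) {xs : List (ℕ × V)}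
    (hxs : ∀ x ∈ xs, x.2 ∈ G x.1) {zs : List (ℕ × V)} (hzs : ∀ x ∈ zs, x.2 ∈ G x.1) :
    relSum L j k d xs y zs w t ∈ G (degs xs + d + degs zs + e + f) := by
  have hd : ∀ r, ∀ x ∈ xs.drop r, x.2 ∈ G x.1 := fun r x hx => hxs x (List.mem_of_mem_drop hx)
  have ht' : ∀ r, ∀ x ∈ xs.take r, x.2 ∈ G x.1 := fun r x hx => hxs x (List.mem_of_mem_take hx)
  unfold relSum
  refine add_mem (Submodule.sum_mem _ fun r _ => ?_) ?_
  · have h5 := degs_take_add_drop xs r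
    have h6 : elts zs ++ [w] = elts (zs ++ [(e, w)]) := by simp
    rw [h6]
    refine mem_of_degree_eq (hL (xs.take r) _ _ f _ t (ht' r)
      (nest_mem hL hy h1 h2 (hd r) (zs := zs ++ [(e, w)]) ?_ (by simp)) (by omega) ?_ ht) ?_
    · rintro x hx
      rcases List.mem_append.1 hx with hx | hx
      · exact hzs x hx
      · rw [List.mem_singleton.1 hx]; exact hw
    all_goals simp; omega
  · split_ifs with hj
    · refine add_mem (Submodule.sum_mem _ fun l hl => Submodule.sum_mem _ fun r _ => ?_) ?_
      · have h5 := degs_take_add_drop xs r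
        have h6 := degs_take_add_drop zs l
        rw [Finset.mem_Icc] at hl
        have hN := nest_mem hL hy h1 h2 (hd r) (zs := zs.take l)
          (fun x hx => hzs x (List.mem_of_mem_take hx))
          (by rw [← List.length_pos_iff, List.length_take]; omega)
        have h7 := hL (xs.take r ++ (_, nest L j y (xs.drop r) (elts (zs.take l))) :: zs.drop l)
          e k f w t (List.forall_mem_append.2 ⟨ht' r, List.forall_mem_cons.2
            ⟨hN, fun x hx => hzs x (List.mem_of_mem_drop hx)⟩⟩) hw h3 h4 ht
        rw [elts_append, elts_cons] at h7
        refine mem_of_degree_eq h7 ?_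
        simp only [degs_append, degs_cons]
        omega
      · have h7 := hL (xs ++ (d, y) :: zs) e k f w t (List.forall_mem_append.2
          ⟨hxs, List.forall_mem_cons.2 ⟨hy, hzs⟩⟩) hw h3 h4 ht
        rw [elts_append, elts_cons] at h7
        refine mem_of_degree_eq h7 ?_
        simp only [degs_append, degs_cons]
        omega
    · exact zero_mem _

end Degrees

/-! ### The relations modulo decomposable elements -/

/-- The homogeneous elements of degree `n` of `𝒫rim_psh(X)`. -/
def primGr (Θ : GradedCoproduct K deg) (n : ℕ) : Submodule K (WordSpace K X) :=
  primPsh Θ ⊓ homog K X n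

theorem preservesGr_primOp (Θ : GradedCoproduct K deg) :
    PreservesGr (primGr Θ) (primOp (K := K) (X := X)) := by
  intro xs m j r y z hxs hy h1 h2 hz
  refine ⟨closedUnderPrimOp_primPsh Θ _ m _ _ _ (fun x hx => ?_) hy.1 hy.2 h1 h2 hz.1,
    primOp_mem_homog (S := primPsh Θ) hxs j hy.2 hz.2⟩
  obtain ⟨p, hp, rfl⟩ := mem_elts.1 hx
  exact (hxs p hp).1

theorem mem_kSpace_of_mem_primPsh (hdeg : ∀ x, 1 ≤ deg x) {Θ : GradedCoproduct K deg}
    {v : WordSpace K X} (h : v ∈ primPsh Θ) : v ∈ kSpace K deg :=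
  (primPsh_le_primitives hdeg Θ h).1

theorem eq_zero_of_mem_primGr_zero (hdeg : ∀ x, 1 ≤ deg x) {Θ : GradedCoproduct K deg}
    {v : WordSpace K X} (h : v ∈ primGr Θ 0) : v = 0 := by
  have h1 := mem_kSpace_of_mem_primPsh hdeg h.1
  have h2 := h.2
  ext w
  by_contra hw
  have h3 : w ∈ v.support := Finsupp.mem_support_iff.2 hw
  have h4 : w.length = 0 := (Finsupp.mem_supported K v).1 h2 h3
  have h5 : IsKWord deg w := (Finsupp.mem_supported K v).1 h1 h3
  exact (Nat.ne_of_gt h5.length_pos) h4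

theorem primOp_zero_right (xs : List (WordSpace K X)) (j : ℕ) (y : WordSpace K X) :
    primOp xs j y 0 = 0 := by
  simpa using primOp_smul_right xs j (0 : K) y 0

/-- Pairs of degree `0` are not excluded, but their element is zero, hence so is an operation with
it as last argument. This covers a boundary case of `bul_convolve_nest`. -/
theorem nest_primOp_eq_zero (hdeg : ∀ x, 1 ≤ deg x) {Θ : GradedCoproduct K deg} {j : ℕ}
    {y : WordSpace K X} (xs : List (ℕ × WordSpace K X)) {zs : List (ℕ × WordSpace K X)}
    (hzs : HomogIn (primPsh Θ) zs) (hne : zs ≠ []) (h : degs zs = 0) :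
    nest primOp j y xs (elts zs) = 0 := by
  cases zs with
  | nil => exact absurd rfl hne
  | cons z zs =>
    rw [degs_cons] at h
    have hz : z.2 = 0 := by
      have := (homogIn_cons.1 hzs).1
      rw [show z.1 = 0 by omega] at this
      exact eq_zero_of_mem_primGr_zero hdeg this
    rw [elts_cons, hz]
    rcases eq_or_ne zs [] with rfl | hne'
    · simp [nest, primOp_zero_right]
    rw [nest_cons_cons _ _ _ _ (by simpa [elts] using hne')]
    simp [primOp_zero_right]

/-- The sum `∑_r x₁ •₀ ⋯ •₀ x_r •₀ F(x_{r+1}, …, x_n)`. -/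
def convolve (F : List (ℕ × WordSpace K X) → WordSpace K X) (xs : List (ℕ × WordSpace K X)) :
    WordSpace K X :=
  ∑ r ∈ Finset.range (xs.length + 1), bul 0 (concat (elts (xs.take r))) (F (xs.drop r))

/-- Both sides run over all ways to cut a list into three consecutive pieces. -/
theorem sum_range_take_drop {M : Type*} [AddCommMonoid M] {α : Type*}
    (f : List α → List α → List α → M) (xs : List α) :
    (∑ r ∈ Finset.range (xs.length + 1), ∑ s ∈ Finset.range ((xs.take r).length + 1),
        f ((xs.take r).take s) ((xs.take r).drop s) (xs.drop r)) =
      ∑ s ∈ Finset.range (xs.length + 1), ∑ p ∈ Finset.range ((xs.drop s).length + 1),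
        f (xs.take s) ((xs.drop s).take p) ((xs.drop s).drop p) := by
  have := Finset.sum_range_diag_flip (xs.length + 1)
    fun s p => f (xs.take s) ((xs.drop s).take p) ((xs.drop s).drop p)
  refine Eq.trans (Finset.sum_congr rfl fun r hr => ?_) (this.trans
    (Finset.sum_congr rfl fun s hs => ?_))
  · rw [Finset.mem_range] at hr
    rw [List.length_take, min_eq_left (by omega)]
    refine Finset.sum_congr rfl fun s hs => ?_
    rw [Finset.mem_range] at hs
    rw [List.take_take, min_eq_left (by omega), List.drop_take, List.drop_drop]
    congr 2
    omega
  · rw [Finset.mem_range] at hs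
    rw [List.length_drop]
    congr 2
    omega

/-- Insertion of a homogeneous element in a sum of products. -/
theorem bul_convolve {S : Submodule K (WordSpace K X)} {xs : List (ℕ × WordSpace K X)}
    (h : HomogIn S xs) (i c : ℕ) {F : List (ℕ × WordSpace K X) → WordSpace K X}
    (hF : ∀ r, F (xs.drop r) ∈ homog K X (degs (xs.drop r) + c)) (z : WordSpace K X) :
    bul (i + degs xs) z (convolve F xs) =
      convolve (fun ys => ∑ p ∈ Finset.range (ys.length + 1),
        primOp (elts (ys.take p)) (i + degs (ys.drop p)) (F (ys.drop p)) z) xs +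
      if i = c then convolve (fun ys => bul 0 (F ys) z) xs else 0 := by
  have h1 : ∀ r ∈ Finset.range (xs.length + 1), bul (i + degs xs) z
      (bul 0 (concat (elts (xs.take r))) (F (xs.drop r))) =
      (∑ s ∈ Finset.range ((xs.take r).length + 1),
        bul 0 (concat (elts ((xs.take r).take s)))
          (primOp (elts ((xs.take r).drop s)) (i + degs (xs.drop r)) (F (xs.drop r)) z)) +
      if i = c then bul 0 (concat (elts (xs.take r))) (bul 0 (F (xs.drop r)) z) else 0 := by
    intro r _
    rw [← degs_take_add_drop xs r, add_comm (degs (xs.take r)), ← add_assoc,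
      bul_concat_eq (h.take r) _ (hF r)]
    congr 2
    exact propext ⟨fun h => by omega, fun h => by omega⟩
  rw [convolve, map_sum, Finset.sum_congr rfl h1, Finset.sum_add_distrib, sum_range_take_drop
    (fun a b c => bul 0 (concat (elts a)) (primOp (elts b) (i + degs c) (F c) z))]
  simp only [convolve, map_sum]
  split_ifs <;> simp

/-- The summand `r = 0` is `F xs`; every other summand is a proper product. -/
theorem convolve_mem_decomposables (hdeg : ∀ x, 1 ≤ deg x) {Θ : GradedCoproduct K deg}
    {xs : List (ℕ × WordSpace K X)} (h : HomogIn (primPsh Θ) xs)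
    {F : List (ℕ × WordSpace K X) → WordSpace K X} (hF : ∀ r, F (xs.drop r) ∈ kSpace K deg) :
    convolve F xs - F xs ∈ decomposables K deg := by
  rw [convolve, Finset.sum_range_succ']
  simp only [List.take_zero, elts_nil, concat_nil, bul_unit_left, List.drop_zero, add_sub_cancel_right]
  refine Submodule.sum_mem _ fun r hr => bul_mem_decomposables ?_ (hF _)
  rw [Finset.mem_range] at hr
  cases xs with
  | nil => simp at hr
  | cons x xs =>
    rw [List.take_succ_cons]
    have h1 : ∀ (x : ℕ × WordSpace K X) (xs), HomogIn (primPsh Θ) (x :: xs) →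
        concat (elts (x :: xs)) ∈ kSpace K deg := by
      intro x xs
      induction xs generalizing x with
      | nil => intro h; simpa using mem_kSpace_of_mem_primPsh hdeg (h x (by simp)).1
      | cons x' xs ih =>
        intro h
        rw [homogIn_cons] at h
        rw [elts_cons, concat_cons]
        exact bul_mem_kSpace 0 (mem_kSpace_of_mem_primPsh hdeg h.1.1) (ih _ h.2)
    refine h1 x _ ?_
    have := h.take (r + 1)
    rwa [List.take_succ_cons] at this

end
end Presh

namespace Presh
open scoped TensorProduct
noncomputable section
variable {K : Type u} {X : Type v}
variable [Field K] {deg : X → ℕ}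

theorem convolve_mem_homog {S : Submodule K (WordSpace K X)} {xs : List (ℕ × WordSpace K X)}
    (h : HomogIn S xs) {c : ℕ} {F : List (ℕ × WordSpace K X) → WordSpace K X}
    (hF : ∀ r, F (xs.drop r) ∈ homog K X (degs (xs.drop r) + c)) :
    convolve F xs ∈ homog K X (degs xs + c) := by
  refine Submodule.sum_mem _ fun r _ => ?_
  have := bul_mem_homog (i := 0) (concat_mem_homog (h.take r)) (hF r)
  rwa [← add_assoc, degs_take_add_drop] at this

theorem concat_mem_kSpace (hdeg : ∀ x, 1 ≤ deg x) {Θ : GradedCoproduct K deg}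
    {xs : List (ℕ × WordSpace K X)} (h : HomogIn (primPsh Θ) xs) (hne : xs ≠ []) :
    concat (elts xs) ∈ kSpace K deg := by
  induction xs with
  | nil => exact absurd rfl hne
  | cons x xs ih =>
    rw [homogIn_cons] at h
    have hx := mem_kSpace_of_mem_primPsh hdeg h.1.1
    rcases eq_or_ne xs [] with rfl | hne'
    · simpa using hx
    · exact bul_mem_kSpace 0 hx (ih h.2 hne')

theorem HomogIn.append {S : Submodule K (WordSpace K X)} {xs ys : List (ℕ × WordSpace K X)}
    (h : HomogIn S xs) (h' : HomogIn S ys) : HomogIn S (xs ++ ys) :=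
  List.forall_mem_append.2 ⟨h, h'⟩

theorem nest_primOp_mem {Θ : GradedCoproduct K deg} {j d : ℕ} {y : WordSpace K X}
    (hy : y ∈ primGr Θ d) (h1 : 1 ≤ j) (h2 : j ≤ d) {xs zs : List (ℕ × WordSpace K X)}
    (hxs : HomogIn (primPsh Θ) xs) (hzs : HomogIn (primPsh Θ) zs) (hne : zs ≠ []) :
    nest primOp j y xs (elts zs) ∈ primGr Θ (degs xs + (d + degs zs)) := by
  rw [← add_assoc]
  exact nest_mem (preservesGr_primOp Θ) hy h1 h2 hxs hzs hne

/-- The expansion `bul_convolve` is the recursion of `nest`. Its extra term requires `j = |y| + degs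
zs`; as `j ≤ |y|`, this forces `degs zs = 0`, and then `nest` vanishes. -/
theorem bul_convolve_nest (hdeg : ∀ x, 1 ≤ deg x) {Θ : GradedCoproduct K deg} {j d : ℕ}
    {y : WordSpace K X} (hy : y ∈ primGr Θ d) (h1 : 1 ≤ j) (h2 : j ≤ d)
    {xs zs : List (ℕ × WordSpace K X)} (hxs : HomogIn (primPsh Θ) xs)
    (hzs : HomogIn (primPsh Θ) zs) (hne : zs ≠ []) (z : WordSpace K X) :
    bul (j + degs xs) z (convolve (fun ys => nest primOp j y ys (elts zs)) xs) =
      convolve (fun ys => nest primOp j y ys (z :: elts zs)) xs := by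
  rw [bul_convolve hxs j (d + degs zs)
    (fun r => (nest_primOp_mem hy h1 h2 (hxs.drop r) hzs hne).2)]
  have h3 : (if j = d + degs zs then
      convolve (fun ys => bul 0 (nest primOp j y ys (elts zs)) z) xs else 0) = 0 := by
    split_ifs with h
    · have h4 : ∀ ys, nest primOp j y ys (elts zs) = 0 :=
        fun ys => nest_primOp_eq_zero hdeg ys hzs hne (by omega)
      simp [convolve, h4]
    · rfl
  rw [h3, add_zero]
  congr 1
  funext ys
  rw [nest_cons_cons _ _ _ _ (by simpa [elts] using hne)]

/-- The decomposition of `(z₁ •₀ ⋯ •₀ z_l) •_{j + n} (x₁ •₀ ⋯ •₀ x_q •₀ y)` into products of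
primitive elements. -/
theorem bul_concat_concat_eq (hdeg : ∀ x, 1 ≤ deg x) {Θ : GradedCoproduct K deg} {j d : ℕ}
    {y : WordSpace K X} (hy : y ∈ primGr Θ d) (h1 : 1 ≤ j) (h2 : j ≤ d)
    {xs zs : List (ℕ × WordSpace K X)} (hxs : HomogIn (primPsh Θ) xs)
    (hzs : HomogIn (primPsh Θ) zs) (hne : zs ≠ []) :
    bul (j + degs xs) (concat (elts zs)) (bul 0 (concat (elts xs)) y) =
      convolve (fun ys => nest primOp j y ys (elts zs)) xs +
      if j = d then
        (∑ i ∈ Finset.Ico 1 zs.length,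
          bul 0 (convolve (fun ys => nest primOp j y ys (elts (zs.take i))) xs)
            (concat (elts (zs.drop i)))) +
        bul 0 (bul 0 (concat (elts xs)) y) (concat (elts zs))
      else 0 := by
  induction zs with
  | nil => exact absurd rfl hne
  | cons z zs ih =>
    have hzs' := (homogIn_cons.1 hzs).2
    have hxy : bul 0 (concat (elts xs)) y ∈ homog K X (degs xs + d) :=
      bul_mem_homog (concat_mem_homog hxs) hy.2
    have hz : ∀ z', bul (j + degs xs) z' (bul 0 (concat (elts xs)) y) =
        convolve (fun ys => nest primOp j y ys [z']) xs +
          if j = d then bul 0 (bul 0 (concat (elts xs)) y) z' else 0 := by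
      intro z'
      rw [bul_concat_eq hxs j hy.2, bul_assoc]
      rfl
    rcases eq_or_ne zs [] with rfl | hne'
    · simpa using hz z.2
    rw [elts_cons, concat_cons, bul_zero_bul _ _ hxy (by omega), ih hzs' hne', map_add,
      bul_convolve_nest hdeg hy h1 h2 hxs hzs' hne']
    congr 1
    split_ifs with hj
    -- Inserting `z` in the last product of the induction hypothesis gives the summand `i = 1` and
    -- the new last product; the summands `i ≥ 2` are the old ones with `z` added to the nest.
    · rw [map_add, map_sum, bul_bul_zero _ _ hxy (by omega), hz, if_pos hj, List.length_cons,
        Finset.sum_eq_sum_Ico_succ_bot (show 1 < zs.length + 1 by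
          have := List.length_pos_iff.2 hne'; omega),
        ← Finset.sum_Ico_add' _ 1 zs.length 1, map_add, LinearMap.add_apply, bul_assoc _ z.2]
      simp only [List.take_succ_cons, List.drop_succ_cons, List.take_zero, List.drop_zero,
        elts_cons, elts_nil]
      have h3 : ∀ i ∈ Finset.Ico 1 zs.length, bul (j + degs xs) z.2
          (bul 0 (convolve (fun ys => nest primOp j y ys (elts (zs.take i))) xs)
            (concat (elts (zs.drop i)))) =
          bul 0 (convolve (fun ys => nest primOp j y ys (z.2 :: elts (zs.take i))) xs)
            (concat (elts (zs.drop i))) := by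
        intro i hi
        rw [Finset.mem_Ico] at hi
        have hne2 : zs.take i ≠ [] := by
          rw [← List.length_pos_iff, List.length_take]; omega
        rw [bul_bul_zero _ _ (convolve_mem_homog hxs fun r =>
          (nest_primOp_mem hy h1 h2 (hxs.drop r) (hzs'.take i) hne2).2) (by omega),
          bul_convolve_nest hdeg hy h1 h2 hxs (hzs'.take i) hne2]
      rw [Finset.sum_congr rfl h3]
      abel
    · simp

/-- The span of the products `a •₀ b` with `a` homogeneous of degree at least `J`. -/
def wideProducts (K : Type u) [Field K] (deg : X → ℕ) (J : ℕ) : Submodule K (WordSpace K X) :=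
  Submodule.span K {v | ∃ n a b, J ≤ n ∧ a ∈ kSpace K deg ∧ a ∈ homog K X n ∧ b ∈ kSpace K deg ∧
    bul 0 a b = v}

theorem bul_mem_wideProducts {J n : ℕ} {a b : WordSpace K X} (ha : a ∈ kSpace K deg)
    (ha' : a ∈ homog K X n) (hJ : J ≤ n) (hb : b ∈ kSpace K deg) :
    bul 0 a b ∈ wideProducts K deg J :=
  Submodule.subset_span ⟨n, a, b, hJ, ha, ha', hb, rfl⟩

theorem wideProducts_le (J : ℕ) : wideProducts K deg J ≤ decomposables K deg := by
  rw [wideProducts, Submodule.span_le]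
  rintro _ ⟨n, a, b, -, ha, -, hb, rfl⟩
  exact bul_mem_decomposables ha hb

/-- Insertion in a product may destroy decomposability. Here position `J` does not go beyond the
first factor, so the second one still splits off. This permits the further insertion of `z₁` in
`primOp_rel_succ`. -/
theorem bul_wideProducts {J : ℕ} {z v : WordSpace K X} (hz : z ∈ kSpace K deg)
    (hv : v ∈ wideProducts K deg J) : bul J z v ∈ decomposables K deg := by
  refine Submodule.span_induction ?_ (by simp) (fun a b _ _ ha hb => ?_) (fun c a _ ha => ?_) hv
  · rintro _ ⟨n, a, b, hJ, ha, ha', hb, rfl⟩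
    rw [bul_bul_zero _ _ ha' hJ]
    exact bul_mem_decomposables (bul_mem_kSpace J hz ha) hb
  · rw [map_add]; exact add_mem ha hb
  · rw [map_smul]; exact Submodule.smul_mem _ _ ha

/-- Insertion in a product, modulo products with a large first factor. -/
theorem bul_concat_append_mem (hdeg : ∀ x, 1 ≤ deg x) {Θ : GradedCoproduct K deg} {J k e f : ℕ}
    {as bs : List (ℕ × WordSpace K X)} {b : ℕ × WordSpace K X} (has : HomogIn (primPsh Θ) as)
    (hbs : HomogIn (primPsh Θ) (b :: bs)) (hJ : J ≤ degs as + b.1) {w t : WordSpace K X}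
    (hw : w ∈ primGr Θ e) (h1 : 1 ≤ k) (h2 : k ≤ e) (ht : t ∈ primGr Θ f) :
    bul (k + degs (as ++ b :: bs)) t (bul 0 (concat (elts (as ++ b :: bs))) w) -
      (∑ s ∈ Finset.range (as.length + 1), bul 0 (concat (elts (as.take s)))
        (primOp (elts (as.drop s ++ b :: bs)) k w t)) ∈ wideProducts K deg J := by
  have hab := has.append hbs
  have hlen : (as ++ b :: bs).length + 1 = (as.length + 1) + (bs.length + 1) := by
    simp; omega
  rw [bul_concat_eq hab k hw.2, hlen, Finset.sum_range_add]
  have h3 : ∀ s ∈ Finset.range (as.length + 1),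
      bul 0 (concat (elts ((as ++ b :: bs).take s))) (primOp (elts ((as ++ b :: bs).drop s)) k w t) =
      bul 0 (concat (elts (as.take s))) (primOp (elts (as.drop s ++ b :: bs)) k w t) := by
    intro s hs
    rw [Finset.mem_range] at hs
    rw [List.take_append_of_le_length (by omega), List.drop_append_of_le_length (by omega)]
  rw [Finset.sum_congr rfl h3, add_assoc, add_sub_cancel_left]
  -- In the remaining summands the first factor contains all of `as` and `b`, so its degree is at
  -- least `J`.
  refine add_mem (Submodule.sum_mem _ fun s _ => ?_) ?_
  · have h4 : (as ++ b :: bs).take (as.length + 1 + s) = as ++ b :: bs.take s := by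
      rw [add_assoc, List.take_length_add_append, add_comm 1 s, List.take_succ_cons]
    rw [h4]
    have h5 : HomogIn (primPsh Θ) (as ++ b :: bs.take s) := by
      have := hab.take (as.length + 1 + s)
      rwa [h4] at this
    refine bul_mem_wideProducts (concat_mem_kSpace hdeg h5 (by simp)) (concat_mem_homog h5)
      (by simp; omega) (mem_kSpace_of_mem_primPsh (Θ := Θ) hdeg ?_)
    exact (preservesGr_primOp Θ _ e k f w t (hab.drop _) hw h1 h2 ht).1
  · split_ifs
    · rw [← bul_assoc]
      refine bul_mem_wideProducts (bul_mem_kSpace 0 (concat_mem_kSpace hdeg hab (by simp))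
        (mem_kSpace_of_mem_primPsh hdeg hw.1)) (bul_mem_homog (concat_mem_homog hab) hw.2) ?_
        (mem_kSpace_of_mem_primPsh hdeg ht.1)
      simp; omega
    · exact zero_mem _

theorem convolve_add (F G : List (ℕ × WordSpace K X) → WordSpace K X)
    (xs : List (ℕ × WordSpace K X)) :
    convolve (fun ys => F ys + G ys) xs = convolve F xs + convolve G xs := by
  simp only [convolve, map_add, Finset.sum_add_distrib]

theorem convolve_sum {ι : Type*} (s : Finset ι) (F : ι → List (ℕ × WordSpace K X) → WordSpace K X)
    (xs : List (ℕ × WordSpace K X)) :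
    convolve (fun ys => ∑ i ∈ s, F i ys) xs = ∑ i ∈ s, convolve (F i) xs := by
  simp only [convolve, map_sum]
  rw [Finset.sum_comm]

/-- Inserting `z₁ ⋯ z_m w` in `x₁ ⋯ x_n y` gives the three kinds of products in
`bul_concat_concat_eq`; inserting `t` in each of them gives the three sums of `relSum`. The error is
kept among the wide products, not just the decomposables, so that one more insertion is possible. -/
theorem bul_bul_concat_mem (hdeg : ∀ x, 1 ≤ deg x) {Θ : GradedCoproduct K deg} {j k d e f : ℕ}
    {y w t : WordSpace K X} (hy : y ∈ primGr Θ d) (h1 : 1 ≤ j) (h2 : j ≤ d)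
    (hw : w ∈ primGr Θ e) (h3 : 1 ≤ k) (h4 : k ≤ e) (ht : t ∈ primGr Θ f)
    {xs zs : List (ℕ × WordSpace K X)} (hxs : HomogIn (primPsh Θ) xs)
    (hzs : HomogIn (primPsh Θ) zs) :
    bul (k + degs zs + (j + degs xs)) t
      (bul (j + degs xs) (bul 0 (concat (elts zs)) w) (bul 0 (concat (elts xs)) y)) -
      convolve (fun ys => relSum primOp j k d ys y zs w t) xs ∈
        wideProducts K deg (j + degs xs) := by
  have hzw : HomogIn (primPsh Θ) (zs ++ [(e, w)]) := hzs.append fun x hx => by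
    rw [List.mem_singleton.1 hx]; exact hw
  have htk := mem_kSpace_of_mem_primPsh hdeg ht.1
  have hc : bul 0 (concat (elts zs)) w = concat (elts (zs ++ [(e, w)])) := by
    simp [concat_append]
  rw [hc, bul_concat_concat_eq hdeg hy h1 h2 hxs hzw (by simp), map_add]
  -- The products in which all of `z₁, …, z_m, w` are nested over `y`.
  have hA : bul (k + degs zs + (j + degs xs)) t
      (convolve (fun ys => nest primOp j y ys (elts (zs ++ [(e, w)]))) xs) -
      convolve (fun ys => ∑ r ∈ Finset.range (ys.length + 1),
        primOp (elts (ys.take r)) (j + k + degs (ys.drop r) + degs zs)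
          (nest primOp j y (ys.drop r) (elts zs ++ [w])) t) xs ∈
        wideProducts K deg (j + degs xs) := by
    have h5 := bul_convolve hxs (k + degs zs + j) (d + degs (zs ++ [(e, w)]))
      (F := fun ys => nest primOp j y ys (elts (zs ++ [(e, w)])))
      (fun r => (nest_primOp_mem hy h1 h2 (hxs.drop r) hzw (by simp)).2) t
    rw [add_assoc] at h5
    have h6 : convolve (fun ys => ∑ r ∈ Finset.range (ys.length + 1),
        primOp (elts (ys.take r)) (j + k + degs (ys.drop r) + degs zs)
          (nest primOp j y (ys.drop r) (elts zs ++ [w])) t) xs =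
        convolve (fun ys => ∑ r ∈ Finset.range (ys.length + 1),
        primOp (elts (ys.take r)) (k + degs zs + j + degs (ys.drop r))
          (nest primOp j y (ys.drop r) (elts (zs ++ [(e, w)]))) t) xs := by
      congr 1; funext ys
      refine Finset.sum_congr rfl fun r _ => ?_
      rw [elts_append, show k + degs zs + j + degs (ys.drop r) =
        j + k + degs (ys.drop r) + degs zs by omega]
      rfl
    rw [h5, h6, add_sub_cancel_left]
    split_ifs
    · refine Submodule.sum_mem _ fun r _ => ?_
      rw [← bul_assoc]
      have hN := nest_primOp_mem hy h1 h2 (hxs.drop r) hzw (by simp)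
      have hNk := mem_kSpace_of_mem_primPsh hdeg hN.1
      refine bul_mem_wideProducts ?_ (bul_mem_homog (concat_mem_homog (hxs.take r)) hN.2) ?_ htk
      · rcases eq_or_ne (xs.take r) [] with h | h
        · rw [h]; simpa using hNk
        · exact bul_mem_kSpace 0 (concat_mem_kSpace hdeg (hxs.take r) h) hNk
      · have := degs_take_add_drop xs r
        omega
    · exact zero_mem _
  simp only [relSum]
  rw [convolve_add, add_sub_add_comm]
  refine add_mem hA ?_
  by_cases hj : j = d
  swap
  · simp only [if_neg hj, map_zero]
    simp [convolve]
  simp only [if_pos hj]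
  rw [convolve_add, convolve_sum, map_add, map_sum, add_sub_add_comm, List.length_append,
    List.length_singleton, show Finset.Ico 1 (zs.length + 1) = Finset.Icc 1 zs.length from rfl,
    ← Finset.sum_sub_distrib]
  refine add_mem (Submodule.sum_mem _ fun l hl => ?_) ?_
  -- The products in which `z₁, …, z_l` are nested over `y`, while `z_{l+1}, …, z_m, w` follow as
  -- separate factors.
  · rw [Finset.mem_Icc] at hl
    have hne : zs.take l ≠ [] := by
      rw [← List.length_pos_iff, List.length_take]; omega
    rw [List.take_append_of_le_length hl.2, List.drop_append_of_le_length hl.2, elts_append,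
      concat_append, convolve, map_sum, LinearMap.sum_apply, map_sum]
    have hs := sum_range_take_drop (fun a b c => bul 0 (concat (elts a))
      (primOp (elts b ++ nest primOp j y c (elts (zs.take l)) :: elts (zs.drop l)) k w t)) xs
    simp only [convolve, map_sum]
    rw [← hs, ← Finset.sum_sub_distrib]
    refine Submodule.sum_mem _ fun r hr => ?_
    have hN := nest_primOp_mem hy h1 h2 (hxs.drop r) (hzs.take l) hne
    have h5 := degs_take_add_drop xs r
    have h6 := degs_take_add_drop zs l
    have key := bul_concat_append_mem hdeg (J := j + degs xs) (hxs.take r)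
      (b := (_, nest primOp j y (xs.drop r) (elts (zs.take l)))) (bs := zs.drop l)
      (homogIn_cons.2 ⟨hN, hzs.drop l⟩) (by dsimp only; omega) hw h3 h4 ht
    have h7 : k + degs zs + (j + degs xs) = k + degs (xs.take r ++
        (degs (xs.drop r) + (d + degs (zs.take l)),
          nest primOp j y (xs.drop r) (elts (zs.take l))) :: zs.drop l) := by
      simp only [degs_append, degs_cons]
      omega
    rw [h7]
    simp only [elts_append, elts_cons, elts_nil, concat_append, concat_cons, concat_nil,
      bul_unit_right, bul_assoc] at key ⊢
    exact key
  -- The product in which nothing is nested over `y`.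
  · have key := bul_concat_append_mem hdeg (J := j + degs xs) hxs (b := (d, y)) (bs := zs)
      (homogIn_cons.2 ⟨hy, hzs⟩) (by dsimp only; omega) hw h3 h4 ht
    have h7 : k + degs zs + (j + degs xs) = k + degs (xs ++ (d, y) :: zs) := by
      simp only [degs_append, degs_cons]
      omega
    rw [h7]
    simp only [elts_append, elts_cons, elts_nil, concat_append, concat_cons, concat_nil,
      bul_unit_right, bul_assoc] at key ⊢
    exact key

end
end Presh

namespace Presh
open scoped TensorProduct
noncomputable section
variable {K : Type u} {X : Type v}
variable [Field K] {deg : X → ℕ}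

/-! ### Verification of the two families of relations. -/

theorem bul_concat_mem_kSpace (hdeg : ∀ x, 1 ≤ deg x) {Θ : GradedCoproduct K deg}
    {xs : List (ℕ × WordSpace K X)} (h : HomogIn (primPsh Θ) xs) {y : WordSpace K X}
    (hy : y ∈ kSpace K deg) : bul 0 (concat (elts xs)) y ∈ kSpace K deg := by
  rcases eq_or_ne xs [] with rfl | hne
  · simpa using hy
  · exact bul_mem_kSpace 0 (concat_mem_kSpace hdeg h hne) hy

/-- The value of an operation is an insertion modulo decomposable elements. -/
theorem bul_concat_sub_primOp_mem (hdeg : ∀ x, 1 ≤ deg x) {Θ : GradedCoproduct K deg} {j d c : ℕ}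
    {y z : WordSpace K X} (hy : y ∈ primGr Θ d) (h1 : 1 ≤ j) (h2 : j ≤ d) (hz : z ∈ primGr Θ c)
    {xs : List (ℕ × WordSpace K X)} (hxs : HomogIn (primPsh Θ) xs) :
    bul (j + degs xs) z (bul 0 (concat (elts xs)) y) - primOp (elts xs) j y z ∈
      decomposables K deg := by
  rw [bul_concat_eq hxs j hy.2, add_sub_right_comm]
  refine add_mem (convolve_mem_decomposables hdeg hxs (F := fun ys => primOp (elts ys) j y z)
    fun r => mem_kSpace_of_mem_primPsh (Θ := Θ) hdeg
      (preservesGr_primOp Θ _ d j c y z (hxs.drop r) hy h1 h2 hz).1) ?_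
  split_ifs
  · rw [← bul_assoc]
    exact bul_mem_decomposables (bul_concat_mem_kSpace hdeg hxs
      (mem_kSpace_of_mem_primPsh hdeg hy.1)) (mem_kSpace_of_mem_primPsh hdeg hz.1)
  · exact zero_mem _

theorem bul_convolve_sub_mem (hdeg : ∀ x, 1 ≤ deg x) {Θ : GradedCoproduct K deg} {i c f : ℕ}
    {xs : List (ℕ × WordSpace K X)} (hxs : HomogIn (primPsh Θ) xs)
    {F : List (ℕ × WordSpace K X) → WordSpace K X} (h1 : 1 ≤ i) (h2 : i ≤ c)
    (hF : ∀ r, F (xs.drop r) ∈ primGr Θ (degs (xs.drop r) + c)) {z : WordSpace K X}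
    (hz : z ∈ primGr Θ f) :
    bul (i + degs xs) z (convolve F xs) - ∑ p ∈ Finset.range (xs.length + 1),
      primOp (elts (xs.take p)) (i + degs (xs.drop p)) (F (xs.drop p)) z ∈
        decomposables K deg := by
  have hzk := mem_kSpace_of_mem_primPsh hdeg hz.1
  rw [bul_convolve hxs i c fun r => (hF r).2, add_sub_right_comm]
  refine add_mem (convolve_mem_decomposables hdeg hxs
    (F := fun ys => ∑ p ∈ Finset.range (ys.length + 1),
      primOp (elts (ys.take p)) (i + degs (ys.drop p)) (F (ys.drop p)) z)
    fun r => Submodule.sum_mem _ fun p _ => ?_) ?_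
  · have h3 := hF (r + p)
    rw [← List.drop_drop] at h3
    exact mem_kSpace_of_mem_primPsh (Θ := Θ) hdeg (preservesGr_primOp Θ _ _ _ f _ z
      ((hxs.drop r).take p) h3 (by omega) (by omega) hz).1
  · split_ifs
    · refine Submodule.sum_mem _ fun r _ => ?_
      rw [← bul_assoc]
      exact bul_mem_decomposables (bul_concat_mem_kSpace hdeg (hxs.take r)
        (mem_kSpace_of_mem_primPsh hdeg (hF r).1)) hzk
    · exact zero_mem _

theorem relSum_primOp_mem {Θ : GradedCoproduct K deg} {j k d e f : ℕ} {y w t : WordSpace K X}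
    (hy : y ∈ primGr Θ d) (h1 : 1 ≤ j) (h2 : j ≤ d) (hw : w ∈ primGr Θ e) (h3 : 1 ≤ k)
    (h4 : k ≤ e) (ht : t ∈ primGr Θ f) {xs zs : List (ℕ × WordSpace K X)}
    (hxs : HomogIn (primPsh Θ) xs) (hzs : HomogIn (primPsh Θ) zs) :
    relSum primOp j k d xs y zs w t ∈ primGr Θ (degs xs + (d + degs zs + e + f)) := by
  simpa only [add_assoc] using
    relSum_mem (preservesGr_primOp Θ) hy h1 h2 hw h3 h4 ht (xs := xs) hxs (zs := zs) hzs

/-- Nested insertion moves `t` outside, where `bul_bul_concat_mem` applies; modulo decomposables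
only the summand of `convolve` without a prefix counts. -/
theorem bul_bul_concat_sub_relSum_mem (hdeg : ∀ x, 1 ≤ deg x) {Θ : GradedCoproduct K deg}
    {j k d e f : ℕ} {y w t : WordSpace K X} (hy : y ∈ primGr Θ d) (h1 : 1 ≤ j) (h2 : j ≤ d)
    (hw : w ∈ primGr Θ e) (h3 : 1 ≤ k) (h4 : k ≤ e) (ht : t ∈ primGr Θ f)
    {xs zs : List (ℕ × WordSpace K X)} (hxs : HomogIn (primPsh Θ) xs)
    (hzs : HomogIn (primPsh Θ) zs) :
    bul (j + degs xs) (bul (k + degs zs) t (bul 0 (concat (elts zs)) w))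
      (bul 0 (concat (elts xs)) y) - relSum primOp j k d xs y zs w t ∈ decomposables K deg := by
  rw [bul_bul t (bul_mem_homog (concat_mem_homog hzs) hw.2)
    (bul_mem_homog (concat_mem_homog hxs) hy.2) (by omega) (by omega)]
  have h5 := wideProducts_le _ (bul_bul_concat_mem hdeg hy h1 h2 hw h3 h4 ht hxs hzs)
  have h6 := convolve_mem_decomposables hdeg hxs
    (F := fun ys => relSum primOp j k d ys y zs w t) fun r =>
      mem_kSpace_of_mem_primPsh (Θ := Θ) hdeg
        (relSum_primOp_mem hy h1 h2 hw h3 h4 ht (hxs.drop r) hzs).1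
  simpa using add_mem h5 h6

/-- The principle behind both relations: between primitive elements, equality may be tested modulo
products. -/
theorem eq_of_sub_mem_decomposables (hdeg : ∀ x, 1 ≤ deg x) {Θ : GradedCoproduct K deg}
    {a b : WordSpace K X} (ha : a ∈ primPsh Θ) (hb : b ∈ primPsh Θ)
    (h : a - b ∈ decomposables K deg) : a = b :=
  sub_eq_zero.1 (eq_zero_of_mem_decomposables hdeg Θ (sub_mem ha hb) h)

/-- The last argument is `t •_k w`, minus `w •₀ t` if `k = |w|`. The first term yields `relSum`. For
the second, inserting `w •₀ t` means inserting `t` and then `w` at the same position, which yields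
the subtracted sum. -/
theorem primOp_rel_zero (hdeg : ∀ x, 1 ≤ deg x) {Θ : GradedCoproduct K deg}
    {j k d e f : ℕ} {y w t : WordSpace K X} (hy : y ∈ primGr Θ d) (h1 : 1 ≤ j) (h2 : j ≤ d)
    (hw : w ∈ primGr Θ e) (h3 : 1 ≤ k) (h4 : k ≤ e) (ht : t ∈ primGr Θ f)
    {xs : List (ℕ × WordSpace K X)} (hxs : HomogIn (primPsh Θ) xs) :
    primOp (elts xs) j y (primOp [] k w t) = relSum primOp j k d xs y [] w t -
      if k = e then ∑ r ∈ Finset.range (xs.length + 1),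
        primOp (elts (xs.take r)) (j + degs (xs.drop r)) (primOp (elts (xs.drop r)) j y t) w
      else 0 := by
  have hnil : HomogIn (primPsh Θ) [] := by simp [HomogIn]
  have hin := preservesGr_primOp Θ [] e k f w t hnil hw h3 h4 ht
  rw [elts_nil] at hin
  have hLr : ∀ r, primOp (elts (xs.drop r)) j y t ∈ primGr Θ (degs (xs.drop r) + (d + f)) :=
    fun r => by
      rw [← add_assoc]
      exact preservesGr_primOp Θ _ d j f y t (hxs.drop r) hy h1 h2 ht
  refine eq_of_sub_mem_decomposables hdeg
    (preservesGr_primOp Θ xs d j _ y _ hxs hy h1 h2 hin).1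
    (sub_mem (relSum_primOp_mem hy h1 h2 hw h3 h4 ht hxs hnil).1 ?_) ?_
  · split_ifs
    · exact Submodule.sum_mem _ fun r _ => (preservesGr_primOp Θ _ _ _ e _ w (hxs.take r) (hLr r)
        (by omega) (by omega) hw).1
    · exact zero_mem _
  have hA := bul_concat_sub_primOp_mem hdeg hy h1 h2 hin hxs
  have hB := bul_bul_concat_sub_relSum_mem hdeg hy h1 h2 hw h3 h4 ht hxs hnil
  simp only [elts_nil, concat_nil, bul_unit_left, degs_nil, add_zero] at hB
  have hC : (if k = e then bul (j + degs xs) (bul 0 w t) (bul 0 (concat (elts xs)) y) else 0) -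
      (if k = e then ∑ r ∈ Finset.range (xs.length + 1),
        primOp (elts (xs.take r)) (j + degs (xs.drop r)) (primOp (elts (xs.drop r)) j y t) w
      else 0) ∈ decomposables K deg := by
    split_ifs
    · rw [bul_zero_bul _ _ (bul_mem_homog (concat_mem_homog hxs) hy.2) (by omega),
        bul_concat_eq hxs j hy.2, map_add, add_sub_right_comm]
      refine add_mem (bul_convolve_sub_mem hdeg hxs (F := fun ys => primOp (elts ys) j y t)
        (c := d + f) h1 (by omega) hLr hw) ?_
      split_ifs
      · rw [← bul_assoc, bul_bul_zero _ _ (bul_mem_homog (concat_mem_homog hxs) hy.2) (by omega)]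
        exact bul_mem_decomposables (bul_mem_kSpace _ (mem_kSpace_of_mem_primPsh hdeg hw.1)
          (bul_concat_mem_kSpace hdeg hxs (mem_kSpace_of_mem_primPsh hdeg hy.1)))
          (mem_kSpace_of_mem_primPsh hdeg ht.1)
      · simp
    · simp
  have hD : bul (j + degs xs) (primOp [] k w t) (bul 0 (concat (elts xs)) y) =
      bul (j + degs xs) (bul k t w) (bul 0 (concat (elts xs)) y) -
        if k = e then bul (j + degs xs) (bul 0 w t) (bul 0 (concat (elts xs)) y) else 0 := by
    rw [primOp_nil hw.2, map_sub, LinearMap.sub_apply]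
    split_ifs <;> simp
  rw [hD] at hA
  convert sub_mem (sub_mem hB hC) hA using 1
  abel

/-- The last argument is a difference of an insertion for `z :: zs` and `z •₀` the insertion for
`zs`. The first term yields `relSum` for `z :: zs`. In the second, `z` is inserted after the whole
expression for `zs`, and this yields the subtracted sum. -/
theorem primOp_rel_succ (hdeg : ∀ x, 1 ≤ deg x) {Θ : GradedCoproduct K deg}
    {j k d e f : ℕ} {y w t : WordSpace K X} (hy : y ∈ primGr Θ d) (h1 : 1 ≤ j) (h2 : j ≤ d)
    (hw : w ∈ primGr Θ e) (h3 : 1 ≤ k) (h4 : k ≤ e) (ht : t ∈ primGr Θ f)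
    {xs zs : List (ℕ × WordSpace K X)} {z : ℕ × WordSpace K X} (hxs : HomogIn (primPsh Θ) xs)
    (hzs : HomogIn (primPsh Θ) (z :: zs)) :
    primOp (elts xs) j y (primOp (elts (z :: zs)) k w t) =
      relSum primOp j k d xs y (z :: zs) w t -
      ∑ r ∈ Finset.range (xs.length + 1), primOp (elts (xs.take r)) (j + degs (xs.drop r))
        (relSum primOp j k d (xs.drop r) y zs w t) z.2 := by
  have hz := (homogIn_cons.1 hzs).1
  have hzs' := (homogIn_cons.1 hzs).2
  have hin := preservesGr_primOp Θ (z :: zs) e k f w t hzs hw h3 h4 ht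
  have hR := fun r => relSum_primOp_mem hy h1 h2 hw h3 h4 ht (hxs.drop r) hzs'
  refine eq_of_sub_mem_decomposables hdeg
    (preservesGr_primOp Θ xs d j _ y _ hxs hy h1 h2 hin).1
    (sub_mem (relSum_primOp_mem hy h1 h2 hw h3 h4 ht hxs hzs).1
      (Submodule.sum_mem _ fun r _ => (preservesGr_primOp Θ _ _ _ z.1 _ z.2 (hxs.take r) (hR r)
        (by omega) (by omega) hz).1)) ?_
  have hA := bul_concat_sub_primOp_mem hdeg hy h1 h2 hin hxs
  have hB := bul_bul_concat_sub_relSum_mem hdeg hy h1 h2 hw h3 h4 ht hxs hzs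
  have hxy : bul 0 (concat (elts xs)) y ∈ homog K X (degs xs + d) :=
    bul_mem_homog (concat_mem_homog hxs) hy.2
  -- The error of the expansion for `zs` stays decomposable after the insertion of `z`, because it
  -- consists of wide products.
  have hU := bul_wideProducts (mem_kSpace_of_mem_primPsh hdeg hz.1)
    (bul_bul_concat_mem hdeg hy h1 h2 hw h3 h4 ht hxs hzs')
  have hV := bul_convolve_sub_mem hdeg hxs (F := fun ys => relSum primOp j k d ys y zs w t)
    (c := d + degs zs + e + f) h1 (by omega) hR hz
  rw [map_sub] at hU
  rw [primOp_cons hzs, map_sub, LinearMap.sub_apply, bul_zero_bul _ _ hxy (by omega),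
    bul_bul t (bul_mem_homog (concat_mem_homog hzs') hw.2) hxy (by omega) (by omega)] at hA
  rw [primOp_cons hzs]
  convert sub_mem (sub_mem hB (add_mem hU hV)) hA using 1
  abel

end
end Presh

namespace Presh
open scoped TensorProduct
noncomputable section
variable {K : Type u} {X : Type v}
variable [Field K] {deg : X → ℕ}

/-! ### Compatibility of maps with the two sides of the relations -/

section MapPairs

variable {V V' : Type*}

/-- A list of pairs (degree, element), mapped by a map that preserves degrees. -/
def mapPairs (φ : V → V') (xs : List (ℕ × V)) : List (ℕ × V') := xs.map (Prod.map id φ)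

@[simp] theorem elts_mapPairs (φ : V → V') (xs : List (ℕ × V)) :
    elts (mapPairs φ xs) = (elts xs).map φ := by
  simp [elts, mapPairs]

@[simp] theorem degs_mapPairs (φ : V → V') (xs : List (ℕ × V)) :
    degs (mapPairs φ xs) = degs xs := by
  simp [degs, mapPairs, Function.comp_def]

@[simp] theorem length_mapPairs (φ : V → V') (xs : List (ℕ × V)) :
    (mapPairs φ xs).length = xs.length := by
  simp [mapPairs]

@[simp] theorem mapPairs_nil (φ : V → V') : mapPairs φ [] = [] := rfl

@[simp] theorem mapPairs_cons (φ : V → V') (x : ℕ × V) (xs : List (ℕ × V)) :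
    mapPairs φ (x :: xs) = (x.1, φ x.2) :: mapPairs φ xs := rfl

theorem take_mapPairs (φ : V → V') (xs : List (ℕ × V)) (r : ℕ) :
    (mapPairs φ xs).take r = mapPairs φ (xs.take r) := by
  simp [mapPairs]

theorem drop_mapPairs (φ : V → V') (xs : List (ℕ × V)) (r : ℕ) :
    (mapPairs φ xs).drop r = mapPairs φ (xs.drop r) := by
  simp [mapPairs]

end MapPairs

section Map

variable {V : Type*} [AddCommGroup V] [Module K V] {V' : Type*} [AddCommGroup V'] [Module K V']
  {G : ℕ → Submodule K V} {L : List V → ℕ → V → V → V} {L' : List V' → ℕ → V' → V' → V'}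

/-- The map `φ` commutes with the operations with last argument `z`. -/
def CommutesAt (G : ℕ → Submodule K V) (L : List V → ℕ → V → V → V)
    (L' : List V' → ℕ → V' → V' → V') (φ : V →ₗ[K] V') (z : V) : Prop :=
  ∀ (xs : List V) (m j : ℕ) (y : V), y ∈ G m → 1 ≤ j → j ≤ m →
    φ (L xs j y z) = L' (xs.map φ) j (φ y) (φ z)

theorem map_nest (hL : PreservesGr G L) {φ : V →ₗ[K] V'} {j d : ℕ} {y : V} (hy : y ∈ G d)
    (h1 : 1 ≤ j) (h2 : j ≤ d) {xs zs : List (ℕ × V)} (hxs : ∀ x ∈ xs, x.2 ∈ G x.1)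
    (hzs : ∀ x ∈ zs, x.2 ∈ G x.1) (hφ : ∀ x ∈ zs, CommutesAt G L L' φ x.2) :
    φ (nest L j y xs (elts zs)) =
      nest L' j (φ y) (mapPairs φ xs) (elts (mapPairs φ zs)) := by
  induction zs generalizing xs with
  | nil => simp [nest]
  | cons z zs ih =>
    rw [List.forall_mem_cons] at hzs hφ
    rcases eq_or_ne zs [] with rfl | hne
    · simp [nest, hφ.1 _ d j y hy h1 h2]
    rw [elts_mapPairs, elts_cons, List.map_cons,
      nest_cons_cons _ _ _ _ (by simpa [elts] using hne),
      nest_cons_cons _ _ _ _ (by simpa [elts] using hne), map_sum, length_mapPairs]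
    refine Finset.sum_congr rfl fun p _ => ?_
    have hd : ∀ x ∈ xs.drop p, x.2 ∈ G x.1 := fun x hx => hxs x (List.mem_of_mem_drop hx)
    rw [hφ.1 _ _ _ _ (nest_mem hL hy h1 h2 hd hzs.2 hne) (by omega) (by omega), ih hd hzs.2 hφ.2,
      take_mapPairs, drop_mapPairs, elts_mapPairs, elts_mapPairs, degs_mapPairs]

/-- Only entries of `zs`, `w` and `t` occur as last arguments in `relSum`, so nothing is assumed
about `xs` and `y`. The induction in the proof of freeness rests on this. -/
theorem map_relSum (hL : PreservesGr G L) {φ : V →ₗ[K] V'} {j k d e : ℕ} {y w t : V}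
    (hy : y ∈ G d) (h1 : 1 ≤ j) (h2 : j ≤ d) (hw : w ∈ G e) (h3 : 1 ≤ k) (h4 : k ≤ e)
    {xs zs : List (ℕ × V)} (hxs : ∀ x ∈ xs, x.2 ∈ G x.1) (hzs : ∀ x ∈ zs, x.2 ∈ G x.1)
    (hφ : ∀ x ∈ zs, CommutesAt G L L' φ x.2) (hφw : CommutesAt G L L' φ w)
    (hφt : CommutesAt G L L' φ t) :
    φ (relSum L j k d xs y zs w t) =
      relSum L' j k d (mapPairs φ xs) (φ y) (mapPairs φ zs) (φ w) (φ t) := by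
  have hd : ∀ r, ∀ x ∈ xs.drop r, x.2 ∈ G x.1 := fun r x hx => hxs x (List.mem_of_mem_drop hx)
  have hzw : ∀ x ∈ zs ++ [(e, w)], x.2 ∈ G x.1 :=
    List.forall_mem_append.2 ⟨hzs, by simpa using hw⟩
  have hzw' : ∀ x ∈ zs ++ [(e, w)], CommutesAt G L L' φ x.2 :=
    List.forall_mem_append.2 ⟨hφ, by simpa using hφw⟩
  have hA : ∀ r, φ (L (elts (xs.take r)) (j + k + degs (xs.drop r) + degs zs)
      (nest L j y (xs.drop r) (elts zs ++ [w])) t) =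
      L' (elts ((mapPairs φ xs).take r))
        (j + k + degs ((mapPairs φ xs).drop r) + degs (mapPairs φ zs))
        (nest L' j (φ y) ((mapPairs φ xs).drop r) (elts (mapPairs φ zs) ++ [φ w])) (φ t) := by
    intro r
    have h5 := map_nest hL hy h1 h2 (hd r) hzw hzw'
    have h6 := nest_mem hL hy h1 h2 (hd r) hzw (by simp)
    rw [elts_append, elts_cons, elts_nil] at h5 h6
    rw [hφt _ _ _ _ h6 (by omega) (by simp; omega), h5]
    simp [take_mapPairs, drop_mapPairs]
  have hB : ∀ l r, φ (L (elts (xs.take r) ++ nest L j y (xs.drop r) (elts (zs.take l)) ::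
      elts (zs.drop l)) k w t) =
      L' (elts ((mapPairs φ xs).take r) ++ nest L' j (φ y) ((mapPairs φ xs).drop r)
        (elts ((mapPairs φ zs).take l)) :: elts ((mapPairs φ zs).drop l)) k (φ w) (φ t) := by
    intro l r
    rw [hφt _ _ _ _ hw h3 h4, List.map_append, List.map_cons, map_nest hL hy h1 h2 (hd r)
      (fun x hx => hzs x (List.mem_of_mem_take hx)) (fun x hx => hφ x (List.mem_of_mem_take hx))]
    simp [take_mapPairs, drop_mapPairs]
  have hC : φ (L (elts xs ++ y :: elts zs) k w t) =
      L' (elts (mapPairs φ xs) ++ φ y :: elts (mapPairs φ zs)) k (φ w) (φ t) := by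
    rw [hφt _ _ _ _ hw h3 h4]
    simp
  unfold relSum
  rw [map_add, map_sum, length_mapPairs, length_mapPairs]
  congr 1
  · exact Finset.sum_congr rfl fun r _ => hA r
  · split_ifs
    · rw [map_add, map_sum, hC]
      congr 1
      refine Finset.sum_congr rfl fun l _ => ?_
      rw [map_sum]
      exact Finset.sum_congr rfl fun r _ => hB l r
    · exact map_zero φ

end Map

/-! ### The `Prim_psh` algebra of primitive elements -/

theorem isGraded_primPsh (hdeg : ∀ x, 1 ≤ deg x) (Θ : GradedCoproduct K deg) :
    IsGraded (primPsh Θ) := by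
  rw [primPsh_eq_primitives hdeg]
  exact isGraded_primitives Θ

/-- The homogeneous component of degree `n` of a primitive element. -/
def primComp (hdeg : ∀ x, 1 ≤ deg x) (Θ : GradedCoproduct K deg) (n : ℕ) :
    primPsh Θ →ₗ[K] primPsh Θ :=
  (comp n).restrict (isGraded_primPsh hdeg Θ n)

/-- The elements of degree `n` of `𝒫rim_psh(X)`, as a subspace of `𝒫rim_psh(X)`. -/
def primPshGr (Θ : GradedCoproduct K deg) (n : ℕ) : Submodule K (primPsh Θ) :=
  (homog K X n).comap (primPsh Θ).subtype

theorem mem_primPshGr {Θ : GradedCoproduct K deg} {n : ℕ} {a : primPsh Θ} :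
    a ∈ primPshGr Θ n ↔ (a : WordSpace K X) ∈ homog K X n := Iff.rfl

theorem primComp_of_mem (hdeg : ∀ x, 1 ≤ deg x) {Θ : GradedCoproduct K deg} {n : ℕ}
    {a : primPsh Θ} (h : a ∈ primPshGr Θ n) : primComp hdeg Θ n a = a :=
  Subtype.ext (comp_of_mem h)

theorem primComp_of_mem_ne (hdeg : ∀ x, 1 ≤ deg x) {Θ : GradedCoproduct K deg} {m n : ℕ}
    {a : primPsh Θ} (h : a ∈ primPshGr Θ m) (hmn : m ≠ n) : primComp hdeg Θ n a = 0 :=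
  Subtype.ext (comp_of_mem_ne h hmn)

/-- The values of the elements of `𝔹` in `𝒫rim_psh(X)`. -/
def primEval (hdeg : ∀ x, 1 ≤ deg x) (Θ : GradedCoproduct K deg)
    (t : {t : NormalForm X // t.IsLegal deg}) : primPsh Θ :=
  ⟨t.1.eval Θ, NormalForm.eval_mem_of_closed hdeg (eElt_mem Θ) (closedUnderPrimOp_primPsh Θ) t.2⟩

theorem primEval_mem (hdeg : ∀ x, 1 ≤ deg x) (Θ : GradedCoproduct K deg)
    (t : {t : NormalForm X // t.IsLegal deg}) :
    primEval hdeg Θ t ∈ primPshGr Θ (t.1.degree deg) :=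
  t.1.eval_mem_homog hdeg Θ

theorem linearIndependent_primEval (hdeg : ∀ x, 1 ≤ deg x) (Θ : GradedCoproduct K deg) :
    LinearIndependent K (primEval hdeg Θ) :=
  LinearIndependent.of_comp (primPsh Θ).subtype (linearIndependent_eval hdeg Θ)

theorem span_primEval (hdeg : ∀ x, 1 ≤ deg x) (Θ : GradedCoproduct K deg) :
    Submodule.span K (Set.range (primEval hdeg Θ)) = ⊤ := by
  apply Submodule.map_injective_of_injective (primPsh Θ).subtype_injective
  rw [Submodule.map_span, Submodule.map_top, Submodule.range_subtype, ← Set.range_comp,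
    ← Set.image_univ]
  refine Eq.trans (congrArg _ ?_) (span_eval_eq_primPsh hdeg Θ)
  rw [Set.image_univ]
  ext v
  constructor
  · rintro ⟨t, rfl⟩; exact ⟨t.1, t.2, rfl⟩
  · rintro ⟨t, ht, rfl⟩; exact ⟨⟨t, ht⟩, rfl⟩

/-- Projection to degree `n` fixes the values of degree `n` and kills the others. -/
theorem primPshGr_le_span (hdeg : ∀ x, 1 ≤ deg x) (Θ : GradedCoproduct K deg) (n : ℕ) :
    primPshGr Θ n ≤ Submodule.span K (primEval hdeg Θ '' {t | t.1.degree deg = n}) := by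
  intro a ha
  rw [← primComp_of_mem hdeg ha]
  have h : a ∈ Submodule.span K (Set.range (primEval hdeg Θ)) := by
    rw [span_primEval]; trivial
  refine Submodule.span_induction ?_ (by simp) (fun a b _ _ ha hb => ?_) (fun c a _ ha => ?_) h
  · rintro _ ⟨t, rfl⟩
    by_cases ht : t.1.degree deg = n
    · rw [primComp_of_mem hdeg (ht ▸ primEval_mem hdeg Θ t)]
      exact Submodule.subset_span ⟨t, ht, rfl⟩
    · rw [primComp_of_mem_ne hdeg (primEval_mem hdeg Θ t) ht]
      exact zero_mem _
  · rw [map_add]; exact add_mem ha hb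
  · rw [map_smul]; exact Submodule.smul_mem _ _ ha

theorem isInternal_of_projections {V : Type*} [AddCommGroup V] [Module K V]
    {G : ℕ → Submodule K V} (p : ℕ → V →ₗ[K] V) (h1 : ∀ n, ∀ a ∈ G n, p n a = a)
    (h2 : ∀ m n, m ≠ n → ∀ a ∈ G m, p n a = 0) {ι : Type*} (v : ι → V) (f : ι → ℕ)
    (hv : Submodule.span K (Set.range v) = ⊤) (hvG : ∀ i, v i ∈ G (f i)) :
    DirectSum.IsInternal G := by
  refine DirectSum.isInternal_submodule_of_iSupIndep_of_iSup_eq_top ?_ ?_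
  · rw [iSupIndep_def]
    intro i
    rw [Submodule.disjoint_def]
    intro a ha hb
    rw [← h1 i a ha]
    have h : (⨆ (j) (_ : j ≠ i), G j) ≤ LinearMap.ker (p i) :=
      iSup₂_le fun j hj b hb => h2 j i hj b hb
    exact h hb
  · rw [eq_top_iff, ← hv, Submodule.span_le]
    rintro _ ⟨t, rfl⟩
    exact Submodule.mem_iSup_of_mem _ (hvG t)

theorem isInternal_primPshGr (hdeg : ∀ x, 1 ≤ deg x) (Θ : GradedCoproduct K deg) :
    DirectSum.IsInternal (primPshGr Θ) :=
  isInternal_of_projections (V := primPsh Θ) (primComp hdeg Θ)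
    (fun n a ha => primComp_of_mem hdeg (Θ := Θ) (n := n) (a := a) ha)
    (fun m n hmn a ha => primComp_of_mem_ne hdeg (Θ := Θ) (m := m) (n := n) (a := a) ha hmn)
    (primEval hdeg Θ) (fun t => t.1.degree deg) (span_primEval hdeg Θ) (primEval_mem hdeg Θ)

open Classical in
/-- The operations on `𝒫rim_psh(X)`. -/
def primPshOp (Θ : GradedCoproduct K deg) (xs : List (primPsh Θ)) (j : ℕ) (y z : primPsh Θ) :
    primPsh Θ :=
  -- The default `0` is never taken for homogeneous `y` and a legal index `j`, see `coe_primPshOp`.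
  if h : primOp (xs.map Subtype.val) j (y : WordSpace K X) z ∈ primPsh Θ then ⟨_, h⟩ else 0

theorem coe_primPshOp (Θ : GradedCoproduct K deg) (xs : List (primPsh Θ)) {m j : ℕ}
    {y : primPsh Θ} (z : primPsh Θ) (hy : y ∈ primPshGr Θ m) (h1 : 1 ≤ j) (h2 : j ≤ m) :
    (primPshOp Θ xs j y z : WordSpace K X) = primOp (xs.map Subtype.val) j y z := by
  rw [primPshOp, dif_pos]
  refine closedUnderPrimOp_primPsh Θ _ m j _ _ (fun x hx => ?_) y.2 hy h1 h2 z.2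
  obtain ⟨a, -, rfl⟩ := List.mem_map.1 hx
  exact a.2

theorem homogIn_mapPairs {Θ : GradedCoproduct K deg} {xs : List (ℕ × primPsh Θ)}
    (hxs : ∀ x ∈ xs, x.2 ∈ primPshGr Θ x.1) :
    HomogIn (primPsh Θ) (mapPairs (primPsh Θ).subtype xs) := by
  intro p hp
  obtain ⟨x, hx, rfl⟩ := List.mem_map.1 hp
  exact ⟨x.2.2, hxs x hx⟩

theorem preservesGr_primPshOp (Θ : GradedCoproduct K deg) :
    PreservesGr (primPshGr Θ) (primPshOp Θ) := by
  intro xs m j r y z hxs hy h1 h2 hz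
  rw [mem_primPshGr, coe_primPshOp Θ _ _ hy h1 h2]
  have := primOp_mem_homog (homogIn_mapPairs hxs) j hy hz
  rwa [elts_mapPairs, degs_mapPairs] at this

theorem commutesAt_subtype (Θ : GradedCoproduct K deg) (z : primPsh Θ) :
    CommutesAt (primPshGr Θ) (primPshOp Θ) primOp (primPsh Θ).subtype z :=
  fun xs _ _ _ hy h1 h2 => coe_primPshOp Θ xs z hy h1 h2

/-- The `Prim_psh` algebra `𝒫rim_psh(X)`. -/
def primAlgebra (hdeg : ∀ x, 1 ≤ deg x) (Θ : GradedCoproduct K deg) :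
    PrimPshAlgebra K (primPsh Θ) where
  gr := primPshGr Θ
  isInternal := isInternal_primPshGr hdeg Θ
  L := primPshOp Θ
  add_left xs xs' a b m j y z hy h1 h2 := Subtype.ext <| by
    rw [Submodule.coe_add, coe_primPshOp Θ _ _ hy h1 h2, coe_primPshOp Θ _ _ hy h1 h2,
      coe_primPshOp Θ _ _ hy h1 h2]
    simpa using primOp_add_left (xs.map Subtype.val) (xs'.map Subtype.val)
      (a : WordSpace K X) b j y z
  smul_left xs xs' c a m j y z hy h1 h2 := Subtype.ext <| by
    rw [Submodule.coe_smul, coe_primPshOp Θ _ _ hy h1 h2, coe_primPshOp Θ _ _ hy h1 h2]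
    simpa using primOp_smul_left (xs.map Subtype.val) (xs'.map Subtype.val)
      c (a : WordSpace K X) j y z
  add_mid xs m j y y' z hy hy' h1 h2 := Subtype.ext <| by
    rw [Submodule.coe_add, coe_primPshOp Θ _ _ hy h1 h2, coe_primPshOp Θ _ _ hy' h1 h2,
      coe_primPshOp Θ _ _ (add_mem hy hy') h1 h2]
    exact primOp_add_mid _ j _ _ _
  smul_mid xs m j c y z hy h1 h2 := Subtype.ext <| by
    rw [Submodule.coe_smul, coe_primPshOp Θ _ _ hy h1 h2,
      coe_primPshOp Θ _ _ (Submodule.smul_mem _ c hy) h1 h2]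
    exact primOp_smul_mid _ j _ _ _
  add_right xs m j y z z' hy h1 h2 := Subtype.ext <| by
    rw [Submodule.coe_add, coe_primPshOp Θ _ _ hy h1 h2, coe_primPshOp Θ _ _ hy h1 h2,
      coe_primPshOp Θ _ _ hy h1 h2]
    exact primOp_add_right _ j _ _ _
  smul_right xs m j c y z hy h1 h2 := Subtype.ext <| by
    rw [Submodule.coe_smul, coe_primPshOp Θ _ _ hy h1 h2, coe_primPshOp Θ _ _ hy h1 h2]
    exact primOp_smul_right _ j _ _ _
  mem_gr := preservesGr_primPshOp Θ
  rel_zero xs d e f j k y w t hxs hy hw ht h1 h2 h3 h4 := by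
    have hL := preservesGr_primPshOp Θ
    have hc := commutesAt_subtype Θ
    have hs : ∀ r, (primPsh Θ).subtype (primPshOp Θ (elts (xs.take r)) (j + degs (xs.drop r))
        (primPshOp Θ (elts (xs.drop r)) j y t) w) = _ := fun r =>
      hc w _ _ _ _ (hL (xs.drop r) d j f y t (fun x hx => hxs x (List.mem_of_mem_drop hx)) hy h1 h2
        ht) (by omega) (by omega)
    -- The inclusion is injective and commutes with the operations, so the relation is inherited
    -- from the word space.
    apply (primPsh Θ).subtype_injective
    rw [map_sub, map_relSum hL hy h1 h2 hw h3 h4 hxs (by simp) (by simp) (hc w) (hc t),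
      hc _ _ d j y hy h1 h2, hc t [] e k w hw h3 h4, apply_ite (primPsh Θ).subtype, map_sum, map_zero,
      Finset.sum_congr rfl fun r _ => hs r,
      Finset.sum_congr rfl fun r _ => by rw [hc t _ d j y hy h1 h2]]
    simpa [take_mapPairs, drop_mapPairs] using primOp_rel_zero hdeg (Θ := Θ) (y := y) (w := w) (t := t)
      ⟨y.2, hy⟩ h1 h2 ⟨w.2, hw⟩ h3 h4 ⟨t.2, ht⟩ (homogIn_mapPairs hxs)
  rel_succ xs z zs d e f j k y w t hxs hzs hy hw ht h1 h2 h3 h4 := by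
    have hL := preservesGr_primPshOp Θ
    have hc := commutesAt_subtype Θ
    have hzs' := (List.forall_mem_cons.1 hzs).2
    have hd : ∀ r, ∀ x ∈ xs.drop r, x.2 ∈ primPshGr Θ x.1 :=
      fun r x hx => hxs x (List.mem_of_mem_drop hx)
    have hs : ∀ r, (primPsh Θ).subtype (primPshOp Θ (elts (xs.take r)) (j + degs (xs.drop r))
        (relSum (primPshOp Θ) j k d (xs.drop r) y zs w t) z.2) = _ := fun r =>
      hc z.2 _ _ _ _ (relSum_mem hL hy h1 h2 hw h3 h4 ht (hd r) hzs') (by omega) (by omega)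
    apply (primPsh Θ).subtype_injective
    rw [map_sub, map_relSum hL hy h1 h2 hw h3 h4 hxs hzs (fun _ _ => hc _) (hc w) (hc t),
      hc _ _ d j y hy h1 h2, hc t _ e k w hw h3 h4, map_sum,
      Finset.sum_congr rfl fun r _ => hs r,
      Finset.sum_congr rfl fun r _ => by rw [map_relSum hL hy h1 h2 hw h3 h4 (hd r) hzs'
        (fun _ _ => hc _) (hc w) (hc t)]]
    have hzs2 := homogIn_mapPairs hzs
    simpa [take_mapPairs, drop_mapPairs] using primOp_rel_succ hdeg (Θ := Θ) (y := y) (w := w) (t := t)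
      (z := (z.1, z.2.1)) (zs := mapPairs (primPsh Θ).subtype zs)
      ⟨y.2, hy⟩ h1 h2 ⟨w.2, hw⟩ h3 h4 ⟨t.2, ht⟩ (homogIn_mapPairs hxs) hzs2

end
end Presh

namespace Presh
open scoped TensorProduct
noncomputable section
variable {K : Type u} {X : Type v}
variable [Field K] {deg : X → ℕ}

/-! ### Freeness -/

/-- Induction on the entries of a list of elements of a spanned module. -/
theorem list_span_induction {V : Type*} [AddCommGroup V] [Module K V] {S : Set V}
    (hS : Submodule.span K S = ⊤) {p : List V → Prop} (hbase : ∀ xs, (∀ x ∈ xs, x ∈ S) → p xs)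
    (hzero : ∀ as bs, p (as ++ 0 :: bs))
    (hadd : ∀ as bs a b, p (as ++ a :: bs) → p (as ++ b :: bs) → p (as ++ (a + b) :: bs))
    (hsmul : ∀ as bs (c : K) a, p (as ++ a :: bs) → p (as ++ (c • a) :: bs)) (xs : List V) :
    p xs := by
  -- The prefix `as` holds the entries already reduced to elements of `S`.
  have h : ∀ bs as : List V, (∀ x ∈ as, x ∈ S) → p (as ++ bs) := by
    intro bs
    induction bs with
    | nil => intro as has; rw [List.append_nil]; exact hbase as has
    | cons b bs ih =>
      intro as has
      have hb : b ∈ Submodule.span K S := by rw [hS]; trivial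
      induction hb using Submodule.span_induction with
      | mem b hb =>
        have := ih (as ++ [b]) (by
          rw [List.forall_mem_append]; exact ⟨has, by simpa using hb⟩)
        simpa using this
      | zero => exact hzero as bs
      | add a b _ _ ha hb => exact hadd as bs a b ha hb
      | smul c a _ ha => exact hsmul as bs c a ha
  exact h xs [] (by simp)

section Hom

variable {V : Type*} [AddCommGroup V] [Module K V] {V' : Type*} [AddCommGroup V'] [Module K V']
  (A : PrimPshAlgebra K V) (B : PrimPshAlgebra K V')

theorem PrimPshAlgebra.zero_left (xs xs' : List V) {m j : ℕ} {y : V} (z : V) (hy : y ∈ A.gr m)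
    (h1 : 1 ≤ j) (h2 : j ≤ m) : A.L (xs ++ 0 :: xs') j y z = 0 := by
  simpa using A.smul_left xs xs' 0 0 m j y z hy h1 h2

/-- The statement `φ (L(x₁, …, x_q; y; z)) = L(φ x₁, …, φ x_q; φ y; φ z)` for all `x₁, …, x_q`
follows from the case where `x₁, …, x_q` belong to a spanning set. -/
theorem map_op_of_span {φ : V →ₗ[K] V'} (hφ : ∀ n, ∀ x ∈ A.gr n, φ x ∈ B.gr n) {S : Set V}
    (hS : Submodule.span K S = ⊤) {m j : ℕ} {y : V} (z : V) (hy : y ∈ A.gr m) (h1 : 1 ≤ j)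
    (h2 : j ≤ m)
    (h : ∀ xs : List V, (∀ x ∈ xs, x ∈ S) →
      φ (A.L xs j y z) = B.L (xs.map φ) j (φ y) (φ z)) (xs : List V) :
    φ (A.L xs j y z) = B.L (xs.map φ) j (φ y) (φ z) := by
  have hy' := hφ m y hy
  refine list_span_induction hS (p := fun xs => φ (A.L xs j y z) = B.L (xs.map φ) j (φ y) (φ z))
    h (fun as bs => ?_) (fun as bs a b ha hb => ?_) (fun as bs c a ha => ?_) xs
  · rw [A.zero_left as bs z hy h1 h2, List.map_append, List.map_cons, map_zero,
      B.zero_left _ _ _ hy' h1 h2]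
  · rw [A.add_left as bs a b m j y z hy h1 h2, map_add, ha, hb]
    simp only [List.map_append, List.map_cons, map_add]
    rw [B.add_left _ _ _ _ m j _ _ hy' h1 h2]
  · rw [A.smul_left as bs c a m j y z hy h1 h2, map_smul, ha]
    simp only [List.map_append, List.map_cons, map_smul]
    rw [B.smul_left _ _ _ _ m j _ _ hy' h1 h2]

/-- The elements `z` such that `φ` commutes with the operations with last argument `z`. -/
def commuting (φ : V →ₗ[K] V') (hφ : ∀ n, ∀ x ∈ A.gr n, φ x ∈ B.gr n) : Submodule K V where
  carrier := {z | CommutesAt A.gr A.L B.L φ z}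
  zero_mem' xs m j y hy h1 h2 := by
    have h3 := A.smul_right xs m j 0 y 0 hy h1 h2
    have h4 := B.smul_right (xs.map φ) m j 0 (φ y) 0 (hφ m y hy) h1 h2
    rw [zero_smul, zero_smul] at h3 h4
    rw [h3, map_zero, h4]
  add_mem' {a b} ha hb xs m j y hy h1 h2 := by
    rw [A.add_right xs m j y a b hy h1 h2, map_add, map_add,
      B.add_right _ m j _ _ _ (hφ m y hy) h1 h2, ha xs m j y hy h1 h2, hb xs m j y hy h1 h2]
  smul_mem' c a ha xs m j y hy h1 h2 := by
    rw [A.smul_right xs m j c y a hy h1 h2, map_smul, map_smul,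
      B.smul_right _ m j _ _ _ (hφ m y hy) h1 h2, ha xs m j y hy h1 h2]

theorem span_iUnion_gr : Submodule.span K (⋃ n, (A.gr n : Set V)) = ⊤ := by
  rw [Submodule.span_iUnion]
  simp only [Submodule.span_eq]
  exact A.isInternal.submodule_iSup_eq_top

theorem exists_pairs {xs : List V} (h : ∀ x ∈ xs, x ∈ ⋃ n, (A.gr n : Set V)) :
    ∃ ps : List (ℕ × V), (∀ p ∈ ps, p.2 ∈ A.gr p.1) ∧ elts ps = xs := by
  induction xs with
  | nil => exact ⟨[], by simp, rfl⟩
  | cons x xs ih =>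
    rw [List.forall_mem_cons] at h
    obtain ⟨ps, h1, rfl⟩ := ih h.2
    obtain ⟨n, hn⟩ := Set.mem_iUnion.1 h.1
    exact ⟨(n, x) :: ps, List.forall_mem_cons.2 ⟨hn, h1⟩, rfl⟩

theorem mapPairs_mem {φ : V →ₗ[K] V'} (hφ : ∀ n, ∀ x ∈ A.gr n, φ x ∈ B.gr n)
    {xs : List (ℕ × V)} (h : ∀ x ∈ xs, x.2 ∈ A.gr x.1) :
    ∀ x ∈ mapPairs φ xs, x.2 ∈ B.gr x.1 := by
  intro p hp
  obtain ⟨x, hx, rfl⟩ := List.mem_map.1 hp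
  exact hφ _ _ (h x hx)

/-- The relation in `A` expresses an operation with last argument `L(w; t)` by operations with last
arguments `w` and `t`, with which `φ` commutes; the relation in `B` reassembles the image. -/
theorem op_nil_mem_commuting {φ : V →ₗ[K] V'} (hφ : ∀ n, ∀ x ∈ A.gr n, φ x ∈ B.gr n)
    {k e f : ℕ} {w t : V} (hw : w ∈ A.gr e) (h3 : 1 ≤ k) (h4 : k ≤ e) (ht : t ∈ A.gr f)
    (hφw : w ∈ commuting A B φ hφ) (hφt : t ∈ commuting A B φ hφ) :
    A.L [] k w t ∈ commuting A B φ hφ := by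
  intro xs m j y hy h1 h2
  -- The relations are stated for homogeneous entries, and these span.
  refine map_op_of_span A B hφ (span_iUnion_gr A) _ hy h1 h2 (fun xs hxs => ?_) xs
  obtain ⟨ps, hps, rfl⟩ := exists_pairs A hxs
  have hd : ∀ r, ∀ x ∈ ps.drop r, x.2 ∈ A.gr x.1 := fun r x hx => hps x (List.mem_of_mem_drop hx)
  rw [A.rel_zero ps m e f j k y w t hps hy hw ht h1 h2 h3 h4, map_sub,
    map_relSum A.mem_gr hy h1 h2 hw h3 h4 hps (by simp) (by simp) hφw hφt,
    hφt [] e k w hw h3 h4, ← elts_mapPairs, List.map_nil,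
    B.rel_zero _ m e f j k _ _ _ (mapPairs_mem A B hφ hps) (hφ _ _ hy) (hφ _ _ hw) (hφ _ _ ht)
      h1 h2 h3 h4, apply_ite φ, map_sum, map_zero, mapPairs_nil, length_mapPairs]
  congr 1
  refine if_congr Iff.rfl (Finset.sum_congr rfl fun r _ => ?_) rfl
  rw [hφw _ _ _ _ (A.mem_gr (ps.drop r) m j f y t (hd r) hy h1 h2 ht) (by omega) (by omega),
    hφt _ m j y hy h1 h2, take_mapPairs, drop_mapPairs, elts_mapPairs, elts_mapPairs,
    degs_mapPairs]

theorem op_cons_mem_commuting {φ : V →ₗ[K] V'} (hφ : ∀ n, ∀ x ∈ A.gr n, φ x ∈ B.gr n)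
    {k e f : ℕ} {w t : V} (hw : w ∈ A.gr e) (h3 : 1 ≤ k) (h4 : k ≤ e) (ht : t ∈ A.gr f)
    {z : ℕ × V} {zs : List (ℕ × V)} (hzs : ∀ x ∈ z :: zs, x.2 ∈ A.gr x.1)
    (hφz : ∀ x ∈ z :: zs, x.2 ∈ commuting A B φ hφ) (hφw : w ∈ commuting A B φ hφ)
    (hφt : t ∈ commuting A B φ hφ) :
    A.L (elts (z :: zs)) k w t ∈ commuting A B φ hφ := by
  intro xs m j y hy h1 h2
  refine map_op_of_span A B hφ (span_iUnion_gr A) _ hy h1 h2 (fun xs hxs => ?_) xs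
  obtain ⟨ps, hps, rfl⟩ := exists_pairs A hxs
  have hd : ∀ r, ∀ x ∈ ps.drop r, x.2 ∈ A.gr x.1 := fun r x hx => hps x (List.mem_of_mem_drop hx)
  have hzs' := (List.forall_mem_cons.1 hzs).2
  have hφz' := List.forall_mem_cons.1 hφz
  rw [A.rel_succ ps z zs m e f j k y w t hps hzs hy hw ht h1 h2 h3 h4, map_sub,
    map_relSum A.mem_gr hy h1 h2 hw h3 h4 hps hzs hφz hφw hφt,
    hφt _ e k w hw h3 h4, ← elts_mapPairs, ← elts_mapPairs, mapPairs_cons,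
    B.rel_succ _ (z.1, φ z.2) (mapPairs φ zs) m e f j k _ _ _ (mapPairs_mem A B hφ hps)
      (mapPairs_mem A B hφ hzs)
      (hφ _ _ hy) (hφ _ _ hw) (hφ _ _ ht) h1 h2 h3 h4, map_sum, length_mapPairs]
  congr 1
  refine Finset.sum_congr rfl fun r _ => ?_
  rw [hφz'.1 _ _ _ _ (relSum_mem A.mem_gr hy h1 h2 hw h3 h4 ht (hd r) hzs') (by omega) (by omega),
    map_relSum A.mem_gr hy h1 h2 hw h3 h4 (hd r) hzs' hφz'.2 hφw hφt, take_mapPairs,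
    drop_mapPairs, elts_mapPairs, degs_mapPairs]

theorem op_mem_commuting {φ : V →ₗ[K] V'} (hφ : ∀ n, ∀ x ∈ A.gr n, φ x ∈ B.gr n)
    {k e f : ℕ} {w t : V} (hw : w ∈ A.gr e) (h3 : 1 ≤ k) (h4 : k ≤ e) (ht : t ∈ A.gr f)
    {zs : List (ℕ × V)} (hzs : ∀ x ∈ zs, x.2 ∈ A.gr x.1)
    (hφz : ∀ x ∈ zs, x.2 ∈ commuting A B φ hφ) (hφw : w ∈ commuting A B φ hφ)
    (hφt : t ∈ commuting A B φ hφ) :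
    A.L (elts zs) k w t ∈ commuting A B φ hφ := by
  cases zs with
  | nil => exact op_nil_mem_commuting A B hφ hw h3 h4 ht hφw hφt
  | cons z zs => exact op_cons_mem_commuting A B hφ hw h3 h4 ht hzs hφz hφw hφt

/-- The value of a normal form in a `Prim_psh` algebra. -/
def NormalForm.evalIn (φ : X → V) : NormalForm X → V
  | .gen x => φ x
  | .op _ ts s j x => A.L (List.ofFn fun i => (ts i).evalIn φ) j (s.evalIn φ) (φ x)

theorem NormalForm.evalIn_mem {φ : X → V} (hφ : ∀ x, φ x ∈ A.gr (deg x)) {t : NormalForm X}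
    (ht : t.IsLegal deg) : t.evalIn A φ ∈ A.gr (t.degree deg) := by
  induction t with
  | gen x => exact hφ x
  | op q ts s j x iht ihs =>
    have h := A.mem_gr (List.ofFn fun i => ((ts i).degree deg, (ts i).evalIn A φ)) _ j _ _ _
      (fun p hp => by
        obtain ⟨i, rfl⟩ := (List.mem_ofFn' _ _).1 hp
        exact iht i (ht.1 i)) (ihs ht.2.1) ht.2.2.1 ht.2.2.2 (hφ x)
    have h1 : degs (List.ofFn fun i => ((ts i).degree deg, (ts i).evalIn A φ)) =
        ∑ i, (ts i).degree deg := by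
      simp [degs, List.map_ofFn, Function.comp_def, List.sum_ofFn]
    have h2 : elts (List.ofFn fun i => ((ts i).degree deg, (ts i).evalIn A φ)) =
        List.ofFn fun i => (ts i).evalIn A φ := by
      simp [elts, List.map_ofFn, Function.comp_def]
    rwa [h1, h2] at h

theorem map_evalIn {Φ : V →ₗ[K] V'} (h : A.IsHom B Φ) {φ : X → V}
    (hφ : ∀ x, φ x ∈ A.gr (deg x)) {t : NormalForm X} (ht : t.IsLegal deg) :
    Φ (t.evalIn A φ) = t.evalIn B (Φ ∘ φ) := by
  induction t with
  | gen x => rfl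
  | op q ts s j x iht ihs =>
    rw [NormalForm.evalIn, h.map_op _ _ j _ _ (s.evalIn_mem A hφ ht.2.1) ht.2.2.1 ht.2.2.2,
      ihs ht.2.1, List.map_ofFn]
    simp only [NormalForm.evalIn, Function.comp_def]
    congr 2
    funext i
    exact iht i (ht.1 i)

end Hom

/-- The generators of `𝒫rim_psh(X)`. -/
def primGen (Θ : GradedCoproduct K deg) (x : X) : primPsh Θ := ⟨eElt Θ x, eElt_mem Θ x⟩

theorem primGen_mem (hdeg : ∀ x, 1 ≤ deg x) (Θ : GradedCoproduct K deg) (x : X) :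
    primGen Θ x ∈ (primAlgebra hdeg Θ).gr (deg x) :=
  eElt_mem_homog hdeg Θ x

theorem coe_evalIn_primAlgebra (hdeg : ∀ x, 1 ≤ deg x) (Θ : GradedCoproduct K deg)
    {t : NormalForm X} (ht : t.IsLegal deg) :
    ((t.evalIn (primAlgebra hdeg Θ) (primGen Θ) : primPsh Θ) : WordSpace K X) = t.eval Θ := by
  induction t with
  | gen x => rfl
  | op q ts s j x iht ihs =>
    rw [NormalForm.evalIn, NormalForm.eval]
    refine (coe_primPshOp Θ _ _ (s.evalIn_mem _ (primGen_mem hdeg Θ) ht.2.1) ht.2.2.1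
      ht.2.2.2).trans ?_
    rw [ihs ht.2.1, List.map_ofFn]
    congr 2
    funext i
    exact iht i (ht.1 i)

theorem primEval_eq (hdeg : ∀ x, 1 ≤ deg x) (Θ : GradedCoproduct K deg)
    (t : {t : NormalForm X // t.IsLegal deg}) :
    primEval hdeg Θ t = t.1.evalIn (primAlgebra hdeg Θ) (primGen Θ) :=
  Subtype.ext (coe_evalIn_primAlgebra hdeg Θ t.2).symm

/-- The basis of `𝒫rim_psh(X)` given by normal forms. -/
def primBasis (hdeg : ∀ x, 1 ≤ deg x) (Θ : GradedCoproduct K deg) :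
    Module.Basis {t : NormalForm X // t.IsLegal deg} K (primPsh Θ) :=
  Module.Basis.mk (linearIndependent_primEval hdeg Θ) (span_primEval hdeg Θ).ge

section Lift

variable {W : Type*} [AddCommGroup W] [Module K W] (Q : PrimPshAlgebra K W) {φ : X → W}

/-- The extension of a map on generators to `𝒫rim_psh(X)`. -/
def primLift (hdeg : ∀ x, 1 ≤ deg x) (Θ : GradedCoproduct K deg) (φ : X → W) :
    primPsh Θ →ₗ[K] W :=
  (primBasis hdeg Θ).constr K fun t => t.1.evalIn Q φ

theorem primLift_primEval (hdeg : ∀ x, 1 ≤ deg x) (Θ : GradedCoproduct K deg) (φ : X → W)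
    (t : {t : NormalForm X // t.IsLegal deg}) :
    primLift Q hdeg Θ φ (primEval hdeg Θ t) = t.1.evalIn Q φ := by
  have := (primBasis hdeg Θ).constr_basis K (fun t => t.1.evalIn Q φ) t
  rwa [primBasis, Module.Basis.mk_apply] at this

theorem primLift_mem_gr (hdeg : ∀ x, 1 ≤ deg x) (Θ : GradedCoproduct K deg)
    (hφ : ∀ x, φ x ∈ Q.gr (deg x)) (n : ℕ) (a : primPsh Θ) (ha : a ∈ primPshGr Θ n) :
    primLift Q hdeg Θ φ a ∈ Q.gr n := by
  have h : Submodule.span K (primEval hdeg Θ '' {t | t.1.degree deg = n}) ≤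
      (Q.gr n).comap (primLift Q hdeg Θ φ) := by
    rw [Submodule.span_le]
    rintro _ ⟨t, rfl, rfl⟩
    rw [SetLike.mem_coe, Submodule.mem_comap, primLift_primEval]
    exact t.1.evalIn_mem Q hφ t.2
  exact h (primPshGr_le_span hdeg Θ n ha)

theorem primGen_eq (hdeg : ∀ x, 1 ≤ deg x) (Θ : GradedCoproduct K deg) (x : X) :
    primGen Θ x = primEval hdeg Θ ⟨.gen x, trivial⟩ := rfl

theorem exists_map_primEval (hdeg : ∀ x, 1 ≤ deg x) (Θ : GradedCoproduct K deg)
    {xs : List (primPsh Θ)} (h : ∀ x ∈ xs, x ∈ Set.range (primEval hdeg Θ)) :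
    ∃ ts : List {t : NormalForm X // t.IsLegal deg}, ts.map (primEval hdeg Θ) = xs := by
  rw [← Set.mem_range, Set.range_list_map]
  exact h

/-- By multilinearity the other arguments may be taken to be values of normal forms. The operation
then gives the value of a normal form, on which `primLift` is prescribed to be the evaluation in
`Q`. -/
theorem primGen_mem_commuting (hdeg : ∀ x, 1 ≤ deg x) (Θ : GradedCoproduct K deg)
    (hφ : ∀ x, φ x ∈ Q.gr (deg x)) (x : X) :
    primGen Θ x ∈ commuting (primAlgebra hdeg Θ) Q (primLift Q hdeg Θ φ)
      (primLift_mem_gr Q hdeg Θ hφ) := by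
  intro xs m j y hy h1 h2
  have hgr := primLift_mem_gr Q hdeg Θ hφ
  refine map_op_of_span (primAlgebra hdeg Θ) Q hgr (span_primEval hdeg Θ) _ hy h1 h2
    (fun xs hxs => ?_) xs
  obtain ⟨ts, rfl⟩ := exists_map_primEval hdeg Θ hxs
  -- Expanding `y` in normal forms of the same degree `m` keeps the index `j` legal.
  have hy' := primPshGr_le_span hdeg Θ m hy
  have key : ∀ s : {t : NormalForm X // t.IsLegal deg}, s.1.degree deg = m →
      primLift Q hdeg Θ φ ((primAlgebra hdeg Θ).L (ts.map (primEval hdeg Θ)) j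
        (primEval hdeg Θ s) (primGen Θ x)) =
      Q.L ((ts.map (primEval hdeg Θ)).map (primLift Q hdeg Θ φ)) j
        (primLift Q hdeg Θ φ (primEval hdeg Θ s)) (primLift Q hdeg Θ φ (primGen Θ x)) := by
    rintro s rfl
    have hleg : (NormalForm.op ts.length (fun i => (ts.get i).1) s.1 j x).IsLegal deg :=
      ⟨fun i => (ts.get i).2, s.2, h1, h2⟩
    have h3 := primLift_primEval Q hdeg Θ φ ⟨_, hleg⟩
    rw [primEval_eq] at h3
    simp only [NormalForm.evalIn, ← primEval_eq hdeg Θ] at h3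
    have h4 : (List.ofFn fun i => primEval hdeg Θ (ts.get i)) = ts.map (primEval hdeg Θ) := by
      conv_rhs => rw [← List.ofFn_get ts, List.map_ofFn]
      rfl
    have h5 : (List.ofFn fun i => (ts.get i).1.evalIn Q φ) =
        (ts.map (primEval hdeg Θ)).map (primLift Q hdeg Θ φ) := by
      conv_rhs => rw [← List.ofFn_get ts, List.map_ofFn, List.map_ofFn]
      congr 1
      funext i
      exact (primLift_primEval Q hdeg Θ φ _).symm
    rw [h4, h5] at h3
    rw [h3, primLift_primEval, primGen_eq hdeg, primLift_primEval]
    rfl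
  have hle : ∀ a, a ∈ Submodule.span K (primEval hdeg Θ '' {t | t.1.degree deg = m}) →
      a ∈ primPshGr Θ m := by
    intro a ha
    refine Submodule.span_le.2 ?_ ha
    rintro _ ⟨t, rfl, rfl⟩
    exact primEval_mem hdeg Θ t
  refine Submodule.span_induction (p := fun y _ =>
    primLift Q hdeg Θ φ ((primAlgebra hdeg Θ).L (ts.map (primEval hdeg Θ)) j y (primGen Θ x)) =
      Q.L ((ts.map (primEval hdeg Θ)).map (primLift Q hdeg Θ φ)) j
        (primLift Q hdeg Θ φ y) (primLift Q hdeg Θ φ (primGen Θ x))) ?_ ?_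
    (fun a b ha hb iha ihb => ?_) (fun c a ha iha => ?_) hy'
  · rintro _ ⟨s, hs, rfl⟩
    exact key s hs
  · have h3 := (primAlgebra hdeg Θ).smul_mid (ts.map (primEval hdeg Θ)) m j 0 0 (primGen Θ x)
      (zero_mem _) h1 h2
    have h4 := Q.smul_mid ((ts.map (primEval hdeg Θ)).map (primLift Q hdeg Θ φ)) m j 0 0
      (primLift Q hdeg Θ φ (primGen Θ x)) (zero_mem _) h1 h2
    rw [zero_smul, zero_smul] at h3 h4
    rw [h3, map_zero, h4]
  · rw [(primAlgebra hdeg Θ).add_mid _ m j _ _ _ (hle a ha) (hle b hb) h1 h2, map_add, map_add,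
      Q.add_mid _ m j _ _ _ (hgr m a (hle a ha)) (hgr m b (hle b hb)) h1 h2, iha, ihb]
  · rw [(primAlgebra hdeg Θ).smul_mid _ m j _ _ _ (hle a ha) h1 h2, map_smul, map_smul,
      Q.smul_mid _ m j _ _ _ (hgr m a (hle a ha)) h1 h2, iha]

theorem primEval_mem_commuting (hdeg : ∀ x, 1 ≤ deg x) (Θ : GradedCoproduct K deg)
    (hφ : ∀ x, φ x ∈ Q.gr (deg x)) {t : NormalForm X} (ht : t.IsLegal deg) :
    t.evalIn (primAlgebra hdeg Θ) (primGen Θ) ∈ commuting (primAlgebra hdeg Θ) Q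
      (primLift Q hdeg Θ φ) (primLift_mem_gr Q hdeg Θ hφ) := by
  induction t with
  | gen x => exact primGen_mem_commuting Q hdeg Θ hφ x
  | op q ts s j x iht ihs =>
    have hgen := primGen_mem hdeg Θ
    have h2 : elts (List.ofFn fun i =>
        ((ts i).degree deg, (ts i).evalIn (primAlgebra hdeg Θ) (primGen Θ))) =
        List.ofFn fun i => (ts i).evalIn (primAlgebra hdeg Θ) (primGen Θ) := by
      simp [elts, List.map_ofFn, Function.comp_def]
    rw [NormalForm.evalIn, ← h2]
    refine op_mem_commuting _ Q _ (s.evalIn_mem _ hgen ht.2.1) ht.2.2.1 ht.2.2.2 (hgen x)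
      (fun p hp => ?_) (fun p hp => ?_) (ihs ht.2.1) (primGen_mem_commuting Q hdeg Θ hφ x)
    all_goals obtain ⟨i, rfl⟩ := (List.mem_ofFn' _ _).1 hp
    · exact (ts i).evalIn_mem _ hgen (ht.1 i)
    · exact iht i (ht.1 i)

theorem isHom_primLift (hdeg : ∀ x, 1 ≤ deg x) (Θ : GradedCoproduct K deg)
    (hφ : ∀ x, φ x ∈ Q.gr (deg x)) :
    (primAlgebra hdeg Θ).IsHom Q (primLift Q hdeg Θ φ) where
  map_gr := primLift_mem_gr Q hdeg Θ hφ
  map_op xs m j y z hy h1 h2 := by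
    have h : (⊤ : Submodule K (primPsh Θ)) ≤ commuting (primAlgebra hdeg Θ) Q
        (primLift Q hdeg Θ φ) (primLift_mem_gr Q hdeg Θ hφ) := by
      rw [← span_primEval hdeg Θ, Submodule.span_le]
      rintro _ ⟨t, rfl⟩
      rw [primEval_eq]
      exact primEval_mem_commuting Q hdeg Θ hφ t.2
    exact h (show z ∈ ⊤ from trivial) xs m j y hy h1 h2

/-- Uniqueness: a homomorphism is determined on values of normal forms by its values on the
generators, and these values span. -/
theorem existsUnique_isHom (hdeg : ∀ x, 1 ≤ deg x) (Θ : GradedCoproduct K deg)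
    (hφ : ∀ x, φ x ∈ Q.gr (deg x)) :
    ∃! Φ : primPsh Θ →ₗ[K] W,
      (primAlgebra hdeg Θ).IsHom Q Φ ∧ ∀ x, Φ ⟨eElt Θ x, eElt_mem Θ x⟩ = φ x := by
  refine ⟨primLift Q hdeg Θ φ, ⟨isHom_primLift Q hdeg Θ hφ, fun x =>
    primLift_primEval Q hdeg Θ φ ⟨.gen x, trivial⟩⟩, ?_⟩
  rintro Ψ ⟨hΨ, hΨx⟩
  refine LinearMap.ext_on (span_primEval hdeg Θ) ?_
  rintro _ ⟨t, rfl⟩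
  rw [primLift_primEval, primEval_eq, map_evalIn _ Q hΨ (primGen_mem hdeg Θ) t.2]
  congr 1
  exact funext hΨx

end Lift

end
end Presh

theorem mainTheorem4 {K : Type u} [Field K] {X : Type v} (deg : X → ℕ) (hdeg : ∀ x, 1 ≤ deg x)
    (Θ : Presh.GradedCoproduct K deg) :
    -- the subspace generated by `e(X)` is the space of primitive elements
    Presh.primPsh Θ = Presh.primitives Θ ∧
    -- with the operations `L_q^p` it is the free `Prim_psh` algebra on `X`
    (∃ P : Presh.PrimPshAlgebra K (Presh.primPsh Θ),
      (∀ (n : ℕ) (a : Presh.primPsh Θ),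
        a ∈ P.gr n ↔ (a : Presh.WordSpace K X) ∈ Presh.homog K X n) ∧
      (∀ (xs : List (Presh.primPsh Θ)) (m p : ℕ) (y z : Presh.primPsh Θ),
        y ∈ P.gr m → 1 ≤ p → p ≤ m →
        (P.L xs p y z : Presh.WordSpace K X) = Presh.primOp (xs.map Subtype.val) p y z) ∧
      (∀ x : X, (⟨Presh.eElt Θ x, Presh.eElt_mem Θ x⟩ : Presh.primPsh Θ) ∈ P.gr (deg x)) ∧
      ∀ (W : Type w) [AddCommGroup W] [Module K W] (Q : Presh.PrimPshAlgebra K W) (φ : X → W),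
        (∀ x, φ x ∈ Q.gr (deg x)) →
        ∃! Φ : Presh.primPsh Θ →ₗ[K] W,
          P.IsHom Q Φ ∧ ∀ x, Φ ⟨Presh.eElt Θ x, Presh.eElt_mem Θ x⟩ = φ x) ∧
    -- the set of normal forms is in bijection with the irreducible elements, and is a basis
    Set.BijOn (Presh.NormalForm.alpha deg) {t | t.IsLegal deg}
      {c | Presh.IsKWord deg c ∧ Presh.IsIrr c.word} ∧
    (∀ t : Presh.NormalForm X, t.IsLegal deg → (t.alpha deg).length = t.degree deg) ∧
    LinearIndependent K (fun t : {t : Presh.NormalForm X // t.IsLegal deg} => t.1.eval Θ) ∧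
    Submodule.span K (Presh.NormalForm.eval Θ '' {t | t.IsLegal deg}) = Presh.primPsh Θ :=
  ⟨Presh.primPsh_eq_primitives hdeg Θ,
    ⟨Presh.primAlgebra hdeg Θ, fun _ _ => Iff.rfl,
      fun xs _ _ _ z hy h1 h2 => Presh.coe_primPshOp Θ xs z hy h1 h2,
      Presh.primGen_mem hdeg Θ, fun _ _ _ Q _ hφ => Presh.existsUnique_isHom Q hdeg Θ hφ⟩,
    Presh.bijOn_alpha hdeg, fun t _ => t.length_alpha deg, Presh.linearIndependent_eval hdeg Θ,
    Presh.span_eval_eq_primPsh hdeg Θ⟩
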